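/- **Setting.** There are $n$ experts. On each day $t=1,\dots,T$ an algorithm plays an expert $i_t$, and then losses $\ell_t(e)\in[0,1]$ of the experts are revealed. The loss vectors are fixed in advance (oblivious adversary). The regret is $\sum_{t\le T}\ell_t(i_t)-\min_e\sum_{t\le T}\ell_t(e)$. **Algorithm (hierarchical baseline).** Parameters: a space parameter $m\ge1$, a number of levels $k\ge 1$, and integer block sizes $0<S_0<S_1<\dots<S_k$ with $S_{i}\mid S_{i+1}$; put $\epsilon=\log(S_k)/m$. There are buckets $B_0,\dots,B_{k-1}$ of entries (expert, arrival time, loss since arrival, weight); an expert may occur in several entries. For $1\le i<k$ there is a pair of external weights $(w_i,w_i')$. An entry $e'$ *dominates* an entry $e$ if $e'$ arrived earlier and the loss of $e'$ since its own arrival is at most $1+\epsilon$ times the loss of $e$ since its own arrival. *Prediction on day $t$.* For each $i$ pick $e_i$ from $B_i$ with probability proportional to the weights. Put $y_0=e_0$, and for $1\le i<k$ let $y_i=e_i$ with probability $w_i/(w_i+w_i')$ and $y_i=y_{i-1}$ otherwise. Play $y_{k-1}$. *Weights.* After the losses of day $t$ are observed, in each entry of $B_i$, with expert $e$, increase the loss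 by $\ell_t(e)$ and multiply the weight by $\exp(-\sqrt{\log|B_i|/S_i}\;\ell_t(e))$; for $1\le i<k$ multiply $w_i$ by $\exp(-\sqrt{2/S_i}\;\ell_t(e_i))$ and $w'_i$ by $\exp(-\sqrt{2/S_i}\;\ell_t(y_{i-1}))$. *Buckets.* At time $t=0$ (with empty buckets) and at the end of each day $t$ divisible by $S_0$, let $k'$ be the largest $i<k$ with $S_i\mid t$, and $\tau$ the largest multiple of $S_{k'+1}$ that is at most $t$. (1) For $i\le k'$, remove from $B_i$ every entry with arrival time at least $\tau+\frac12$ that is dominated by some entry of $B_i$ (all removals simultaneous), and reset to $1$ the weights in $B_i$ and, if $i\ge 1$, the pair $(w_i,w_i')$. (2) For $i=k',k'-1,\dots,1$, add to $B_i$ a copy of each entry of $B_0,\dots,B_{i-1}$, with distinct arrival times in $[t,t+\frac12)$, loss $0$ and weight $1$. (3) For $i\le k'$, sample $m$ experts independently and uniformly with replacement and add them to $B_i$ with distinct arrival times in $[t+\frac12,t+1)$, loss $0$ and weight $1$. All random choices are independent. **Choice of parameters.** Let $x=Tm/n$. For given $k$ put $T_{-1}=1$, $T_0=x^{2^k/(2^{k+1}-1)}$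 and $T_i=T_{i-1}^{3/2}/\sqrt{T_{i-2}}$ for $1\le i\le k-1$. For a constant $b$, call $(k;S_0,\dots,S_k)$ *prescribed* if $k\ge1$, $|k-\log_2\log_2x|\le b$, the $S_i$ are legal block sizes as above, $\frac12T_i\le S_i\le 2T_i$ for $0\le i\le k-1$, and $S_k$ is the least multiple of $S_{k-1}$ that is at least $T$ (so $S_k=T$ if $S_{k-1}\mid T$). **Theorem.** There are absolute constants $C>0$, $b$, $p$ such that the following holds. 1. For all integers $1\le m\le n$ and $T\ge C\frac nm$, prescribed parameters $(k;S_0,\dots,S_k)$ exist. 2. For every $\gamma>0$ there is a constant $A$ such that for all integers $1\le m\le n$ and $T\ge C\frac nm$, all prescribed parameters, and all loss vectors $\ell_1,\dots,\ell_T\in[0,1]^n$, the hierarchical baseline with these parameters, run for $T$ days, has with probability at least $1-T^{-\gamma}$ regret at most $$A\,\bigl(\log(nT)\bigr)^p\left(\frac Tm+\sqrt{\frac{Tn}{m}}\right),$$ that is, regret $\tilde O\bigl(\frac Tm+\sqrt{Tn/m}\bigr)$ with high probability in $T$. -/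

import Mathlib

/-! Prediction with expert advice: `n` experts (the elements of `Fin n`), days `1, 2, …`, and the
algorithm `HierarchicalBaseline`, which runs `k` buckets `B 0, …, B (k-1)` with block sizes
`S 0 < S 1 < … < S k`.  Objects indexed by a level are functions on `ℕ`, of which only the values
at the levels `0, …, k-1` (for `S`: `0, …, k`) are used. -/

namespace HierBaseline

open scoped ENNReal

noncomputable section

/-- One entry of a bucket: an expert with its arrival time, its loss since the arrival, and its
(internal) weight. Several entries of a bucket may hold the same expert. -/
structure Entry (n : ℕ) where
  expert : Fin n
  arrival : ℝ
  loss : ℝ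
  weight : ℝ

/-- The entry `e'` `ε`-dominates the entry `e`. -/
def Dominates {n : ℕ} (ε : ℝ) (e' e : Entry n) : Prop :=
  e'.arrival < e.arrival ∧ e'.loss ≤ (1 + ε) * e.loss

/-- The memory of the algorithm (buckets and external weights), together with a record of the
experts played so far. For `1 ≤ i < k` the pair `ext i = (w, w')` holds the weights of the two-expert
multiplicative weights instance of level `i`: `w` belongs to bucket `i`, and `w'` to the combined
prediction of the levels below `i`. -/
structure State (n : ℕ) where
  buckets : ℕ → List (Entry n)
  ext : ℕ → ℝ × ℝ
  play : ℕ → Fin n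

/-- Choose an element of a list of pairs (element, weight) with probability proportional to its
weight. If no weight is positive the choice is `default`; this does not happen in the algorithm,
whose buckets are never empty and whose weights are positive. -/
def weightedChoice {α : Type} [Inhabited α] (l : List (α × ℝ)) : PMF α :=
  open Classical in
  if h : (∑' j : Fin l.length, ENNReal.ofReal (l.get j).2) ≠ 0 then
    (PMF.normalize (fun j : Fin l.length => ENNReal.ofReal (l.get j).2) h
      (by rw [tsum_fintype]; exact ENNReal.sum_ne_top.2 fun _ _ => ENNReal.ofReal_ne_top)).map
        (fun j => (l.get j).1)
  else PMF.pure default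

/-- The random choices of one day: `own i` is the expert picked from bucket `i`, and `pred i` is the
combined prediction of the levels `0, …, i`. -/
structure Predictions (n : ℕ) where
  own : ℕ → Fin n
  pred : ℕ → Fin n

/-- `GetPredictions` for the levels `0, …, i`. -/
def getPredictions {n : ℕ} [NeZero n] (s : State n) : ℕ → PMF (Predictions n)
  | 0 => do
      let e ← weightedChoice ((s.buckets 0).map fun x => (x.expert, x.weight))
      pure ⟨fun _ => e, fun _ => e⟩
  | i + 1 => do
      let q ← getPredictions s i
      let e ← weightedChoice ((s.buckets (i + 1)).map fun x => (x.expert, x.weight))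
      let y ← weightedChoice [(e, (s.ext (i + 1)).1), (q.pred i, (s.ext (i + 1)).2)]
      pure ⟨Function.update q.own (i + 1) e, Function.update q.pred (i + 1) y⟩

/-- Learning rate inside bucket `i`. -/
def innerRate {n : ℕ} (S : ℕ → ℕ) (i : ℕ) (B : List (Entry n)) : ℝ :=
  √(Real.log B.length / S i)

/-- Learning rate of the two-expert instance of level `i`. -/
def outerRate (S : ℕ → ℕ) (i : ℕ) : ℝ := √(2 / S i)

/-- `UpdateWeights`, with the multiplicative update `w ↦ w * exp (-η * loss)`; `l` is the loss
vector of the day. -/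
def updateWeights {n : ℕ} (S : ℕ → ℕ) (l : Fin n → ℝ) (q : Predictions n) (s : State n) :
    State n where
  buckets i := (s.buckets i).map fun x =>
    { x with
      loss := x.loss + l x.expert
      weight := x.weight * Real.exp (-(innerRate S i (s.buckets i)) * l x.expert) }
  ext i :=
    ((s.ext i).1 * Real.exp (-(outerRate S i) * l (q.own i)),
     (s.ext i).2 * Real.exp (-(outerRate S i) * l (q.pred (i - 1))))
  play := s.play

/-- Eviction from one bucket: an entry which arrived at time at least `τ + 1/2` and is `ε`-dominated
by some entry of the bucket is removed. The weights of the remaining entries are set to `1`. -/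
def evict {n : ℕ} (ε : ℝ) (τ : ℕ) (B : List (Entry n)) : List (Entry n) :=
  open Classical in
  (B.filter fun e => decide
    (¬ ((τ : ℝ) + 1 / 2 ≤ e.arrival ∧ ∃ e' ∈ B, Dominates ε e' e))).map
      fun e => { e with weight := 1 }

/-- Fresh entries for the given experts, with loss `0`, weight `1` and distinct arrival times in
`[a, a + 1/2)`. -/
def arrivals {n : ℕ} (a : ℝ) (es : List (Fin n)) : List (Entry n) :=
  es.mapIdx fun j e => ⟨e, a + (j : ℝ) / (2 * es.length), 0, 1⟩

/-- All random samples of experts: for every time `0, …, N`, every level and every one of the `m`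
slots an expert. -/
abbrev Samples (n m k N : ℕ) : Type := Fin (N + 1) → Fin k → Fin m → Fin n

/-- The `m` experts sampled at time `t` for bucket `i`. -/
def Samples.at {n m k N : ℕ} (ω : Samples n m k N) (t i : ℕ) : List (Fin n) :=
  if h : t < N + 1 ∧ i < k then List.ofFn (ω ⟨t, h.1⟩ ⟨i, h.2⟩) else []

/-- The largest level `i < k` whose bucket is updated at time `t`. -/
def topLevel (S : ℕ → ℕ) (k t : ℕ) : ℕ := Nat.findGreatest (fun i => S i ∣ t) (k - 1)

/-- `UpdateBuckets` at time `t`: evict in the buckets `0, …, k'`, then copy to each bucket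
`i = k', …, 1` all entries of the buckets below `i`, then add the sampled experts. The external
weights of the levels `0, …, k'` are reset. -/
def updateBuckets {n m N : ℕ} (S : ℕ → ℕ) (k : ℕ) (ω : Samples n m k N) (t : ℕ) (s : State n) :
    State n :=
  let ε : ℝ := Real.log (S k) / m
  let k' := topLevel S k t
  let τ := t / S (k' + 1) * S (k' + 1)
  let kept : ℕ → List (Entry n) := fun i => evict ε τ (s.buckets i)
  { buckets := fun i =>
      if i ≤ k' then
        kept i
          ++ arrivals t (((List.range i).flatMap kept).map Entry.expert)
          ++ arrivals (t + 1 / 2) (ω.at t i)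
      else s.buckets i
    ext := fun i => if i ≤ k' then (1, 1) else s.ext i
    play := s.play }

/-- Day `t` of `HierarchicalBaseline`: predict, play, observe the losses, update. -/
def day {n m N : ℕ} [NeZero n] (S : ℕ → ℕ) (k : ℕ) (ω : Samples n m k N) (ℓ : ℕ → Fin n → ℝ)
    (t : ℕ) (s : State n) : PMF (State n) := do
  let q ← getPredictions s (k - 1)
  let s₁ : State n := { s with play := Function.update s.play t (q.pred (k - 1)) }
  let s₂ := updateWeights S (ℓ t) q s₁
  pure (if S 0 ∣ t then updateBuckets S k ω t s₂ else s₂)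

/-- The state after days `1, …, t`, for given samples of experts. -/
def runDays {n m N : ℕ} [NeZero n] (S : ℕ → ℕ) (k : ℕ) (ω : Samples n m k N)
    (ℓ : ℕ → Fin n → ℝ) : ℕ → PMF (State n)
  | 0 => pure (updateBuckets S k ω 0 ⟨fun _ => [], fun _ => (1, 1), fun _ => default⟩)
  | t + 1 => do
      let s ← runDays S k ω ℓ t
      day S k ω ℓ (t + 1) s

/-- The law of the experts played (`t ↦` expert of day `t`) when `HierarchicalBaseline` with block
sizes `S 0, …, S k` and space parameter `m` is run on the loss sequence `ℓ` for `T` days. All experts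
sampled by the algorithm are independent and uniform. -/
def hierarchicalBaseline (n m : ℕ) [NeZero n] (k : ℕ) (S : ℕ → ℕ) (ℓ : ℕ → Fin n → ℝ) (T : ℕ) :
    PMF (ℕ → Fin n) := do
  let ω ← PMF.uniformOfFintype (Samples n m k (S k))
  let s ← runDays S k ω ℓ T
  pure s.play

/-- The regret of the plays `a 1, …, a T` against the best single expert. -/
def regret {n : ℕ} (ℓ : ℕ → Fin n → ℝ) (T : ℕ) (a : ℕ → Fin n) : ℝ :=
  (∑ t ∈ Finset.Icc 1 T, ℓ t (a t)) - ⨅ e : Fin n, ∑ t ∈ Finset.Icc 1 T, ℓ t e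

/-- The real numbers `T_0 = x^(2^k / (2^(k+1) - 1))` and `T_i = T_{i-1}^(3/2) / √T_{i-2}`, where
`T_{-1} = 1`. -/
def idealBlock (x : ℝ) (k : ℕ) : ℕ → ℝ
  | 0 => x ^ ((2 : ℝ) ^ k / (2 ^ (k + 1) - 1))
  | 1 => idealBlock x k 0 ^ (3 / 2 : ℝ) / √1
  | i + 2 => idealBlock x k (i + 1) ^ (3 / 2 : ℝ) / √(idealBlock x k i)

/-- Legal integer block sizes `S 0 < … < S k` (each dividing the next) which follow the prescription
with `x = T m / n`: the number `k` of levels is `log₂ log₂ x` up to the additive constant `b`, the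
size `S i`, `i < k`, is `T_i` rounded within a factor `2`, and `S k` is the least multiple of
`S (k-1)` which is at least `T`; so `S k = T` if `S (k-1)` divides `T`. -/
structure PrescribedBlocks (b : ℝ) (n m T k : ℕ) (S : ℕ → ℕ) : Prop where
  levels_pos : 1 ≤ k
  levels : |(k : ℝ) - Real.logb 2 (Real.logb 2 ((T : ℝ) * m / n))| ≤ b
  size_pos : 0 < S 0
  strict : ∀ i < k, S i < S (i + 1)
  dvd : ∀ i < k, S i ∣ S (i + 1)
  lower : ∀ i < k, idealBlock ((T : ℝ) * m / n) k i ≤ 2 * S i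
  upper : ∀ i < k, (S i : ℝ) ≤ 2 * idealBlock ((T : ℝ) * m / n) k i
  le_horizon : T ≤ S k
  horizon_lt : S k < T + S (k - 1)

end

end HierBaseline

/-! The expert samples are drawn first. Given them the buckets are deterministic, because weights,
losses and evictions never look at the predictions. Only the daily predictions stay random, and
`histLaw` is their law.

Predictions. In every block of every level, realised losses exceed their conditional means by at
most about L√S_i, by an exponential supermartingale (`histLaw_deviation`). With the multiplicative
weights bound this gives, for a block of level i: the combined prediction of levels up to i competes
with each expert that is in bucket i at the start, and with the combined prediction of the levels
below, at additive cost √S_i · D (`Concentrated.sum_pred_le_expert`,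
`Concentrated.sum_pred_le_pred`).

Samples. Let e be the best expert; the adversary is oblivious, so e is fixed in advance. Suppose a
copy of e arriving in bucket i on day b would be evicted later, at time t. Then its dominator is an
expert c that was present at b, stays until t, and loses at most 1+ε times as much as e on the way:
a `Cover` of b (`exists_cover_of_not_live`). If it would never be evicted, b is live, and each of
the m samples is e with probability 1/n; after one hit e stays and covers all later starts. Liveness
at a slot depends only on earlier arrivals and lower levels (`Live.congr`), so these are sequential
trials, and about (n/m)L starts per level can be uncovered with high probability
(`toOuterMeasure_uncovered_le`).

Combination. Walk from 0, jumping along the cover of highest level at each stop, or by S_0 with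
comparator e if there is none. The comparators lose at most 1+ε times the loss of e in total. The
epoch rule of the evictions makes the jumps fit the tree of blocks. Descend this tree from the top
level: a block that is not split has a single comparator, available in its bucket
(`IsCoverWalk.exists_comparator`), and costs √S_i · D. A split block starts at an uncovered time and
passes to its children, at extra cost S_{i+1}/√S_i · D, or S_0 at the bottom. Summation is
`total_loss_le`.

Parameters. The recursion for T_i makes T_{i+1}/√T_i equal to T_0 at all levels, T_0 is about √x and
T_{k-1} about x once k is within a constant of log log x. The three costs then are εT ~ T/m, T/√x =
√(Tn/m) and (n/m)√x = √(Tn/m), up to logarithms. -/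

namespace HierBaseline

open scoped ENNReal

noncomputable section

/-! ### Expectations with respect to a `PMF` -/

/-- The expectation of an extended nonnegative function. -/
def pexp {α : Type} (p : PMF α) (f : α → ℝ≥0∞) : ℝ≥0∞ := ∑' a, p a * f a

section pexp

variable {α β : Type}

lemma pexp_pure (a : α) (f : α → ℝ≥0∞) : pexp (PMF.pure a) f = f a := by
  classical
  unfold pexp
  rw [tsum_eq_single a]
  · simp
  · intro b hb
    simp [PMF.pure_apply, hb]

lemma pexp_bind (p : PMF α) (q : α → PMF β) (f : β → ℝ≥0∞) :
    pexp (p.bind q) f = pexp p fun a => pexp (q a) f := by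
  simp only [pexp, PMF.bind_apply, ← ENNReal.tsum_mul_left, ← ENNReal.tsum_mul_right]
  rw [ENNReal.tsum_comm]
  simp only [mul_assoc]

lemma pexp_map (p : PMF α) (g : α → β) (f : β → ℝ≥0∞) :
    pexp (p.map g) f = pexp p fun a => f (g a) := by
  rw [PMF.map, pexp_bind]
  simp only [Function.comp_apply, pexp_pure]

lemma pexp_mono (p : PMF α) {f g : α → ℝ≥0∞} (h : ∀ a, f a ≤ g a) : pexp p f ≤ pexp p g :=
  ENNReal.tsum_le_tsum fun a => by gcongr; exact h a

lemma pexp_const (p : PMF α) (c : ℝ≥0∞) : pexp p (fun _ => c) = c := by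
  rw [pexp, ENNReal.tsum_mul_right, p.tsum_coe, one_mul]

lemma pexp_const_mul (p : PMF α) (c : ℝ≥0∞) (f : α → ℝ≥0∞) :
    pexp p (fun a => c * f a) = c * pexp p f := by
  simp only [pexp, ← ENNReal.tsum_mul_left, mul_left_comm]

lemma pexp_add (p : PMF α) (f g : α → ℝ≥0∞) :
    pexp p (fun a => f a + g a) = pexp p f + pexp p g := by
  simp only [pexp, mul_add, ENNReal.tsum_add]

lemma toOuterMeasure_eq_pexp (p : PMF α) (s : Set α) :
    p.toOuterMeasure s = pexp p (s.indicator 1) := by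
  classical
  rw [PMF.toOuterMeasure_apply, pexp]
  refine tsum_congr fun a => ?_
  by_cases h : a ∈ s <;> simp [h]

lemma toOuterMeasure_add_compl (p : PMF α) (s : Set α) :
    p.toOuterMeasure s + p.toOuterMeasure sᶜ = 1 := by
  classical
  rw [toOuterMeasure_eq_pexp, toOuterMeasure_eq_pexp, ← pexp_add]
  rw [← pexp_const p 1]
  congr 1
  funext a
  by_cases h : a ∈ s <;> simp [h]

/-- Exponential Markov inequality. -/
lemma toOuterMeasure_le_exp_neg (p : PMF α) (X : α → ℝ) (c : ℝ)
    (h : pexp p (fun a => ENNReal.ofReal (Real.exp (X a))) ≤ 1) :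
    p.toOuterMeasure {a | c ≤ X a} ≤ ENNReal.ofReal (Real.exp (-c)) := by
  classical
  rw [toOuterMeasure_eq_pexp]
  have h1 : ∀ a, ({a | c ≤ X a} : Set α).indicator (1 : α → ℝ≥0∞) a ≤
      ENNReal.ofReal (Real.exp (-c)) * ENNReal.ofReal (Real.exp (X a)) := by
    intro a
    by_cases ha : c ≤ X a
    · rw [Set.indicator_of_mem (by exact ha), ← ENNReal.ofReal_mul (Real.exp_nonneg _),
        ← Real.exp_add, Pi.one_apply, ← ENNReal.ofReal_one]
      apply ENNReal.ofReal_le_ofReal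
      rw [← Real.exp_zero]
      apply Real.exp_le_exp.2
      linarith
    · rw [Set.indicator_of_notMem (by exact ha)]
      exact zero_le
  refine (pexp_mono p h1).trans ?_
  rw [pexp_const_mul]
  exact mul_le_of_le_one_right' h

end pexp

/-! ### Weighted choice -/

/-- The mean of `g` when the elements of `l` are chosen proportionally to their weights. -/
def wavg {α : Type} (l : List (α × ℝ)) (g : α → ℝ) : ℝ :=
  (l.map fun x => x.2 * g x.1).sum / (l.map Prod.snd).sum

lemma list_sum_pos {α : Type} {l : List α} (f : α → ℝ) (hl : l ≠ [])
    (hf : ∀ x ∈ l, 0 < f x) : 0 < (l.map f).sum := by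
  apply List.sum_pos
  · intro y hy
    obtain ⟨x, hx, rfl⟩ := List.mem_map.1 hy
    exact hf x hx
  · simpa using hl

lemma pexp_weightedChoice_le {α : Type} [Inhabited α] (l : List (α × ℝ)) (hl : l ≠ [])
    (hpos : ∀ x ∈ l, 0 < x.2) (f : α → ℝ) (hf : ∀ a, 0 ≤ f a)
    (h : (l.map fun x => x.2 * f x.1).sum ≤ (l.map Prod.snd).sum) :
    pexp (weightedChoice l) (fun a => ENNReal.ofReal (f a)) ≤ 1 := by
  have hW : 0 < (l.map Prod.snd).sum := list_sum_pos _ hl hpos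
  have hp : ∀ j : Fin l.length, 0 < (l.get j).2 := fun j => hpos _ (List.get_mem l j)
  have hsum : (∑' j : Fin l.length, ENNReal.ofReal (l.get j).2) =
      ENNReal.ofReal (l.map Prod.snd).sum := by
    rw [tsum_fintype, ← ENNReal.ofReal_sum_of_nonneg fun j _ => (hp j).le]
    congr 1
    exact Fin.sum_univ_fun_getElem l Prod.snd
  have h0 : (∑' j : Fin l.length, ENNReal.ofReal (l.get j).2) ≠ 0 := by
    rw [hsum]
    simpa using hW
  unfold weightedChoice
  rw [dif_pos h0, pexp_map, pexp, tsum_fintype]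
  simp only [PMF.normalize_apply, hsum]
  have : ∀ j : Fin l.length, ENNReal.ofReal (l.get j).2 *
      (ENNReal.ofReal (l.map Prod.snd).sum)⁻¹ * ENNReal.ofReal (f (l.get j).1) =
      ENNReal.ofReal ((l.get j).2 * f (l.get j).1) *
        (ENNReal.ofReal (l.map Prod.snd).sum)⁻¹ := by
    intro j
    rw [ENNReal.ofReal_mul (hp j).le]
    ring
  rw [Finset.sum_congr rfl fun j _ => this j, ← Finset.sum_mul,
    ← ENNReal.ofReal_sum_of_nonneg fun j _ => mul_nonneg (hp j).le (hf _)]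
  have h2 : ∑ j : Fin l.length, (l.get j).2 * f (l.get j).1 =
      (l.map fun x => x.2 * f x.1).sum :=
    Fin.sum_univ_fun_getElem l fun x => x.2 * f x.1
  rw [h2, ← div_eq_mul_inv]
  apply ENNReal.div_le_of_le_mul
  rw [one_mul]
  exact ENNReal.ofReal_le_ofReal h

lemma wavg_mem {α : Type} (l : List (α × ℝ)) (hl : l ≠ []) (hpos : ∀ x ∈ l, 0 < x.2) (g : α → ℝ)
    (hg : ∀ a, g a ∈ Set.Icc (0 : ℝ) 1) : wavg l g ∈ Set.Icc (0 : ℝ) 1 := by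
  have hW : 0 < (l.map Prod.snd).sum := list_sum_pos _ hl hpos
  refine ⟨div_nonneg (List.sum_nonneg ?_) hW.le, (div_le_one hW).2 (List.sum_le_sum ?_)⟩
  · intro y hy
    obtain ⟨x, hx, rfl⟩ := List.mem_map.1 hy
    exact mul_nonneg (hpos x hx).le (hg _).1
  · intro x hx
    exact mul_le_of_le_one_right (hpos x hx).le (hg _).2

/-- This is e^y ≤ 1 + y + y² for |y| ≤ 1, which is where `lam ≤ 1` is used. The right side is affine
in `z`, so its weighted mean can be computed exactly. -/
lemma exp_mul_sub_sq_le {lam z : ℝ} (h0 : 0 ≤ lam) (h1 : lam ≤ 1) (hz : |z| ≤ 1) :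
    Real.exp (lam * z - lam ^ 2) ≤ (1 + lam * z + lam ^ 2) * Real.exp (-lam ^ 2) := by
  have hz' : |lam * z| ≤ 1 := by
    rw [abs_mul, abs_of_nonneg h0]
    exact mul_le_one₀ h1 (abs_nonneg _) hz
  have h2 := (abs_le.1 (Real.abs_exp_sub_one_sub_id_le hz')).2
  have h3 : (lam * z) ^ 2 ≤ lam ^ 2 := by
    rw [mul_pow]
    exact mul_le_of_le_one_right (sq_nonneg _) ((sq_le_one_iff_abs_le_one z).2 hz)
  rw [sub_eq_add_neg, Real.exp_add]
  gcongr
  linarith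

/-- Exponential moment of a bounded function of a weighted choice. -/
lemma pexp_weightedChoice_exp_le {α : Type} [Inhabited α] (l : List (α × ℝ)) (hl : l ≠ [])
    (hpos : ∀ x ∈ l, 0 < x.2) (g : α → ℝ) (hg : ∀ a, g a ∈ Set.Icc (0 : ℝ) 1) {lam : ℝ}
    (h0 : 0 ≤ lam) (h1 : lam ≤ 1) :
    pexp (weightedChoice l)
      (fun a => ENNReal.ofReal (Real.exp (lam * (g a - wavg l g) - lam ^ 2))) ≤ 1 := by
  have hW : 0 < (l.map Prod.snd).sum := list_sum_pos _ hl hpos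
  have hm := wavg_mem l hl hpos g hg
  refine pexp_weightedChoice_le l hl hpos _ (fun a => Real.exp_nonneg _) ?_
  have key : (l.map fun x => x.2 * Real.exp (lam * (g x.1 - wavg l g) - lam ^ 2)).sum ≤
      (l.map fun x => x.2 * ((1 + lam * (g x.1 - wavg l g) + lam ^ 2) *
        Real.exp (-lam ^ 2))).sum := by
    refine List.sum_le_sum fun x hx => ?_
    refine mul_le_mul_of_nonneg_left (exp_mul_sub_sq_le h0 h1 ?_) (hpos x hx).le
    have := hg x.1
    rw [abs_le]
    constructor <;> linarith [this.1, this.2, hm.1, hm.2]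
  refine key.trans ?_
  have e1 : ∀ (c d : ℝ), (l.map fun x => x.2 * ((1 + lam * (g x.1 - c) + lam ^ 2) * d)).sum =
      d * ((1 + lam ^ 2 - lam * c) * (l.map Prod.snd).sum +
        lam * (l.map fun x => x.2 * g x.1).sum) := by
    intro c d
    rw [← List.sum_map_mul_left, ← List.sum_map_mul_left, ← List.sum_map_add,
      ← List.sum_map_mul_left]
    congr 1
    apply List.map_congr_left
    intro x _
    ring
  have e2 : (l.map fun x => x.2 * g x.1).sum = wavg l g * (l.map Prod.snd).sum := by
    rw [wavg, div_mul_cancel₀ _ hW.ne']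
  rw [e1, e2]
  -- The linear term is centred and averages out; only this factor remains.
  have e3 : (1 + lam ^ 2) * Real.exp (-lam ^ 2) ≤ 1 := by
    have := Real.add_one_le_exp (lam ^ 2)
    calc (1 + lam ^ 2) * Real.exp (-lam ^ 2) ≤ Real.exp (lam ^ 2) * Real.exp (-lam ^ 2) := by
          gcongr; linarith
      _ = 1 := by rw [← Real.exp_add]; simp
  nlinarith [mul_le_mul_of_nonneg_right e3 hW.le]

/-! ### Multiplicative weights -/

/-- The regret bound of multiplicative weights with losses in `[0,1]`. -/
lemma multiplicative_weights {J : Type} [Fintype J] (g : ℕ → J → ℝ)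
    (r : ℕ) (hg : ∀ u < r, ∀ j, g u j ∈ Set.Icc (0 : ℝ) 1) {η : ℝ} (hη : 0 ≤ η) (j₀ : J) :
    η * ∑ u ∈ Finset.range r,
        (∑ j, Real.exp (-η * ∑ v ∈ Finset.range u, g v j) * g u j) /
          (∑ j, Real.exp (-η * ∑ v ∈ Finset.range u, g v j)) ≤
      η * ∑ u ∈ Finset.range r, g u j₀ + Real.log (Fintype.card J) + η ^ 2 * r := by
  have hne : (Finset.univ : Finset J).Nonempty := ⟨j₀, Finset.mem_univ _⟩
  have hWpos : ∀ u, 0 < ∑ j, Real.exp (-η * ∑ v ∈ Finset.range u, g v j) := fun u =>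
    Finset.sum_pos (fun j _ => Real.exp_pos _) hne
  -- The logarithm of the total weight is the potential: each day it falls by `η` times the mean
  -- loss, up to an error η².
  have main : ∀ u ≤ r, Real.log (∑ j, Real.exp (-η * ∑ v ∈ Finset.range u, g v j)) +
      η * ∑ w ∈ Finset.range u,
        (∑ j, Real.exp (-η * ∑ v ∈ Finset.range w, g v j) * g w j) /
          (∑ j, Real.exp (-η * ∑ v ∈ Finset.range w, g v j)) ≤
      Real.log (Fintype.card J) + η ^ 2 * u := by
    intro u
    induction u with
    | zero => intro _; simp
    | succ u ih =>
      intro hu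
      have ih := ih (by omega)
      set W := ∑ j, Real.exp (-η * ∑ v ∈ Finset.range u, g v j) with hW
      set G := ∑ j, Real.exp (-η * ∑ v ∈ Finset.range u, g v j) * g u j with hG
      have hWp : 0 < W := hWpos u
      have step : ∑ j, Real.exp (-η * ∑ v ∈ Finset.range (u + 1), g v j) ≤
          W * Real.exp (-η * (G / W) + η ^ 2) := by
        have : ∀ j, Real.exp (-η * ∑ v ∈ Finset.range (u + 1), g v j) ≤
            Real.exp (-η * ∑ v ∈ Finset.range u, g v j) * (1 + η ^ 2) -
              η * (Real.exp (-η * ∑ v ∈ Finset.range u, g v j) * g u j) := by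
          intro j
          rw [Finset.sum_range_succ, mul_add, Real.exp_add]
          have hgj := hg u (by omega) j
          have hx : 0 ≤ η * g u j := mul_nonneg hη hgj.1
          -- From e^{-y} ≤ 1/(1+y) ≤ 1 - y + y², valid for all y ≥ 0. No upper bound on `η` is
          -- assumed, since the inner rate √(log|B|/S) may exceed 1.
          have h2 : Real.exp (-η * g u j) ≤ 1 - η * g u j + η ^ 2 := by
            have h3 : (η * g u j) ^ 2 ≤ η ^ 2 := by
              rw [mul_pow]
              exact mul_le_of_le_one_right (sq_nonneg _) (pow_le_one₀ hgj.1 hgj.2)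
            have h4 : Real.exp (-(η * g u j)) ≤ 1 - η * g u j + (η * g u j) ^ 2 := by
              have h5 : 1 + η * g u j ≤ Real.exp (η * g u j) := by
                linarith [Real.add_one_le_exp (η * g u j)]
              rw [Real.exp_neg]
              have h6 : (Real.exp (η * g u j))⁻¹ ≤ (1 + η * g u j)⁻¹ := by
                gcongr
              refine h6.trans ?_
              rw [inv_le_iff_one_le_mul₀ (by linarith)]
              nlinarith [pow_nonneg hx 3]
            rw [neg_mul]
            linarith
          have := mul_le_mul_of_nonneg_left h2
            (Real.exp_nonneg (-η * ∑ v ∈ Finset.range u, g v j))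
          linarith
        calc _ ≤ ∑ j, (Real.exp (-η * ∑ v ∈ Finset.range u, g v j) * (1 + η ^ 2) -
              η * (Real.exp (-η * ∑ v ∈ Finset.range u, g v j) * g u j)) :=
              Finset.sum_le_sum fun j _ => this j
          _ = W * (1 + η ^ 2) - η * G := by
              rw [Finset.sum_sub_distrib, ← Finset.sum_mul, ← Finset.mul_sum]
          _ = W * ((-η * (G / W) + η ^ 2) + 1) := by field_simp; ring
          _ ≤ _ := by gcongr; exact Real.add_one_le_exp _
      have hlog := Real.log_le_log (hWpos (u + 1)) step
      rw [Real.log_mul hWp.ne' (Real.exp_ne_zero _), Real.log_exp] at hlog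
      rw [Finset.sum_range_succ, ← hG, ← hW]
      push_cast
      linarith
  have h1 := main r le_rfl
  have h2 : -η * ∑ u ∈ Finset.range r, g u j₀ ≤
      Real.log (∑ j, Real.exp (-η * ∑ v ∈ Finset.range r, g v j)) := by
    rw [← Real.log_exp (-η * ∑ u ∈ Finset.range r, g u j₀)]
    apply Real.log_le_log (Real.exp_pos _)
    exact Finset.single_le_sum (f := fun j => Real.exp (-η * ∑ v ∈ Finset.range r, g v j))
      (fun j _ => Real.exp_nonneg _) (Finset.mem_univ j₀)
  linarith

/-! ### Histories of predictions -/

section history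

variable {n m N : ℕ} [NeZero n] (S : ℕ → ℕ) (k : ℕ) (ω : Samples n m k N) (ℓ : ℕ → Fin n → ℝ)

/-- The state after day `t`, for given predictions `h u` of the days `u`. -/
def stateOf (h : ℕ → Predictions n) : ℕ → State n
  | 0 => updateBuckets S k ω 0 ⟨fun _ => [], fun _ => (1, 1), fun _ => default⟩
  | t + 1 =>
    let s := stateOf h t
    let s₂ := updateWeights S (ℓ (t + 1)) (h (t + 1))
      { s with play := Function.update s.play (t + 1) ((h (t + 1)).pred (k - 1)) }
    if S 0 ∣ t + 1 then updateBuckets S k ω (t + 1) s₂ else s₂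

/-- The law of the predictions of the days `1, …, t`. -/
def histLaw : ℕ → PMF (ℕ → Predictions n)
  | 0 => PMF.pure fun _ => ⟨fun _ => default, fun _ => default⟩
  | t + 1 => (histLaw t).bind fun h =>
      (getPredictions (stateOf S k ω ℓ h t) (k - 1)).map fun q => Function.update h (t + 1) q

lemma stateOf_congr {h h' : ℕ → Predictions n} {t : ℕ} (H : ∀ u ≤ t, h u = h' u) :
    stateOf S k ω ℓ h t = stateOf S k ω ℓ h' t := by
  induction t with
  | zero => rfl
  | succ t ih =>
    simp only [stateOf]
    rw [ih fun u hu => H u (by omega), H (t + 1) le_rfl]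

lemma update_agree {α : Type} (h : ℕ → α) (t : ℕ) (q : α) :
    ∀ u ≤ t, Function.update h (t + 1) q u = h u := by
  intro u hu
  rw [Function.update_of_ne (by omega)]

/-- For fixed samples the predictions are the only randomness, so the state is a function of their
history, and all estimates can be made under one law of histories. -/
lemma runDays_eq_map (t : ℕ) :
    runDays S k ω ℓ t = (histLaw S k ω ℓ t).map fun h => stateOf S k ω ℓ h t := by
  induction t with
  | zero =>
    rw [histLaw, PMF.pure_map]
    rfl
  | succ t ih =>
    change (runDays S k ω ℓ t).bind (fun s => day S k ω ℓ (t + 1) s) = _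
    rw [ih, histLaw, PMF.bind_map, PMF.map_bind]
    congr 1
    funext h
    rw [PMF.map_comp]
    change (getPredictions (stateOf S k ω ℓ h t) (k - 1)).bind (fun q => PMF.pure _) = _
    rw [PMF.map]
    congr 1
    funext q
    simp only [Function.comp_apply, stateOf]
    rw [stateOf_congr S k ω ℓ (update_agree h t q), Function.update_self]

lemma stateOf_play (h : ℕ → Predictions n) {t u : ℕ} (h1 : 1 ≤ u) (hu : u ≤ t) :
    (stateOf S k ω ℓ h t).play u = (h u).pred (k - 1) := by
  induction t with
  | zero => omega
  | succ t ih =>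
    have : (stateOf S k ω ℓ h (t + 1)).play =
        Function.update (stateOf S k ω ℓ h t).play (t + 1) ((h (t + 1)).pred (k - 1)) := by
      simp only [stateOf]
      split_ifs <;> rfl
    rw [this]
    rcases Nat.lt_or_ge t u with h2 | h2
    · obtain rfl : u = t + 1 := by omega
      simp
    · rw [Function.update_of_ne (by omega), ih h2]

/-- The expectation of a function of the first `T` predictions does not depend on later days. -/
lemma pexp_histLaw_of_le {T t : ℕ} (hT : T ≤ t) (f : (ℕ → Predictions n) → ℝ≥0∞)
    (hf : ∀ h h' : ℕ → Predictions n, (∀ u ≤ T, h u = h' u) → f h = f h') :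
    pexp (histLaw S k ω ℓ t) f = pexp (histLaw S k ω ℓ T) f := by
  induction t, hT using Nat.le_induction with
  | base => rfl
  | succ t ht ih =>
    rw [histLaw, pexp_bind, ← ih]
    congr 1
    funext h
    rw [pexp_map, ← pexp_const (getPredictions (stateOf S k ω ℓ h t) (k - 1)) (f h)]
    congr 1
    funext q
    exact hf _ _ fun u hu => update_agree h t q u (hu.trans ht)

/-- A product of conditionally submean factors has mean at most one. -/
lemma pexp_histLaw_prod_le (F : ℕ → (ℕ → Predictions n) → ℝ≥0∞)
    (hF : ∀ t h h', (∀ u ≤ t + 1, h u = h' u) → F t h = F t h')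
    (hstep : ∀ t h, pexp (getPredictions (stateOf S k ω ℓ h t) (k - 1))
      (fun q => F t (Function.update h (t + 1) q)) ≤ 1) (t : ℕ) :
    pexp (histLaw S k ω ℓ t) (fun h => ∏ u ∈ Finset.range t, F u h) ≤ 1 := by
  induction t with
  | zero => simp [pexp_const]
  | succ t ih =>
    rw [histLaw, pexp_bind]
    refine le_trans (pexp_mono _ fun h => ?_) ih
    rw [pexp_map]
    have : ∀ q, ∏ u ∈ Finset.range (t + 1), F u (Function.update h (t + 1) q) =
        (∏ u ∈ Finset.range t, F u h) * F t (Function.update h (t + 1) q) := by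
      intro q
      rw [Finset.prod_range_succ]
      congr 1
      refine Finset.prod_congr rfl fun u hu => hF u _ _ fun v hv => ?_
      have := Finset.mem_range.1 hu
      exact update_agree h t q v (by omega)
    simp only [this]
    rw [pexp_const_mul]
    exact mul_le_of_le_one_right' (hstep t h)

/-- A deviation inequality for sums of centred functions of the predictions. -/
lemma histLaw_deviation (X : ℕ → (ℕ → Predictions n) → ℝ)
    (hX : ∀ t h h', (∀ u ≤ t + 1, h u = h' u) → X t h = X t h')
    (s r : ℕ) (hr : 0 < r)
    (hstep : ∀ t h, s ≤ t → t < s + r → ∀ lam : ℝ, 0 ≤ lam → lam ≤ 1 →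
      pexp (getPredictions (stateOf S k ω ℓ h t) (k - 1))
        (fun q => ENNReal.ofReal
          (Real.exp (lam * X t (Function.update h (t + 1) q) - lam ^ 2))) ≤ 1)
    {T : ℕ} (hT : s + r ≤ T) {L : ℝ} (hL : 1 ≤ L) :
    (histLaw S k ω ℓ T).toOuterMeasure
      {h | 2 * L * √r ≤ ∑ u ∈ Finset.Ico s (s + r), X u h} ≤ ENNReal.ofReal (Real.exp (-L)) := by
  have hr' : (1 : ℝ) ≤ r := by exact_mod_cast hr
  have hsq : 1 ≤ √(r : ℝ) := Real.one_le_sqrt.2 hr'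
  -- With this rate the total compensation `lam ^ 2 * r` is 1, and a deviation 2L√r contributes 2L -
  -- 1 ≥ L to the exponent.
  set lam : ℝ := (√(r : ℝ))⁻¹ with hlam
  have h0 : 0 ≤ lam := by positivity
  have h1 : lam ≤ 1 := inv_le_one_of_one_le₀ hsq
  have h2 : lam ^ 2 * r = 1 := by
    rw [hlam, inv_pow, Real.sq_sqrt (by linarith)]
    field_simp
  have hkey : pexp (histLaw S k ω ℓ T) (fun h => ENNReal.ofReal
      (Real.exp (∑ u ∈ Finset.Ico s (s + r), (lam * X u h - lam ^ 2)))) ≤ 1 := by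
    -- Days outside the window get the factor 1.
    refine le_trans (le_of_eq ?_) (pexp_histLaw_prod_le S k ω ℓ
      (fun t h => if s ≤ t ∧ t < s + r then
        ENNReal.ofReal (Real.exp (lam * X t h - lam ^ 2)) else 1) ?_ ?_ T)
    · congr 1
      funext h
      rw [Real.exp_sum, ENNReal.ofReal_prod_of_nonneg fun _ _ => Real.exp_nonneg _,
        ← Finset.prod_filter]
      refine Finset.prod_congr ?_ fun _ _ => rfl
      ext u
      simp only [Finset.mem_Ico, Finset.mem_filter, Finset.mem_range]
      omega
    · intro t h h' H
      simp only [hX t h h' H]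
    · intro t h
      by_cases ht : s ≤ t ∧ t < s + r
      · simp only [ht, and_self, if_true]
        exact hstep t h ht.1 ht.2 lam h0 h1
      · simp only [ht, if_false, pexp_const, le_refl]
  refine le_trans ?_ (toOuterMeasure_le_exp_neg _ _ L hkey)
  apply MeasureTheory.OuterMeasure.mono
  intro h hh
  simp only [Set.mem_ofPred_eq] at hh ⊢
  rw [Finset.sum_sub_distrib, ← Finset.mul_sum, Finset.sum_const, Nat.card_Ico, nsmul_eq_mul]
  have h3 : lam * (2 * L * √r) = 2 * L := by
    rw [hlam]
    field_simp
  have h4 := mul_le_mul_of_nonneg_left hh h0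
  have h5 : ((s + r - s : ℕ) : ℝ) * lam ^ 2 = 1 := by
    rw [Nat.add_sub_cancel_left, mul_comm, h2]
  rw [h5]
  linarith

end history

/-! ### The predictions of one day -/

section predictions

variable {n : ℕ} [NeZero n]

/-- Predictions are built upwards, and higher levels write only their own coordinates, so they
integrate out. -/
lemma pexp_getPredictions_of_le (s : State n) {i K : ℕ} (hK : i ≤ K) (f : Predictions n → ℝ≥0∞)
    (hf : ∀ q q' : Predictions n, (∀ j ≤ i, q.own j = q'.own j ∧ q.pred j = q'.pred j) →
      f q = f q') :
    pexp (getPredictions s K) f = pexp (getPredictions s i) f := by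
  induction K, hK using Nat.le_induction with
  | base => rfl
  | succ K hK ih =>
    rw [← ih]
    change pexp ((getPredictions s K).bind fun q => PMF.bind _ fun e => PMF.bind _ fun y =>
      PMF.pure _) f = _
    rw [pexp_bind]
    congr 1
    funext q
    simp only [pexp_bind, pexp_pure]
    have : ∀ e y, f ⟨Function.update q.own (K + 1) e, Function.update q.pred (K + 1) y⟩ = f q := by
      intro e y
      refine hf _ _ fun j hj => ?_
      simp only
      rw [Function.update_of_ne (by omega), Function.update_of_ne (by omega)]
      exact ⟨rfl, rfl⟩
    simp only [this, pexp_const]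

/-- The list of experts of a bucket with their weights. -/
def weightList (B : List (Entry n)) : List (Fin n × ℝ) := B.map fun x => (x.expert, x.weight)

lemma pexp_own_le (s : State n) {i K : ℕ} (hK : i ≤ K) (hne : s.buckets i ≠ [])
    (hpos : ∀ x ∈ s.buckets i, 0 < x.weight) (g : Fin n → ℝ)
    (hg : ∀ a, g a ∈ Set.Icc (0 : ℝ) 1) {lam : ℝ} (h0 : 0 ≤ lam) (h1 : lam ≤ 1) :
    pexp (getPredictions s K) (fun q => ENNReal.ofReal
      (Real.exp (lam * (g (q.own i) - wavg (weightList (s.buckets i)) g) - lam ^ 2))) ≤ 1 := by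
  rw [pexp_getPredictions_of_le s hK _ fun q q' H => by rw [(H i le_rfl).1]]
  have hw := pexp_weightedChoice_exp_le (weightList (s.buckets i)) (by simpa [weightList] using hne)
    (by
      intro x hx
      obtain ⟨e, he, rfl⟩ := List.mem_map.1 hx
      exact hpos e he) g hg h0 h1
  cases i with
  | zero =>
    change pexp (PMF.bind (weightedChoice (weightList (s.buckets 0))) fun e => PMF.pure _) _ ≤ 1
    simpa only [pexp_bind, pexp_pure] using hw
  | succ i =>
    change pexp ((getPredictions s i).bind fun q =>
      PMF.bind (weightedChoice (weightList (s.buckets (i + 1)))) fun e => PMF.bind _ fun y =>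
      PMF.pure _) _ ≤ 1
    simp only [pexp_bind, pexp_pure, Function.update_self, pexp_const]
    exact hw

/-- Conditioned on the two candidates of the same day, the prediction is a two-point choice. The
centring uses the realised candidates, whose losses are exactly those that update the external
weights. -/
lemma pexp_pred_le (s : State n) {i K : ℕ} (hK : i + 1 ≤ K)
    (hpos₁ : 0 < (s.ext (i + 1)).1) (hpos₂ : 0 < (s.ext (i + 1)).2) (g : Fin n → ℝ)
    (hg : ∀ a, g a ∈ Set.Icc (0 : ℝ) 1) {lam : ℝ} (h0 : 0 ≤ lam) (h1 : lam ≤ 1) :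
    pexp (getPredictions s K) (fun q => ENNReal.ofReal
      (Real.exp (lam * (g (q.pred (i + 1)) -
        wavg [(q.own (i + 1), (s.ext (i + 1)).1), (q.pred i, (s.ext (i + 1)).2)] g) -
          lam ^ 2))) ≤ 1 := by
  rw [pexp_getPredictions_of_le s hK _ fun q q' H => by
    rw [(H (i + 1) le_rfl).1, (H (i + 1) le_rfl).2, (H i (by omega)).2]]
  change pexp ((getPredictions s i).bind fun q =>
      PMF.bind (weightedChoice (weightList (s.buckets (i + 1)))) fun e =>
        PMF.bind (weightedChoice [(e, (s.ext (i + 1)).1), (q.pred i, (s.ext (i + 1)).2)])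
          fun y => PMF.pure _) _ ≤ 1
  simp only [pexp_bind, pexp_pure, Function.update_self]
  have key : ∀ (q : Predictions n) (e : Fin n), pexp
      (weightedChoice [(e, (s.ext (i + 1)).1), (q.pred i, (s.ext (i + 1)).2)])
      (fun y => ENNReal.ofReal (Real.exp (lam * (g y - wavg [(e, (s.ext (i + 1)).1),
        (Function.update q.pred (i + 1) y i, (s.ext (i + 1)).2)] g) - lam ^ 2))) ≤ 1 := by
    intro q e
    have : ∀ y, Function.update q.pred (i + 1) y i = q.pred i := fun y =>
      Function.update_of_ne (by omega) _ _
    simp only [this]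
    refine pexp_weightedChoice_exp_le _ (by simp) ?_ g hg h0 h1
    intro x hx
    simp only [List.mem_cons, List.not_mem_nil, or_false] at hx
    rcases hx with rfl | rfl
    exacts [hpos₁, hpos₂]
  calc _ ≤ pexp (getPredictions s i) fun _ => pexp (weightedChoice
        (weightList (s.buckets (i + 1)))) fun _ => 1 :=
        pexp_mono _ fun q => pexp_mono _ fun e => key q e
    _ = 1 := by simp only [pexp_const]

end predictions

/-! ### Block sizes -/

/-- Block sizes `S 0 < … < S k`, each of which divides the next. -/
structure LegalBlocks (S : ℕ → ℕ) (k : ℕ) : Prop where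
  levels_pos : 1 ≤ k
  size_pos : 0 < S 0
  strict : ∀ i < k, S i < S (i + 1)
  dvd : ∀ i < k, S i ∣ S (i + 1)

section blocks

variable {S : ℕ → ℕ} {k : ℕ}

lemma LegalBlocks.dvd_of_le (hS : LegalBlocks S k) {i j : ℕ} (hij : i ≤ j) (hj : j ≤ k) :
    S i ∣ S j := by
  induction j, hij using Nat.le_induction with
  | base => exact dvd_rfl
  | succ j _ ih => exact (ih (by omega)).trans (hS.dvd j (by omega))

lemma LegalBlocks.pos (hS : LegalBlocks S k) {i : ℕ} (hi : i ≤ k) : 0 < S i := by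
  induction i with
  | zero => exact hS.size_pos
  | succ i ih => exact (ih (by omega)).trans (hS.strict i (by omega))

lemma LegalBlocks.lt_size (hS : LegalBlocks S k) {i : ℕ} (hi : i ≤ k) : i < S i := by
  induction i with
  | zero => exact hS.size_pos
  | succ i ih => have := hS.strict i (by omega); have := ih (by omega); omega

lemma topLevel_lt (hk : 1 ≤ k) (t : ℕ) : topLevel S k t < k := by
  have := Nat.findGreatest_le (P := fun i => S i ∣ t) (k - 1)
  unfold topLevel
  omega

lemma le_topLevel {i t : ℕ} (hi : i < k) (h : S i ∣ t) : i ≤ topLevel S k t :=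
  Nat.le_findGreatest (by omega) h

lemma dvd_of_topLevel {t : ℕ} (h : S 0 ∣ t) : S (topLevel S k t) ∣ t :=
  Nat.findGreatest_spec (P := fun i => S i ∣ t) (Nat.zero_le _) h

/-- `S 0 ∣ t` is needed because `Nat.findGreatest` also returns 0 when no block size divides `t`. -/
lemma LegalBlocks.le_topLevel_iff (hS : LegalBlocks S k) {i t : ℕ} (hi : i < k) (h : S 0 ∣ t) :
    i ≤ topLevel S k t ↔ S i ∣ t := by
  refine ⟨fun H => ?_, le_topLevel hi⟩
  exact (hS.dvd_of_le H (topLevel_lt hS.levels_pos t).le).trans (dvd_of_topLevel h)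

/-- The start of the block, one level above the highest updated one, which contains time `t`. -/
def epochStart (S : ℕ → ℕ) (k t : ℕ) : ℕ :=
  t / S (topLevel S k t + 1) * S (topLevel S k t + 1)

/-- A block which starts strictly after the start of the epoch of `t` and before `t`, and whose
level lies above the levels updated at `t`, does not exist. -/
lemma LegalBlocks.add_le_of_epochStart_le (hS : LegalBlocks S k) {i s b t : ℕ} (hi : i < k)
    (h0 : S 0 ∣ t) (hs : S i ∣ s) (hb : epochStart S k t ≤ b) (hbs : b < s) (hst : s < t) :
    s + S i ≤ t := by
  by_contra hlt
  push Not at hlt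
  have hnd : ¬ S i ∣ t := by
    intro hd
    obtain ⟨c, hc⟩ := (Nat.dvd_sub hd hs)
    have : 0 < c := Nat.pos_of_ne_zero (by rintro rfl; omega)
    have : S i * 1 ≤ S i * c := Nat.mul_le_mul_left _ this
    omega
  have htop : topLevel S k t + 1 ≤ i ∨ i ≤ topLevel S k t := by omega
  rcases htop with h1 | h1
  -- Here `s` is a multiple of the epoch length and precedes `t`, so it is at most the epoch start,
  -- against `b < s`.
  · have hd : S (topLevel S k t + 1) ∣ s := (hS.dvd_of_le h1 hi.le).trans hs
    obtain ⟨c, rfl⟩ := hd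
    have hp : 0 < S (topLevel S k t + 1) := hS.pos (by omega)
    have : c ≤ t / S (topLevel S k t + 1) := by
      rw [Nat.le_div_iff_mul_le hp, mul_comm]
      exact hst.le
    have h2 := Nat.mul_le_mul_right (S (topLevel S k t + 1)) this
    unfold epochStart at hb
    rw [mul_comm] at h2
    omega
  · exact hnd ((hS.le_topLevel_iff hi h0).1 h1)

end blocks

/-! ### The evolution of the buckets -/

section buckets

variable {n m N : ℕ} (S : ℕ → ℕ) (k : ℕ) (ω : Samples n m k N) (ℓ : ℕ → Fin n → ℝ)

/-- The update of the losses and weights of all buckets with the loss vector `l`. -/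
def observe (l : Fin n → ℝ) (B : ℕ → List (Entry n)) (i : ℕ) : List (Entry n) :=
  (B i).map fun x =>
    { x with
      loss := x.loss + l x.expert
      weight := x.weight * Real.exp (-(innerRate S i (B i)) * l x.expert) }

/-- The update of the buckets at time `t`. -/
def newBuckets (t : ℕ) (B : ℕ → List (Entry n)) (i : ℕ) : List (Entry n) :=
  let kept : ℕ → List (Entry n) := fun i =>
    evict (Real.log (S k) / m) (epochStart S k t) (B i)
  if i ≤ topLevel S k t then
    kept i ++ arrivals t (((List.range i).flatMap kept).map Entry.expert)
      ++ arrivals (t + 1 / 2) (ω.at t i)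
  else B i

/-- The buckets after day `t`. -/
def bkt : ℕ → ℕ → List (Entry n)
  | 0 => newBuckets S k ω 0 fun _ => []
  | t + 1 =>
    if S 0 ∣ t + 1 then newBuckets S k ω (t + 1) (observe S (ℓ (t + 1)) (bkt t))
    else observe S (ℓ (t + 1)) (bkt t)

/-- The buckets after the losses of day `t` are observed, before they are updated. -/
def preBkt : ℕ → ℕ → List (Entry n)
  | 0 => fun _ => []
  | t + 1 => observe S (ℓ (t + 1)) (bkt S k ω ℓ t)

/-- The right side does not involve `h`: predictions influence only the external weights and the
record of plays. -/
lemma stateOf_buckets [NeZero n] (h : ℕ → Predictions n) (t : ℕ) :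
    (stateOf S k ω ℓ h t).buckets = bkt S k ω ℓ t := by
  induction t with
  | zero => rfl
  | succ t ih =>
    simp only [stateOf, bkt]
    rw [← ih]
    split_ifs <;> rfl

variable {S k}

/-- The copies come from the survivors of the lower buckets, before these receive their own
arrivals; an entry arriving at `t` is therefore not copied at `t`. -/
lemma bkt_eq_of_dvd (hS : LegalBlocks S k) {t i : ℕ} (hi : i < k) (h : S i ∣ t) :
    bkt S k ω ℓ t i =
      evict (Real.log (S k) / m) (epochStart S k t) (preBkt S k ω ℓ t i) ++
        arrivals t (((List.range i).flatMap fun j =>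
          evict (Real.log (S k) / m) (epochStart S k t) (preBkt S k ω ℓ t j)).map Entry.expert) ++
        arrivals (t + 1 / 2) (ω.at t i) := by
  have h0 : S 0 ∣ t := (hS.dvd_of_le (Nat.zero_le _) hi.le).trans h
  have h1 := le_topLevel hi h
  cases t with
  | zero => simp only [bkt, newBuckets, h1, if_true]; rfl
  | succ t => simp only [bkt, newBuckets, h0, h1, if_true]; rfl

lemma bkt_succ_of_not_dvd (hS : LegalBlocks S k) {t i : ℕ} (hi : i < k) (h : ¬ S i ∣ t + 1) :
    bkt S k ω ℓ (t + 1) i = preBkt S k ω ℓ (t + 1) i := by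
  simp only [bkt]
  split_ifs with h0
  · rw [newBuckets, if_neg (by rwa [hS.le_topLevel_iff hi h0])]
    rfl
  · rfl

lemma mem_evict {ε : ℝ} {τ : ℕ} {B : List (Entry n)} {e : Entry n} :
    e ∈ evict ε τ B ↔ ∃ e₀ ∈ B, (¬ ((τ : ℝ) + 1 / 2 ≤ e₀.arrival ∧ ∃ e' ∈ B, Dominates ε e' e₀)) ∧
      { e₀ with weight := 1 } = e := by
  simp [evict, and_assoc]

lemma weight_of_mem_arrivals {a : ℝ} {es : List (Fin n)} {e : Entry n} (he : e ∈ arrivals a es) :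
    e.weight = 1 := by
  obtain ⟨j, hj, rfl⟩ := List.mem_mapIdx.1 he
  rfl

lemma weight_of_mem_evict {ε : ℝ} {τ : ℕ} {B : List (Entry n)} {e : Entry n}
    (he : e ∈ evict ε τ B) : e.weight = 1 := by
  obtain ⟨e₀, -, -, rfl⟩ := mem_evict.1 he
  rfl

/-- At the start of a block all weights of the bucket are `1`. -/
lemma weight_eq_one_of_dvd (hS : LegalBlocks S k) {t i : ℕ} (hi : i < k) (h : S i ∣ t) {e : Entry n}
    (he : e ∈ bkt S k ω ℓ t i) : e.weight = 1 := by
  rw [bkt_eq_of_dvd ω ℓ hS hi h, List.mem_append, List.mem_append] at he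
  rcases he with (he | he) | he
  · exact weight_of_mem_evict he
  · exact weight_of_mem_arrivals he
  · exact weight_of_mem_arrivals he

lemma weight_pos (hS : LegalBlocks S k) {t i : ℕ} (hi : i < k) {e : Entry n}
    (he : e ∈ bkt S k ω ℓ t i) : 0 < e.weight := by
  induction t generalizing e with
  | zero => rw [weight_eq_one_of_dvd ω ℓ hS hi (dvd_zero _) he]; exact one_pos
  | succ t ih =>
    by_cases h : S i ∣ t + 1
    · rw [weight_eq_one_of_dvd ω ℓ hS hi h he]; exact one_pos
    · rw [bkt_succ_of_not_dvd ω ℓ hS hi h] at he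
      obtain ⟨e₀, he₀, rfl⟩ := List.mem_map.1 he
      exact mul_pos (ih he₀) (Real.exp_pos _)

lemma length_arrivals (a : ℝ) (es : List (Fin n)) : (arrivals a es).length = es.length := by
  simp [arrivals]

lemma length_samples_at {t i : ℕ} (ht : t ≤ N) (hi : i < k) : (ω.at t i).length = m := by
  rw [Samples.at, dif_pos ⟨by omega, hi⟩, List.length_ofFn]

lemma length_observe (l : Fin n → ℝ) (B : ℕ → List (Entry n)) (i : ℕ) :
    (observe S l B i).length = (B i).length := by
  simp [observe]

lemma bkt_ne_nil (hS : LegalBlocks S k) (hm : 1 ≤ m) {t i : ℕ} (hi : i < k) (ht : t ≤ N) :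
    bkt S k ω ℓ t i ≠ [] := by
  induction t with
  | zero =>
    rw [bkt_eq_of_dvd ω ℓ hS hi (dvd_zero _), ← List.length_pos_iff]
    simp only [List.length_append, length_arrivals, length_samples_at ω ht hi]
    omega
  | succ t ih =>
    rw [← List.length_pos_iff]
    by_cases h : S i ∣ t + 1
    · rw [bkt_eq_of_dvd ω ℓ hS hi h]
      simp only [List.length_append, length_arrivals, length_samples_at ω ht hi]
      omega
    · rw [bkt_succ_of_not_dvd ω ℓ hS hi h, preBkt, length_observe, List.length_pos_iff]
      exact ih (by omega)

/-- The bucket of level `i` during a block of level `i`. -/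
lemma bkt_add (hS : LegalBlocks S k) {s i r : ℕ} (hi : i < k) (h : S i ∣ s) (hr : r < S i) :
    bkt S k ω ℓ (s + r) i = (bkt S k ω ℓ s i).map fun x =>
      { x with
        loss := x.loss + ∑ v ∈ Finset.range r, ℓ (s + v + 1) x.expert
        weight := x.weight * Real.exp (-(innerRate S i (bkt S k ω ℓ s i)) *
          ∑ v ∈ Finset.range r, ℓ (s + v + 1) x.expert) } := by
  induction r with
  | zero => simp
  | succ r ih =>
    have hnd : ¬ S i ∣ s + r + 1 := by
      intro hd
      have := Nat.le_of_dvd (by omega) ((Nat.dvd_add_right h).1 (add_assoc s r 1 ▸ hd))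
      omega
    -- The rate depends only on the length of the bucket, which does not change inside a block.
    have hrate : innerRate S i (bkt S k ω ℓ (s + r) i) = innerRate S i (bkt S k ω ℓ s i) := by
      rw [ih (by omega)]
      simp [innerRate]
    rw [← add_assoc, bkt_succ_of_not_dvd ω ℓ hS hi hnd, preBkt, observe, hrate, ih (by omega),
      List.map_map]
    refine List.map_congr_left fun x _ => ?_
    simp only [Function.comp_apply, Finset.sum_range_succ, mul_add, Real.exp_add]
    congr 1
    · ring
    · ring

/-- The external weights of level `i` during a block of level `i`. -/
lemma stateOf_ext_add [NeZero n] (hS : LegalBlocks S k) (h : ℕ → Predictions n) {s i r : ℕ}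
    (hi : i < k) (hs : S i ∣ s) (hr : r < S i) :
    (stateOf S k ω ℓ h (s + r)).ext i =
      (Real.exp (-(outerRate S i) *
        ∑ v ∈ Finset.range r, ℓ (s + v + 1) ((h (s + v + 1)).own i)),
       Real.exp (-(outerRate S i) *
        ∑ v ∈ Finset.range r, ℓ (s + v + 1) ((h (s + v + 1)).pred (i - 1)))) := by
  induction r with
  | zero =>
    have h0 : S 0 ∣ s := (hS.dvd_of_le (Nat.zero_le _) hi.le).trans hs
    have h1 := le_topLevel hi hs
    cases s with
    | zero => simp [stateOf, updateBuckets]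
    | succ s =>
      simp only [stateOf, h0, if_true, updateBuckets, h1]
      simp
  | succ r ih =>
    have hnd : ¬ S i ∣ s + r + 1 := by
      intro hd
      have := Nat.le_of_dvd (by omega) ((Nat.dvd_add_right hs).1 (add_assoc s r 1 ▸ hd))
      omega
    have hstep : (stateOf S k ω ℓ h (s + r + 1)).ext i =
        (((stateOf S k ω ℓ h (s + r)).ext i).1 *
          Real.exp (-(outerRate S i) * ℓ (s + r + 1) ((h (s + r + 1)).own i)),
         ((stateOf S k ω ℓ h (s + r)).ext i).2 *
          Real.exp (-(outerRate S i) * ℓ (s + r + 1) ((h (s + r + 1)).pred (i - 1)))) := by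
      simp only [stateOf]
      split_ifs with h0
      · simp only [updateBuckets]
        rw [if_neg (by rwa [hS.le_topLevel_iff hi h0])]
        rfl
      · rfl
    rw [← add_assoc, hstep, ih (by omega)]
    simp only [Finset.sum_range_succ, mul_add, Real.exp_add]

lemma stateOf_ext_pos [NeZero n] (h : ℕ → Predictions n) (t i : ℕ) :
    0 < ((stateOf S k ω ℓ h t).ext i).1 ∧ 0 < ((stateOf S k ω ℓ h t).ext i).2 := by
  induction t with
  | zero => simp [stateOf, updateBuckets]
  | succ t ih =>
    simp only [stateOf]
    split_ifs
    · simp only [updateBuckets]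
      split_ifs
      · simp
      · exact ⟨mul_pos ih.1 (Real.exp_pos _), mul_pos ih.2 (Real.exp_pos _)⟩
    · exact ⟨mul_pos ih.1 (Real.exp_pos _), mul_pos ih.2 (Real.exp_pos _)⟩

/-! ### The size of the buckets -/

lemma length_evict_le (ε : ℝ) (τ : ℕ) (B : List (Entry n)) : (evict ε τ B).length ≤ B.length := by
  rw [evict, List.length_map]
  exact List.length_filter_le _ _

lemma length_flatMap_evict_le (ε : ℝ) (τ i : ℕ) (B : ℕ → List (Entry n)) :
    ((List.range i).flatMap fun j => evict ε τ (B j)).length ≤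
      ∑ j ∈ Finset.range i, (B j).length := by
  induction i with
  | zero => simp
  | succ i ih =>
    rw [List.range_succ, List.flatMap_append, List.length_append, Finset.sum_range_succ]
    simp only [List.flatMap_cons, List.flatMap_nil, List.append_nil]
    exact Nat.add_le_add ih (length_evict_le _ _ _)

lemma sum_pow_le (t i : ℕ) :
    1 + ∑ j ∈ Finset.range i, (2 * t) ^ (j + 1) ≤ 2 ^ (i + 1) * (t + 1) ^ i := by
  induction i with
  | zero => simp
  | succ i ih =>
    rw [Finset.sum_range_succ, ← add_assoc]
    have h1 : (2 * t) ^ (i + 1) ≤ 2 ^ (i + 1) * (t + 1) ^ (i + 1) := by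
      rw [← mul_pow]
      exact Nat.pow_le_pow_left (by omega) _
    have h2 : 2 ^ (i + 1) * (t + 1) ^ i ≤ 2 ^ (i + 1) * (t + 1) ^ (i + 1) :=
      Nat.mul_le_mul_left _ (Nat.pow_le_pow_right (by omega) (by omega))
    calc _ ≤ 2 ^ (i + 1) * (t + 1) ^ (i + 1) + 2 ^ (i + 1) * (t + 1) ^ (i + 1) := by omega
      _ = _ := by ring

/-- Evictions are ignored. This crude growth suffices, since the length enters the regret only
through the square root of its logarithm. -/
lemma length_bkt_le (hS : LegalBlocks S k) {t i : ℕ} (hi : i < k) (ht : t ≤ N) :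
    (bkt S k ω ℓ t i).length ≤ m * (2 * (t + 1)) ^ (i + 1) := by
  have hpre : ∀ t j, (preBkt S k ω ℓ t j).length =
      match t with
      | 0 => 0
      | t + 1 => (bkt S k ω ℓ t j).length := by
    intro t j
    cases t with
    | zero => rfl
    | succ t => rw [preBkt, length_observe]
  induction t generalizing i with
  | zero =>
    rw [bkt_eq_of_dvd ω ℓ hS hi (dvd_zero _)]
    simp only [List.length_append, length_arrivals, length_samples_at ω ht hi, List.length_map]
    have h1 := length_evict_le (Real.log (S k) / m) (epochStart S k 0) (preBkt S k ω ℓ 0 i)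
    have h2 := length_flatMap_evict_le (Real.log (S k) / m) (epochStart S k 0) i
      (preBkt S k ω ℓ 0)
    simp only [hpre, Finset.sum_const_zero] at h1 h2
    have : m * 1 ≤ m * (2 * (0 + 1)) ^ (i + 1) := Nat.mul_le_mul_left _ Nat.one_le_two_pow
    omega
  | succ t ih =>
    have ih := fun {i} (hi : i < k) => ih hi (by omega)
    by_cases h : S i ∣ t + 1
    · rw [bkt_eq_of_dvd ω ℓ hS hi h]
      simp only [List.length_append, length_arrivals, length_samples_at ω ht hi, List.length_map]
      have h1 := length_evict_le (Real.log (S k) / m) (epochStart S k (t + 1))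
        (preBkt S k ω ℓ (t + 1) i)
      have h2 := length_flatMap_evict_le (Real.log (S k) / m) (epochStart S k (t + 1)) i
        (preBkt S k ω ℓ (t + 1))
      simp only [hpre] at h1 h2
      have h3 : ∑ j ∈ Finset.range i, (bkt S k ω ℓ t j).length ≤
          m * ∑ j ∈ Finset.range i, (2 * (t + 1)) ^ (j + 1) := by
        rw [Finset.mul_sum]
        exact Finset.sum_le_sum fun j hj => ih ((Finset.mem_range.1 hj).trans hi)
      have h4 := Nat.mul_le_mul_left m (sum_pow_le (t + 1) i)
      have h5 := ih hi
      have h6 : m * (2 * (t + 1)) ^ (i + 1) + m * (2 ^ (i + 1) * (t + 1 + 1) ^ i) ≤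
          m * (2 * (t + 1 + 1)) ^ (i + 1) := by
        rw [← Nat.mul_add]
        refine Nat.mul_le_mul_left _ ?_
        rw [mul_pow, mul_pow, ← Nat.mul_add]
        refine Nat.mul_le_mul_left _ ?_
        rw [pow_succ (t + 1 + 1), pow_succ (t + 1)]
        have : (t + 1) ^ i * (t + 1) ≤ (t + 1 + 1) ^ i * (t + 1) :=
          Nat.mul_le_mul_right _ (Nat.pow_le_pow_left (by omega) _)
        linarith
      rw [mul_add] at h4
      omega
    · rw [bkt_succ_of_not_dvd ω ℓ hS hi h, hpre]
      exact (ih hi).trans (Nat.mul_le_mul_left _ (Nat.pow_le_pow_left (by omega) _))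

end buckets

/-! ### Regret within one block -/

section mean

variable {n m N : ℕ} (S : ℕ → ℕ) (k : ℕ) (ω : Samples n m k N) (ℓ : ℕ → Fin n → ℝ)

/-- The mean loss of the expert picked from bucket `i` on day `t + 1`. -/
def ownMean (i t : ℕ) : ℝ := wavg (weightList (bkt S k ω ℓ t i)) (ℓ (t + 1))

variable {S k}

lemma sum_Ico_add_eq (f : ℕ → ℝ) (s r : ℕ) :
    ∑ u ∈ Finset.Ico s (s + r), f u = ∑ v ∈ Finset.range r, f (s + v) := by
  rw [Finset.sum_Ico_eq_sum_range, Nat.add_sub_cancel_left]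

/-- Multiplicative weights in one bucket during one block. -/
lemma sum_ownMean_le (hS : LegalBlocks S k)
    (hℓ : ∀ t e, ℓ t e ∈ Set.Icc (0 : ℝ) 1) {i s : ℕ} (hi : i < k) (hs : S i ∣ s)
    {x : Entry n} (hx : x ∈ bkt S k ω ℓ s i) :
    ∑ u ∈ Finset.Ico s (s + S i), ownMean S k ω ℓ i u ≤
      ∑ u ∈ Finset.Ico s (s + S i), ℓ (u + 1) x.expert +
        2 * √(S i * Real.log (bkt S k ω ℓ s i).length) := by
  set B := bkt S k ω ℓ s i with hB
  set η := innerRate S i B with hη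
  have hSp : (0 : ℝ) < S i := by exact_mod_cast hS.pos hi.le
  obtain ⟨j₀, hj₀, hxj⟩ := List.mem_iff_getElem.1 hx
  have hmean : ∀ v ∈ Finset.range (S i), ownMean S k ω ℓ i (s + v) =
      (∑ j : Fin B.length, Real.exp (-η * ∑ w ∈ Finset.range v, ℓ (s + w + 1) B[j].expert) *
        ℓ (s + v + 1) B[j].expert) /
      (∑ j : Fin B.length, Real.exp (-η * ∑ w ∈ Finset.range v, ℓ (s + w + 1) B[j].expert)) := by
    intro v hv
    have hw : ∀ x ∈ B, x.weight = 1 := fun x hx => weight_eq_one_of_dvd ω ℓ hS hi hs hx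
    have hbk := bkt_add ω ℓ hS hi hs (Finset.mem_range.1 hv)
    rw [← hB, ← hη] at hbk
    rw [ownMean, wavg, weightList, hbk]
    simp only [List.map_map]
    congr 1
    · rw [← Fin.sum_univ_fun_getElem]
      refine Finset.sum_congr rfl fun j _ => ?_
      simp [hw _ (List.getElem_mem j.2)]
    · rw [← Fin.sum_univ_fun_getElem]
      refine Finset.sum_congr rfl fun j _ => ?_
      simp [hw _ (List.getElem_mem j.2)]
  rw [sum_Ico_add_eq, sum_Ico_add_eq, Finset.sum_congr rfl hmean]
  have hMW := multiplicative_weights (J := Fin B.length)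
    (fun v j => ℓ (s + v + 1) B[j].expert) (S i) (fun _ _ _ => hℓ _ _)
    (η := η) (Real.sqrt_nonneg _) ⟨j₀, hj₀⟩
  simp only [Fintype.card_fin] at hMW
  have hxe : (B[(⟨j₀, hj₀⟩ : Fin B.length)]).expert = x.expert := by rw [← hxj]; rfl
  rw [hxe] at hMW
  set A := ∑ u ∈ Finset.range (S i), (∑ j : Fin B.length,
    Real.exp (-η * ∑ w ∈ Finset.range u, ℓ (s + w + 1) B[j].expert) *
        ℓ (s + u + 1) B[j].expert) /
      (∑ j : Fin B.length, Real.exp (-η * ∑ w ∈ Finset.range u, ℓ (s + w + 1) B[j].expert)) with hA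
  have hlen : 0 < B.length := by omega
  have hlog : 0 ≤ Real.log B.length := Real.log_natCast_nonneg _
  -- A bucket with one entry has rate 0, so one cannot divide by `η`; its mean loss is then exactly
  -- the loss of that entry.
  rcases hlog.eq_or_lt with h0 | hpos
  · have hlen1 : B.length = 1 := by
      have h1 : (B.length : ℝ) = 0 ∨ (B.length : ℝ) = 1 ∨ (B.length : ℝ) = -1 :=
        Real.log_eq_zero.1 h0.symm
      rcases h1 with h1 | h1 | h1
      · exact absurd (by exact_mod_cast h1) hlen.ne'
      · exact_mod_cast h1
      · have : (0 : ℝ) < B.length := by exact_mod_cast hlen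
        linarith
    have huniq : ∀ j : Fin B.length, B[j].expert = x.expert := by
      intro j
      have : j = ⟨j₀, hj₀⟩ := by ext; simp only; omega
      rw [this, hxe]
    rw [← h0, mul_zero, Real.sqrt_zero, mul_zero, add_zero, hA]
    refine Finset.sum_le_sum fun u _ => le_of_eq ?_
    simp only [huniq]
    rw [← Finset.sum_mul]
    refine mul_div_cancel_left₀ _ (Finset.sum_pos (fun _ _ => Real.exp_pos _) ?_).ne'
    exact ⟨⟨j₀, hj₀⟩, Finset.mem_univ _⟩
  -- The rate balances the errors log|B|/η and η·S_i: both equal √(S_i log|B|).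
  · have hη0 : 0 < η := Real.sqrt_pos.2 (div_pos hpos hSp)
    have hη2 : η ^ 2 * S i = Real.log B.length := by
      rw [hη, innerRate, Real.sq_sqrt (div_nonneg hlog hSp.le), div_mul_cancel₀ _ hSp.ne']
    have hη3 : η * √(S i * Real.log B.length) = Real.log B.length := by
      rw [hη, innerRate, ← Real.sqrt_mul (div_nonneg hlog hSp.le)]
      have : Real.log B.length / S i * (S i * Real.log B.length) = Real.log B.length ^ 2 := by
        field_simp
      rw [this, Real.sqrt_sq hlog]
    refine le_of_mul_le_mul_left ?_ hη0
    rw [mul_add]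
    have : η * (2 * √(S i * Real.log B.length)) = 2 * Real.log B.length := by rw [mul_left_comm, hη3]
    rw [this]
    linarith

end mean

/-! ### Concentration of the realised losses, and comparison of levels within a block -/

section regret

variable {n m N : ℕ} [NeZero n] (S : ℕ → ℕ) (k : ℕ) (ω : Samples n m k N) (ℓ : ℕ → Fin n → ℝ)

lemma pexp_pred_zero_le (s : State n) (K : ℕ) (hne : s.buckets 0 ≠ [])
    (hpos : ∀ x ∈ s.buckets 0, 0 < x.weight) (g : Fin n → ℝ)
    (hg : ∀ a, g a ∈ Set.Icc (0 : ℝ) 1) {lam : ℝ} (h0 : 0 ≤ lam) (h1 : lam ≤ 1) :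
    pexp (getPredictions s K) (fun q => ENNReal.ofReal
      (Real.exp (lam * (g (q.pred 0) - wavg (weightList (s.buckets 0)) g) - lam ^ 2))) ≤ 1 := by
  refine le_trans (le_of_eq ?_) (pexp_own_le s (Nat.zero_le K) hne hpos g hg h0 h1)
  rw [pexp_getPredictions_of_le s (Nat.zero_le K) _ fun q q' H => by rw [(H 0 le_rfl).2],
    pexp_getPredictions_of_le s (Nat.zero_le K) _ fun q q' H => by rw [(H 0 le_rfl).1]]
  change pexp (PMF.bind (weightedChoice (weightList (s.buckets 0))) fun e => PMF.pure _) _ =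
    pexp (PMF.bind (weightedChoice (weightList (s.buckets 0))) fun e => PMF.pure _) _
  simp only [pexp_bind, pexp_pure]

/-- The conditional mean of the loss of the combined prediction of the levels `0, …, i` on day
`t + 1`, given the picked expert of level `i` and the combined prediction of the lower levels. -/
def predMean (i : ℕ) (h : ℕ → Predictions n) (t : ℕ) : ℝ :=
  match i with
  | 0 => ownMean S k ω ℓ 0 t
  | i + 1 => wavg [((h (t + 1)).own (i + 1), ((stateOf S k ω ℓ h t).ext (i + 1)).1),
      ((h (t + 1)).pred i, ((stateOf S k ω ℓ h t).ext (i + 1)).2)] (ℓ (t + 1))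

/-- The random choices of all blocks have losses close to their conditional means. -/
def Concentrated (L : ℝ) (h : ℕ → Predictions n) : Prop :=
  ∀ i < k, ∀ s, s + S i ≤ N →
    (∑ u ∈ Finset.Ico s (s + S i), (ℓ (u + 1) ((h (u + 1)).own i) - ownMean S k ω ℓ i u) <
      2 * L * √(S i)) ∧
    (∑ u ∈ Finset.Ico s (s + S i), (ℓ (u + 1) ((h (u + 1)).pred i) - predMean S k ω ℓ i h u) <
      2 * L * √(S i))

variable {S k}

lemma own_deviation (hS : LegalBlocks S k) (hm : 1 ≤ m)
    (hℓ : ∀ t e, ℓ t e ∈ Set.Icc (0 : ℝ) 1) {i s : ℕ} (hi : i < k)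
    (hN : s + S i ≤ N) {L : ℝ} (hL : 1 ≤ L) :
    (histLaw S k ω ℓ N).toOuterMeasure {h | 2 * L * √(S i) ≤
      ∑ u ∈ Finset.Ico s (s + S i), (ℓ (u + 1) ((h (u + 1)).own i) - ownMean S k ω ℓ i u)} ≤
      ENNReal.ofReal (Real.exp (-L)) := by
  refine histLaw_deviation S k ω ℓ
    (fun u h => ℓ (u + 1) ((h (u + 1)).own i) - ownMean S k ω ℓ i u) ?_ s (S i) (hS.pos hi.le)
    ?_ hN hL
  · intro t h h' H
    simp only [H (t + 1) le_rfl]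
  · intro t h _ ht lam h0 h1
    simp only [Function.update_self]
    have := pexp_own_le (stateOf S k ω ℓ h t) (i := i) (K := k - 1) (by omega)
      (by rw [stateOf_buckets]; exact bkt_ne_nil ω ℓ hS hm hi (by omega))
      (by rw [stateOf_buckets]; exact fun x hx => weight_pos ω ℓ hS hi hx)
      (ℓ (t + 1)) (hℓ _) h0 h1
    rwa [stateOf_buckets] at this

lemma pred_deviation (hS : LegalBlocks S k) (hm : 1 ≤ m)
    (hℓ : ∀ t e, ℓ t e ∈ Set.Icc (0 : ℝ) 1) {i s : ℕ} (hi : i < k)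
    (hN : s + S i ≤ N) {L : ℝ} (hL : 1 ≤ L) :
    (histLaw S k ω ℓ N).toOuterMeasure {h | 2 * L * √(S i) ≤
      ∑ u ∈ Finset.Ico s (s + S i),
        (ℓ (u + 1) ((h (u + 1)).pred i) - predMean S k ω ℓ i h u)} ≤
      ENNReal.ofReal (Real.exp (-L)) := by
  refine histLaw_deviation S k ω ℓ
    (fun u h => ℓ (u + 1) ((h (u + 1)).pred i) - predMean S k ω ℓ i h u) ?_ s (S i)
    (hS.pos hi.le) ?_ hN hL
  · intro t h h' H
    cases i with
    | zero => simp only [predMean, H (t + 1) le_rfl]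
    | succ i =>
      simp only [predMean, H (t + 1) le_rfl,
        stateOf_congr S k ω ℓ fun u hu => H u (Nat.le_succ_of_le hu)]
  · intro t h _ ht lam h0 h1
    cases i with
    | zero =>
      simp only [Function.update_self, predMean]
      have := pexp_pred_zero_le (stateOf S k ω ℓ h t) (k - 1)
        (by rw [stateOf_buckets]; exact bkt_ne_nil ω ℓ hS hm hi (by omega))
        (by rw [stateOf_buckets]; exact fun x hx => weight_pos ω ℓ hS hi hx)
        (ℓ (t + 1)) (hℓ _) h0 h1
      rwa [stateOf_buckets] at this
    | succ i =>
      -- The external weights in use on day `t + 1` are those after day `t`, hence untouched by the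
      -- new prediction.
      simp only [Function.update_self, predMean,
        fun q => stateOf_congr S k ω ℓ (update_agree h t q)]
      have hp := stateOf_ext_pos ω ℓ (S := S) (k := k) h t (i + 1)
      exact pexp_pred_le (stateOf S k ω ℓ h t) (i := i) (K := k - 1) (by omega) hp.1 hp.2
        (ℓ (t + 1)) (hℓ _) h0 h1

/-- A union bound over `k` levels, at most `N` starts and two deviations for each. -/
lemma concentrated_compl_le (hS : LegalBlocks S k) (hm : 1 ≤ m)
    (hℓ : ∀ t e, ℓ t e ∈ Set.Icc (0 : ℝ) 1) {L : ℝ} (hL : 1 ≤ L) :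
    (histLaw S k ω ℓ N).toOuterMeasure {h | Concentrated S k ω ℓ L h}ᶜ ≤
      ENNReal.ofReal (2 * k * N * Real.exp (-L)) := by
  set P := (histLaw S k ω ℓ N).toOuterMeasure with hP
  have hsub : ({h | Concentrated S k ω ℓ L h}ᶜ : Set (ℕ → Predictions n)) ⊆
      ⋃ i ∈ Finset.range k, ⋃ s ∈ (Finset.range N).filter (fun s => s + S i ≤ N),
        ({h | 2 * L * √(S i) ≤ ∑ u ∈ Finset.Ico s (s + S i),
          (ℓ (u + 1) ((h (u + 1)).own i) - ownMean S k ω ℓ i u)} ∪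
        {h | 2 * L * √(S i) ≤ ∑ u ∈ Finset.Ico s (s + S i),
          (ℓ (u + 1) ((h (u + 1)).pred i) - predMean S k ω ℓ i h u)}) := by
    intro h hh
    simp only [Set.mem_compl_iff, Set.mem_ofPred_eq, Concentrated] at hh
    push Not at hh
    obtain ⟨i, hi, s, hs, H⟩ := hh
    have := hS.pos hi.le
    simp only [Set.mem_iUnion, Finset.mem_range, Finset.mem_filter, Set.mem_union,
      Set.mem_ofPred_eq]
    refine ⟨i, hi, s, ⟨by omega, hs⟩, ?_⟩
    by_contra! hcon
    exact absurd (H hcon.1) (not_le.2 hcon.2)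
  refine (P.mono hsub).trans ?_
  refine (MeasureTheory.measure_biUnion_finset_le (μ := P) _ _).trans ?_
  have h1 : ∀ i ∈ Finset.range k, P (⋃ s ∈ (Finset.range N).filter (fun s => s + S i ≤ N),
        ({h | 2 * L * √(S i) ≤ ∑ u ∈ Finset.Ico s (s + S i),
          (ℓ (u + 1) ((h (u + 1)).own i) - ownMean S k ω ℓ i u)} ∪
        {h | 2 * L * √(S i) ≤ ∑ u ∈ Finset.Ico s (s + S i),
          (ℓ (u + 1) ((h (u + 1)).pred i) - predMean S k ω ℓ i h u)})) ≤
      ENNReal.ofReal (N * (2 * Real.exp (-L))) := by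
    intro i hi
    refine (MeasureTheory.measure_biUnion_finset_le (μ := P) _ _).trans ?_
    have h2 : ∀ s ∈ (Finset.range N).filter (fun s => s + S i ≤ N),
        P ({h | 2 * L * √(S i) ≤ ∑ u ∈ Finset.Ico s (s + S i),
          (ℓ (u + 1) ((h (u + 1)).own i) - ownMean S k ω ℓ i u)} ∪
        {h | 2 * L * √(S i) ≤ ∑ u ∈ Finset.Ico s (s + S i),
          (ℓ (u + 1) ((h (u + 1)).pred i) - predMean S k ω ℓ i h u)}) ≤
        ENNReal.ofReal (2 * Real.exp (-L)) := by
      intro s hs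
      refine (MeasureTheory.measure_union_le (μ := P) _ _).trans ?_
      rw [two_mul (Real.exp (-L)), ENNReal.ofReal_add (Real.exp_nonneg _) (Real.exp_nonneg _)]
      have hi' := Finset.mem_range.1 hi
      have hs' := (Finset.mem_filter.1 hs).2
      exact add_le_add (own_deviation ω ℓ hS hm hℓ hi' hs' hL)
        (pred_deviation ω ℓ hS hm hℓ hi' hs' hL)
    refine (Finset.sum_le_sum h2).trans ?_
    rw [Finset.sum_const, nsmul_eq_mul, ENNReal.ofReal_mul (Nat.cast_nonneg N),
      ENNReal.ofReal_natCast]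
    gcongr
    exact (Finset.card_filter_le _ _).trans (by simp)
  refine (Finset.sum_le_sum h1).trans ?_
  rw [Finset.sum_const, Finset.card_range, nsmul_eq_mul, ← ENNReal.ofReal_natCast,
    ← ENNReal.ofReal_mul (Nat.cast_nonneg k)]
  exact ENNReal.ofReal_le_ofReal (by linarith)

/-- The two-expert instance of level `i` during one block. -/
lemma sum_predMean_le (hS : LegalBlocks S k) (hℓ : ∀ t e, ℓ t e ∈ Set.Icc (0 : ℝ) 1) {i s : ℕ}
    (hi : i + 1 < k) (hs : S (i + 1) ∣ s) (h : ℕ → Predictions n) :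
    ∑ u ∈ Finset.Ico s (s + S (i + 1)), predMean S k ω ℓ (i + 1) h u ≤
        ∑ u ∈ Finset.Ico s (s + S (i + 1)), ℓ (u + 1) ((h (u + 1)).own (i + 1)) +
          3 * √(S (i + 1)) ∧
      ∑ u ∈ Finset.Ico s (s + S (i + 1)), predMean S k ω ℓ (i + 1) h u ≤
        ∑ u ∈ Finset.Ico s (s + S (i + 1)), ℓ (u + 1) ((h (u + 1)).pred i) +
          3 * √(S (i + 1)) := by
  have hSp : (0 : ℝ) < S (i + 1) := by exact_mod_cast hS.pos hi.le
  set η := outerRate S (i + 1) with hη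
  set g : ℕ → Fin 2 → ℝ := fun v =>
    ![ℓ (s + v + 1) ((h (s + v + 1)).own (i + 1)), ℓ (s + v + 1) ((h (s + v + 1)).pred i)] with hg
  have hmean : ∀ v ∈ Finset.range (S (i + 1)), predMean S k ω ℓ (i + 1) h (s + v) =
      (∑ j, Real.exp (-η * ∑ w ∈ Finset.range v, g w j) * g v j) /
      (∑ j, Real.exp (-η * ∑ w ∈ Finset.range v, g w j)) := by
    intro v hv
    rw [predMean, wavg, stateOf_ext_add ω ℓ hS h hi hs (Finset.mem_range.1 hv), ← hη]
    simp [hg, Fin.sum_univ_two]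
  have hgmem : ∀ u < S (i + 1), ∀ j, g u j ∈ Set.Icc (0 : ℝ) 1 := by
    intro u _ j
    fin_cases j <;> exact hℓ _ _
  have hη0 : 0 < η := Real.sqrt_pos.2 (div_pos two_pos hSp)
  have hη2 : η ^ 2 * S (i + 1) = 2 := by
    rw [hη, outerRate, Real.sq_sqrt (div_nonneg two_pos.le hSp.le), div_mul_cancel₀ _ hSp.ne']
  -- Since η√S = √2 ≥ 1, the error (log 2 + 2)/η is at most 3√S.
  have hη3 : 1 ≤ η * √(S (i + 1)) := by
    rw [hη, outerRate, ← Real.sqrt_mul (div_nonneg two_pos.le hSp.le),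
      div_mul_cancel₀ _ hSp.ne']
    exact Real.one_le_sqrt.2 (by norm_num)
  have hlog : Real.log ((2 : ℕ) : ℝ) ≤ 1 := by
    have := Real.log_two_lt_d9
    push_cast
    linarith
  have key : ∀ j, ∑ u ∈ Finset.Ico s (s + S (i + 1)), predMean S k ω ℓ (i + 1) h u ≤
      ∑ v ∈ Finset.range (S (i + 1)), g v j + 3 * √(S (i + 1)) := by
    intro j
    have hMW := multiplicative_weights g (S (i + 1)) hgmem hη0.le j
    rw [sum_Ico_add_eq, Finset.sum_congr rfl hmean]
    refine le_of_mul_le_mul_left ?_ hη0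
    rw [Fintype.card_fin] at hMW
    have h3 : η * (3 * √(S (i + 1))) = 3 * (η * √(S (i + 1))) := mul_left_comm _ _ _
    rw [mul_add, h3]
    refine hMW.trans ?_
    rw [hη2]
    linarith
  refine ⟨?_, ?_⟩
  · refine (key 0).trans (le_of_eq ?_)
    rw [sum_Ico_add_eq]
    rfl
  · refine (key 1).trans (le_of_eq ?_)
    rw [sum_Ico_add_eq]
    rfl

/-- With concentrated choices, the combined prediction of the levels `0, …, i` competes with each
entry of bucket `i` during a block of level `i`. -/
lemma Concentrated.sum_pred_le_expert (hS : LegalBlocks S k)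
    (hℓ : ∀ t e, ℓ t e ∈ Set.Icc (0 : ℝ) 1) {L : ℝ} {h : ℕ → Predictions n}
    (hc : Concentrated S k ω ℓ L h) {b : ℝ} (hL : 0 ≤ L)
    (hb : ∀ s i, i < k → s ≤ N → √(Real.log (bkt S k ω ℓ s i).length) ≤ b) {i s : ℕ}
    (hi : i < k) (hs : S i ∣ s) (hN : s + S i ≤ N) {x : Entry n} (hx : x ∈ bkt S k ω ℓ s i) :
    ∑ u ∈ Finset.Ico s (s + S i), ℓ (u + 1) ((h (u + 1)).pred i) ≤
      ∑ u ∈ Finset.Ico s (s + S i), ℓ (u + 1) x.expert + √(S i) * (4 * L + 2 * b + 3) := by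
  obtain ⟨h1, h2⟩ := hc i hi s hN
  rw [Finset.sum_sub_distrib] at h1 h2
  have h3 := sum_ownMean_le ω ℓ hS hℓ hi hs hx
  rw [Real.sqrt_mul (Nat.cast_nonneg _)] at h3
  have h4 := mul_le_mul_of_nonneg_left (hb s i hi (by omega)) (Real.sqrt_nonneg (S i : ℝ))
  have h5 := Real.sqrt_nonneg (S i : ℝ)
  have h6 := mul_nonneg hL h5
  cases i with
  | zero =>
    simp only [predMean] at h2
    linarith
  | succ i =>
    have h7 := (sum_predMean_le ω ℓ hS hℓ hi hs h).1
    linarith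

/-- With concentrated choices, the combined prediction of the levels `0, …, i + 1` competes with
that of the levels `0, …, i` during a block of level `i + 1`. -/
lemma Concentrated.sum_pred_le_pred (hS : LegalBlocks S k)
    (hℓ : ∀ t e, ℓ t e ∈ Set.Icc (0 : ℝ) 1) {L : ℝ} {h : ℕ → Predictions n}
    (hc : Concentrated S k ω ℓ L h) {b : ℝ} (hL : 0 ≤ L) (hb : 0 ≤ b) {i s : ℕ}
    (hi : i + 1 < k) (hs : S (i + 1) ∣ s) (hN : s + S (i + 1) ≤ N) :
    ∑ u ∈ Finset.Ico s (s + S (i + 1)), ℓ (u + 1) ((h (u + 1)).pred (i + 1)) ≤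
      ∑ u ∈ Finset.Ico s (s + S (i + 1)), ℓ (u + 1) ((h (u + 1)).pred i) +
        √(S (i + 1)) * (4 * L + 2 * b + 3) := by
  obtain ⟨-, h2⟩ := hc (i + 1) hi s hN
  rw [Finset.sum_sub_distrib] at h2
  have h5 := Real.sqrt_nonneg (S (i + 1) : ℝ)
  have h6 := mul_nonneg hL h5
  have h8 := mul_nonneg hb h5
  have h7 := (sum_predMean_le ω ℓ hS hℓ hi hs h).2
  linarith

end regret

/-! ### Presence of experts in the buckets -/

section presence

variable {n m N : ℕ} {S : ℕ → ℕ} {k : ℕ} (ω : Samples n m k N) (ℓ : ℕ → Fin n → ℝ)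

lemma arrivals_arrival {a : ℝ} {es : List (Fin n)} {x : Entry n} (hx : x ∈ arrivals a es) :
    a ≤ x.arrival ∧ x.arrival < a + 1 / 2 ∧ x.loss = 0 := by
  obtain ⟨j, hj, rfl⟩ := List.mem_mapIdx.1 hx
  have h1 : (j : ℝ) < es.length := by exact_mod_cast hj
  have h0 : (0 : ℝ) ≤ j := Nat.cast_nonneg j
  have h2 : (j : ℝ) / (2 * es.length) < 1 / 2 := by
    rw [div_lt_div_iff₀ (by linarith) two_pos]
    linarith
  refine ⟨?_, ?_, rfl⟩
  · have : 0 ≤ (j : ℝ) / (2 * es.length) := by positivity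
    simpa using this
  · simpa using h2

lemma exists_mem_arrivals {a : ℝ} {es : List (Fin n)} {e : Fin n} (he : e ∈ es) :
    ∃ x ∈ arrivals a es, x.expert = e := by
  obtain ⟨j, hj, rfl⟩ := List.mem_iff_getElem.1 he
  exact ⟨_, List.mem_mapIdx.2 ⟨j, hj, rfl⟩, rfl⟩

/-- The loss of an entry is the loss of its expert since the day of arrival. -/
lemma bkt_invariant (hS : LegalBlocks S k) {t i : ℕ} (hi : i < k) {x : Entry n}
    (hx : x ∈ bkt S k ω ℓ t i) :
    ∃ a ≤ t, (a : ℝ) ≤ x.arrival ∧ x.arrival < a + 1 ∧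
      x.loss = ∑ u ∈ Finset.Ico a t, ℓ (u + 1) x.expert := by
  have hnew : ∀ {t : ℕ} {x : Entry n} (es es' : List (Fin n)),
      (x ∈ arrivals (t : ℝ) es ∨ x ∈ arrivals ((t : ℝ) + 1 / 2) es') →
      ∃ a ≤ t, (a : ℝ) ≤ x.arrival ∧ x.arrival < a + 1 ∧
        x.loss = ∑ u ∈ Finset.Ico a t, ℓ (u + 1) x.expert := by
    intro t x es es' h
    refine ⟨t, le_rfl, ?_⟩
    rcases h with h | h
    · obtain ⟨h1, h2, h3⟩ := arrivals_arrival h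
      exact ⟨h1, by linarith, by simp [h3]⟩
    · obtain ⟨h1, h2, h3⟩ := arrivals_arrival h
      exact ⟨by linarith, by linarith, by simp [h3]⟩
  induction t generalizing x with
  | zero =>
    rw [bkt_eq_of_dvd ω ℓ hS hi (dvd_zero _), List.mem_append, List.mem_append] at hx
    rcases hx with (hx | hx) | hx
    · obtain ⟨x₀, hx₀, -⟩ := mem_evict.1 hx
      simp [preBkt] at hx₀
    · exact hnew _ [] (Or.inl hx)
    · exact hnew [] _ (Or.inr hx)
  | succ t ih =>
    have hpre : ∀ x ∈ preBkt S k ω ℓ (t + 1) i, ∃ a ≤ t + 1, (a : ℝ) ≤ x.arrival ∧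
        x.arrival < a + 1 ∧ x.loss = ∑ u ∈ Finset.Ico a (t + 1), ℓ (u + 1) x.expert := by
      intro x hx
      obtain ⟨y, hy, rfl⟩ := List.mem_map.1 hx
      obtain ⟨a, ha, h1, h2, h3⟩ := ih hy
      refine ⟨a, by omega, h1, h2, ?_⟩
      rw [Finset.sum_Ico_succ_top ha, ← h3]
    by_cases h : S i ∣ t + 1
    · rw [bkt_eq_of_dvd ω ℓ hS hi h, List.mem_append, List.mem_append] at hx
      rcases hx with (hx | hx) | hx
      · obtain ⟨x₀, hx₀, -, rfl⟩ := mem_evict.1 hx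
        exact hpre x₀ hx₀
      · exact hnew _ [] (Or.inl hx)
      · exact hnew [] _ (Or.inr hx)
    · rw [bkt_succ_of_not_dvd ω ℓ hS hi h] at hx
      exact hpre x hx

lemma preBkt_invariant (hS : LegalBlocks S k) {t i : ℕ} (hi : i < k) {x : Entry n}
    (hx : x ∈ preBkt S k ω ℓ t i) :
    ∃ a < t, (a : ℝ) ≤ x.arrival ∧ x.arrival < a + 1 ∧
      x.loss = ∑ u ∈ Finset.Ico a t, ℓ (u + 1) x.expert := by
  cases t with
  | zero => simp [preBkt] at hx
  | succ t =>
    obtain ⟨y, hy, rfl⟩ := List.mem_map.1 hx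
    obtain ⟨a, ha, h1, h2, h3⟩ := bkt_invariant ω ℓ hS hi hy
    refine ⟨a, by omega, h1, h2, ?_⟩
    rw [Finset.sum_Ico_succ_top ha, ← h3]

/-- An entry of an earlier day was already in the bucket before the update. -/
lemma exists_mem_evict (hS : LegalBlocks S k) {t i : ℕ} (hi : i < k) (h : S i ∣ t) {x : Entry n}
    (hx : x ∈ bkt S k ω ℓ t i) (ha : x.arrival < t) :
    x ∈ evict (Real.log (S k) / m) (epochStart S k t) (preBkt S k ω ℓ t i) := by
  rw [bkt_eq_of_dvd ω ℓ hS hi h, List.mem_append, List.mem_append] at hx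
  rcases hx with (hx | hx) | hx
  · exact hx
  · linarith [(arrivals_arrival hx).1]
  · linarith [(arrivals_arrival hx).1]

lemma exists_mem_preBkt (hS : LegalBlocks S k) {t i : ℕ} (hi : i < k) {x : Entry n}
    (hx : x ∈ bkt S k ω ℓ t i) (ha : x.arrival < t) :
    ∃ y ∈ preBkt S k ω ℓ t i, y.expert = x.expert ∧ y.arrival = x.arrival := by
  by_cases h : S i ∣ t
  · obtain ⟨x₀, hx₀, -, rfl⟩ := mem_evict.1 (exists_mem_evict ω ℓ hS hi h hx ha)
    exact ⟨x₀, hx₀, rfl, rfl⟩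
  · cases t with
    | zero => exact absurd (dvd_zero _) h
    | succ t =>
      rw [bkt_succ_of_not_dvd ω ℓ hS hi h] at hx
      exact ⟨x, hx, rfl, rfl⟩

/-- Entries never come back: an entry is in the bucket from its arrival on. -/
lemma exists_mem_bkt_of_mem_preBkt (hS : LegalBlocks S k) {t i u : ℕ} (hi : i < k) {x : Entry n}
    (hx : x ∈ preBkt S k ω ℓ t i) (hu : x.arrival < u + 1) (hut : u < t) :
    ∃ y ∈ bkt S k ω ℓ u i, y.expert = x.expert ∧ y.arrival = x.arrival := by
  induction t, (Nat.succ_le_of_lt hut) using Nat.le_induction generalizing x with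
  | base =>
    obtain ⟨y, hy, rfl⟩ := List.mem_map.1 hx
    exact ⟨y, hy, rfl, rfl⟩
  | succ t ht ih =>
    obtain ⟨y, hy, rfl⟩ := List.mem_map.1 hx
    have h1 : (u : ℝ) + 1 ≤ t := by exact_mod_cast ht
    obtain ⟨z, hz, hz1, hz2⟩ := exists_mem_preBkt ω ℓ hS hi hy (by simp only at hu; linarith)
    obtain ⟨w, hw, hw1, hw2⟩ := ih hz (by rw [hz2]; exact hu) (by omega)
    exact ⟨w, hw, hw1.trans hz1, hw2.trans hz2⟩

/-- Experts are copied to all higher buckets that are updated. -/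
lemma exists_mem_bkt_of_lt (hS : LegalBlocks S k) {t i j : ℕ} (hij : i < j) (hj : j < k)
    (h : S j ∣ t) {x : Entry n} (hx : x ∈ bkt S k ω ℓ t i) (ha : x.arrival < t) :
    ∃ y ∈ bkt S k ω ℓ t j, y.expert = x.expert := by
  have hi : i < k := hij.trans hj
  have hx' := exists_mem_evict ω ℓ hS hi ((hS.dvd_of_le hij.le hj.le).trans h) hx ha
  obtain ⟨y, hy, hy'⟩ := exists_mem_arrivals (a := t) (e := x.expert)
    (List.mem_map_of_mem (List.mem_flatMap (f := fun j =>
      evict (Real.log (S k) / m) (epochStart S k t) (preBkt S k ω ℓ t j)).2 ⟨i, List.mem_range.2 hij, hx'⟩))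
  refine ⟨y, ?_, hy'⟩
  rw [bkt_eq_of_dvd ω ℓ hS hj h, List.mem_append, List.mem_append]
  exact Or.inl (Or.inr hy)

lemma mem_evict_of_not_dominated {ε : ℝ} {τ : ℕ} {B : List (Entry n)} {x : Entry n} (hx : x ∈ B)
    (h : ¬ ((τ : ℝ) + 1 / 2 ≤ x.arrival ∧ ∃ e' ∈ B, Dominates ε e' x)) :
    { x with weight := 1 } ∈ evict ε τ B := mem_evict.2 ⟨x, hx, h, rfl⟩

/-! ### Live entries and covers -/

variable (S k) in
/-- An entry of level `i` with the expert `e`, arriving at time `a` on day `b`, would not be evicted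
before day `N`. -/
def Live (e : Fin n) (i b : ℕ) (a : ℝ) : Prop :=
  ∀ t, b < t → t < N → S i ∣ t → epochStart S k t ≤ b → ∀ x ∈ preBkt S k ω ℓ t i,
    x.arrival < a →
      (1 + Real.log (S k) / m) * ∑ u ∈ Finset.Ico b t, ℓ (u + 1) e < x.loss

variable (S k) in
/-- From the end of day `b` to day `t`, the expert `c` is available from level `i` upwards and
competes with the expert `e`. -/
structure Cover (e : Fin n) (i b t : ℕ) (c : Fin n) : Prop where
  lt : b < t
  le : t ≤ N
  dvd : S i ∣ t
  mem : ∃ x ∈ bkt S k ω ℓ b i, x.expert = c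
  inner : ∀ j, i ≤ j → j < k → ∀ s, S j ∣ s → b < s → s < t →
    s + S j ≤ t ∧ ∃ x ∈ bkt S k ω ℓ s j, x.expert = c
  loss : ∑ u ∈ Finset.Ico b t, ℓ (u + 1) c ≤
    (1 + Real.log (S k) / m) * ∑ u ∈ Finset.Ico b t, ℓ (u + 1) e

lemma Live.mono {e : Fin n} {i b : ℕ} {a a' : ℝ} (h : Live S k ω ℓ e i b a') (ha : a ≤ a') :
    Live S k ω ℓ e i b a :=
  fun t h1 h2 h3 h4 x hx hxa => h t h1 h2 h3 h4 x hx (hxa.trans_le ha)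

/-- The witness against `Live` is an entry that would dominate a copy of `e`. It arrived before `b +
1` and lasts until `t`, so it is in the bucket throughout and is copied upwards at each block start
in between. Its recorded loss includes the days before `b`, which only helps. -/
lemma exists_cover_of_not_live (hS : LegalBlocks S k) (hℓ : ∀ t e, ℓ t e ∈ Set.Icc (0 : ℝ) 1)
    {e : Fin n} {i b : ℕ} (hi : i < k) (h : ¬ Live S k ω ℓ e i b (b + 1)) :
    ∃ t c, Cover S k ω ℓ e i b t c := by
  unfold Live at h
  push Not at h
  obtain ⟨t, hbt, htN, hdvd, hep, x, hx, hxa, hloss⟩ := h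
  have h0 : S 0 ∣ t := (hS.dvd_of_le (Nat.zero_le _) hi.le).trans hdvd
  refine ⟨t, x.expert, hbt, htN.le, hdvd, ?_, ?_, ?_⟩
  · obtain ⟨y, hy, hy', -⟩ := exists_mem_bkt_of_mem_preBkt ω ℓ hS hi hx hxa hbt
    exact ⟨y, hy, hy'⟩
  · intro j hij hj s hs hbs hst
    -- The epoch condition on evictions is what prevents `t` from cutting a block of a higher level
    -- that starts after `b`.
    refine ⟨hS.add_le_of_epochStart_le hj h0 hs hep hbs hst, ?_⟩
    have hbs' : (b : ℝ) + 1 ≤ s := by exact_mod_cast hbs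
    obtain ⟨y, hy, hy', hya⟩ := exists_mem_bkt_of_mem_preBkt ω ℓ hS hi (u := s) hx
      (by linarith) hst
    rcases hij.eq_or_lt with rfl | hij
    · exact ⟨y, hy, hy'⟩
    · obtain ⟨z, hz, hz'⟩ := exists_mem_bkt_of_lt ω ℓ hS hij hj hs hy (by linarith)
      exact ⟨z, hz, hz'.trans hy'⟩
  · obtain ⟨a, hat, ha1, ha2, ha3⟩ := preBkt_invariant ω ℓ hS hi hx
    refine le_trans ?_ hloss
    rw [ha3]
    have hab : a ≤ b := by
      have : (a : ℝ) < b + 1 := by linarith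
      exact Nat.lt_succ_iff.1 (by exact_mod_cast this)
    exact Finset.sum_le_sum_of_subset_of_nonneg (Finset.Ico_subset_Ico_left hab)
      fun u _ _ => (hℓ _ _).1

/-- The arrival time of the sample `j` of day `b`. -/
def slotTime (m b j : ℕ) : ℝ := b + 1 / 2 + (j : ℝ) / (2 * m)

lemma slotTime_bounds {b j : ℕ} (hj : j < m) :
    (b : ℝ) + 1 / 2 ≤ slotTime m b j ∧ slotTime m b j < b + 1 := by
  have h1 : (j : ℝ) < m := by exact_mod_cast hj
  have h0 : (0 : ℝ) ≤ j := Nat.cast_nonneg j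
  have h2 : (j : ℝ) / (2 * m) < 1 / 2 := by
    rw [div_lt_div_iff₀ (by linarith) two_pos]
    linarith
  have : 0 ≤ (j : ℝ) / (2 * m) := by positivity
  unfold slotTime
  constructor <;> linarith

lemma exists_mem_bkt_of_sample (hS : LegalBlocks S k) {b i j : ℕ} (hi : i < k) (hb : b < N + 1)
    (hj : j < m) (h : S i ∣ b) :
    ∃ x ∈ bkt S k ω ℓ b i, x.expert = ω ⟨b, hb⟩ ⟨i, hi⟩ ⟨j, hj⟩ ∧ x.arrival = slotTime m b j := by
  have hlen := length_samples_at ω (t := b) (by omega) hi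
  refine ⟨⟨ω ⟨b, hb⟩ ⟨i, hi⟩ ⟨j, hj⟩, slotTime m b j, 0, 1⟩, ?_, rfl, rfl⟩
  rw [bkt_eq_of_dvd ω ℓ hS hi h, List.mem_append]
  refine Or.inr (List.mem_mapIdx.2 ⟨j, by rw [hlen]; exact hj, ?_⟩)
  simp only [hlen]
  congr 1
  simp only [Samples.at, hb, hi, and_self, dite_true]
  simp

/-- A sampled live entry stays in its bucket. -/
lemma exists_mem_bkt_of_live (hS : LegalBlocks S k) {e : Fin n} {b i j : ℕ} (hi : i < k)
    (hb : b < N + 1) (hj : j < m) (h : S i ∣ b) (he : ω ⟨b, hb⟩ ⟨i, hi⟩ ⟨j, hj⟩ = e)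
    (hlive : Live S k ω ℓ e i b (slotTime m b j)) {t : ℕ} (hbt : b ≤ t) (htN : t < N) :
    ∃ x ∈ bkt S k ω ℓ t i, x.expert = e ∧ x.arrival = slotTime m b j := by
  induction t, hbt using Nat.le_induction with
  | base =>
    obtain ⟨x, hx, hx1, hx2⟩ := exists_mem_bkt_of_sample ω ℓ hS hi hb hj h
    exact ⟨x, hx, hx1.trans he, hx2⟩
  | succ t hbt ih =>
    obtain ⟨x, hx, hx1, hx2⟩ := ih (by omega)
    obtain ⟨y, hy, hy1, hy2⟩ : ∃ y ∈ preBkt S k ω ℓ (t + 1) i, y.expert = e ∧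
        y.arrival = slotTime m b j := ⟨_, List.mem_map_of_mem hx, hx1, hx2⟩
    by_cases hd : S i ∣ t + 1
    · refine ⟨{ y with weight := 1 }, ?_, hy1, hy2⟩
      rw [bkt_eq_of_dvd ω ℓ hS hi hd, List.mem_append, List.mem_append]
      refine Or.inl (Or.inl (mem_evict_of_not_dominated hy ?_))
      rintro ⟨h1, z, hz, hz1, hz2⟩
      obtain ⟨hs1, hs2⟩ := slotTime_bounds (b := b) hj
      -- Eviction needs arrival at least τ + 1/2, and the sample arrived before b + 1; so τ ≤ b, and
      -- this eviction is among those excluded by `Live`.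
      have hep : epochStart S k (t + 1) ≤ b := by
        have : (epochStart S k (t + 1) : ℝ) < b + 1 := by linarith
        exact Nat.lt_succ_iff.1 (by exact_mod_cast this)
      obtain ⟨a, ha, ha1, ha2, ha3⟩ := preBkt_invariant ω ℓ hS hi hy
      have hab : a = b := by
        have h3 : (a : ℝ) < b + 1 := by linarith
        have h4 : (b : ℝ) < a + 1 := by linarith
        have h3 : a < b + 1 := by exact_mod_cast h3
        have h4 : b < a + 1 := by exact_mod_cast h4
        omega
      have := hlive (t + 1) (by omega) htN hd hep z hz (by linarith)
      rw [ha3, hab, hy1] at hz2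
      linarith
    · rw [bkt_succ_of_not_dvd ω ℓ hS hi hd]
      exact ⟨y, hy, hy1, hy2⟩

/-- One successful sample settles all later starts: `e` stays to the end and covers itself, and `N`
is a multiple of every block size. -/
lemma cover_of_live_sample (hS : LegalBlocks S k) (hN : S k = N)
    (hℓ : ∀ t e, ℓ t e ∈ Set.Icc (0 : ℝ) 1) {e : Fin n} {b i j : ℕ} (hi : i < k)
    (hb : b < N + 1) (hj : j < m) (h : S i ∣ b) (he : ω ⟨b, hb⟩ ⟨i, hi⟩ ⟨j, hj⟩ = e)
    (hlive : Live S k ω ℓ e i b (slotTime m b j)) {b' : ℕ} (hbb' : b ≤ b') (hb' : b' < N) :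
    Cover S k ω ℓ e i b' N e := by
  have hdN : ∀ j < k, S j ∣ N := fun j hj => hN ▸ hS.dvd_of_le hj.le le_rfl
  refine ⟨hb', le_rfl, hdN i hi, ?_, ?_, ?_⟩
  · obtain ⟨x, hx, hx1, -⟩ := exists_mem_bkt_of_live ω ℓ hS hi hb hj h he hlive hbb' hb'
    exact ⟨x, hx, hx1⟩
  · intro j' hij hj' s hs hbs hsN
    refine ⟨?_, ?_⟩
    · have hd := Nat.dvd_sub (hdN j' hj') hs
      have := Nat.le_of_dvd (by omega) hd
      omega
    · obtain ⟨x, hx, hx1, hx2⟩ := exists_mem_bkt_of_live ω ℓ hS hi hb hj h he hlive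
        (hbb'.trans hbs.le) hsN
      rcases hij.eq_or_lt with rfl | hij
      · exact ⟨x, hx, hx1⟩
      · have h1 := (slotTime_bounds (b := b) hj).2
        have h2 : (b : ℝ) + 1 ≤ s := by exact_mod_cast (Nat.succ_le_of_lt (hbb'.trans_lt hbs))
        obtain ⟨y, hy, hy1⟩ := exists_mem_bkt_of_lt ω ℓ hS hij hj' hs hx (by linarith)
        exact ⟨y, hy, hy1.trans hx1⟩
  · have h1 : 0 ≤ ∑ u ∈ Finset.Ico b' N, ℓ (u + 1) e := Finset.sum_nonneg fun u _ => (hℓ _ _).1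
    have h2 : 0 ≤ Real.log (S k) / m := div_nonneg (Real.log_natCast_nonneg _) (Nat.cast_nonneg m)
    nlinarith

end presence

/-! ### Dependence on the samples -/

section locality

variable {n m N : ℕ} {S : ℕ → ℕ} {k : ℕ} {ω ω' : Samples n m k N} (ℓ : ℕ → Fin n → ℝ)

lemma preBkt_congr {t i : ℕ} (h : ∀ t, bkt S k ω ℓ t i = bkt S k ω' ℓ t i) :
    preBkt S k ω ℓ t i = preBkt S k ω' ℓ t i := by
  cases t with
  | zero => rfl
  | succ t => simp only [preBkt, observe, h]

/-- Copies only move upwards, so samples of level `i` and above do not affect the buckets below `i`.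
-/
lemma bkt_congr_lower (hS : LegalBlocks S k) {i : ℕ} (hi : i ≤ k)
    (H : ∀ t, ∀ j < i, ω.at t j = ω'.at t j) (t : ℕ) :
    ∀ j < i, bkt S k ω ℓ t j = bkt S k ω' ℓ t j := by
  have hdvd : ∀ t, (∀ j < i, preBkt S k ω ℓ t j = preBkt S k ω' ℓ t j) →
      ∀ j < i, S j ∣ t → bkt S k ω ℓ t j = bkt S k ω' ℓ t j := by
    intro t hpre j hj hd
    rw [bkt_eq_of_dvd ω ℓ hS (by omega) hd, bkt_eq_of_dvd ω' ℓ hS (by omega) hd, H t j hj,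
      hpre j hj]
    congr 4
    refine List.flatMap_congr ?_
    intro j' hj'
    rw [hpre j' ((List.mem_range.1 hj').trans hj)]
  induction t with
  | zero => exact fun j hj => hdvd 0 (fun _ _ => rfl) j hj (dvd_zero _)
  | succ t ih =>
    have hpre : ∀ j < i, preBkt S k ω ℓ (t + 1) j = preBkt S k ω' ℓ (t + 1) j := by
      intro j hj
      simp only [preBkt, observe, ih j hj]
    intro j hj
    by_cases hd : S j ∣ t + 1
    · exact hdvd _ hpre j hj hd
    · rw [bkt_succ_of_not_dvd ω ℓ hS (by omega) hd, bkt_succ_of_not_dvd ω' ℓ hS (by omega) hd,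
        hpre j hj]

/-- All entries of `B` which arrived before time `a` are entries of `B'`, up to their weights. -/
def SubBefore (a : ℝ) (B B' : List (Entry n)) : Prop :=
  ∀ x ∈ B, x.arrival < a → ∃ y ∈ B', y.expert = x.expert ∧ y.arrival = x.arrival ∧ y.loss = x.loss

lemma SubBefore.observe {a : ℝ} {B B' : ℕ → List (Entry n)} {i : ℕ}
    (h : SubBefore a (B i) (B' i)) (l : Fin n → ℝ) :
    SubBefore a (observe S l B i) (observe S l B' i) := by
  intro x hx hxa
  obtain ⟨x₀, hx₀, rfl⟩ := List.mem_map.1 hx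
  obtain ⟨y₀, hy₀, h1, h2, h3⟩ := h x₀ hx₀ hxa
  exact ⟨_, List.mem_map_of_mem hy₀, h1, h2, by simp only [h1, h3]⟩

/-- Both inclusions are needed: a dominator of a surviving entry arrives even earlier, so it could
be transported back to the first bucket. -/
lemma SubBefore.evict {a ε : ℝ} {τ : ℕ} {B B' : List (Entry n)} (h : SubBefore a B B')
    (h' : SubBefore a B' B) : SubBefore a (evict ε τ B) (evict ε τ B') := by
  intro x hx hxa
  obtain ⟨x₀, hx₀, hnd, rfl⟩ := mem_evict.1 hx
  obtain ⟨y₀, hy₀, h1, h2, h3⟩ := h x₀ hx₀ hxa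
  refine ⟨_, mem_evict_of_not_dominated hy₀ ?_, h1, h2, h3⟩
  rintro ⟨h4, z, hz, hz1, hz2⟩
  obtain ⟨w, hw, -, hw2, hw3⟩ := h' z hz ((hz1.trans_eq h2).trans hxa)
  refine hnd ⟨h2 ▸ h4, w, hw, ?_, ?_⟩
  · rw [hw2, ← h2]; exact hz1
  · rw [hw3, ← h3]; exact hz2

lemma SubBefore.refl (a : ℝ) (B : List (Entry n)) : SubBefore a B B :=
  fun x hx _ => ⟨x, hx, rfl, rfl, rfl⟩

lemma SubBefore.append {a : ℝ} {B₁ B₂ B₁' B₂' : List (Entry n)} (h₁ : SubBefore a B₁ B₁')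
    (h₂ : SubBefore a B₂ B₂') : SubBefore a (B₁ ++ B₂) (B₁' ++ B₂') := by
  intro x hx hxa
  rcases List.mem_append.1 hx with hx | hx
  · obtain ⟨y, hy, h⟩ := h₁ x hx hxa
    exact ⟨y, List.mem_append_left _ hy, h⟩
  · obtain ⟨y, hy, h⟩ := h₂ x hx hxa
    exact ⟨y, List.mem_append_right _ hy, h⟩

lemma subBefore_samples {a : ℝ} {t i : ℕ} (ht : t < N + 1) (hi : i < k)
    (H : ∀ j : Fin m, slotTime m t j < a → ω ⟨t, ht⟩ ⟨i, hi⟩ j = ω' ⟨t, ht⟩ ⟨i, hi⟩ j) :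
    SubBefore a (arrivals ((t : ℝ) + 1 / 2) (ω.at t i)) (arrivals ((t : ℝ) + 1 / 2) (ω'.at t i)) := by
  intro x hx hxa
  have hlen := length_samples_at ω (t := t) (by omega) hi
  have hlen' := length_samples_at ω' (t := t) (by omega) hi
  obtain ⟨j, hj, rfl⟩ := List.mem_mapIdx.1 hx
  have hjm : j < m := by rwa [hlen] at hj
  simp only [hlen] at hxa
  have h1 := H ⟨j, hjm⟩ hxa
  refine ⟨_, List.mem_mapIdx.2 ⟨j, by rwa [hlen'], rfl⟩, ?_, ?_, rfl⟩
  · simp only [Samples.at, ht, hi, and_self, dite_true]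
    simpa using h1.symm
  · simp only [hlen, hlen']

/-- Entries are dominated only by earlier arrivals, so samples from time `a` on cannot affect the
fate of older entries. Weights are disregarded because eviction never reads them. -/
lemma subBefore_bkt (hS : LegalBlocks S k) {a : ℝ} {i : ℕ} (hi : i < k)
    (H₁ : ∀ t, ∀ j < i, ω.at t j = ω'.at t j)
    (H₂ : ∀ t (ht : t < N + 1) (j : Fin m), slotTime m t j < a →
      ω ⟨t, ht⟩ ⟨i, hi⟩ j = ω' ⟨t, ht⟩ ⟨i, hi⟩ j) (t : ℕ) :
    SubBefore a (bkt S k ω ℓ t i) (bkt S k ω' ℓ t i) ∧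
      SubBefore a (bkt S k ω' ℓ t i) (bkt S k ω ℓ t i) := by
  have hlow := bkt_congr_lower ℓ hS hi.le H₁
  have hnew : ∀ t, SubBefore a (preBkt S k ω ℓ t i) (preBkt S k ω' ℓ t i) →
      SubBefore a (preBkt S k ω' ℓ t i) (preBkt S k ω ℓ t i) → S i ∣ t →
      SubBefore a (bkt S k ω ℓ t i) (bkt S k ω' ℓ t i) ∧
      SubBefore a (bkt S k ω' ℓ t i) (bkt S k ω ℓ t i) := by
    intro t h1 h2 hd
    have h3 : ((List.range i).flatMap fun j =>
        evict (Real.log (S k) / m) (epochStart S k t) (preBkt S k ω ℓ t j)) =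
        (List.range i).flatMap fun j =>
        evict (Real.log (S k) / m) (epochStart S k t) (preBkt S k ω' ℓ t j) := by
      refine List.flatMap_congr ?_
      intro j hj
      rw [preBkt_congr ℓ fun t => hlow t j (List.mem_range.1 hj)]
    have h4 : SubBefore a (arrivals ((t : ℝ) + 1 / 2) (ω.at t i))
          (arrivals ((t : ℝ) + 1 / 2) (ω'.at t i)) ∧
        SubBefore a (arrivals ((t : ℝ) + 1 / 2) (ω'.at t i))
          (arrivals ((t : ℝ) + 1 / 2) (ω.at t i)) := by
      by_cases ht : t < N + 1
      · exact ⟨subBefore_samples ht hi (H₂ t ht),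
          subBefore_samples ht hi fun j hj => (H₂ t ht j hj).symm⟩
      · have : ∀ ω : Samples n m k N, ω.at t i = [] := fun ω => by
          rw [Samples.at, dif_neg (by tauto)]
        rw [this, this]
        exact ⟨SubBefore.refl _ _, SubBefore.refl _ _⟩
    rw [bkt_eq_of_dvd ω ℓ hS hi hd, bkt_eq_of_dvd ω' ℓ hS hi hd, h3]
    exact ⟨((h1.evict h2).append (SubBefore.refl _ _)).append h4.1,
      ((h2.evict h1).append (SubBefore.refl _ _)).append h4.2⟩
  induction t with
  | zero => exact hnew 0 (SubBefore.refl _ _) (SubBefore.refl _ _) (dvd_zero _)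
  | succ t ih =>
    have h1 := ih.1.observe (S := S) (ℓ (t + 1))
    have h2 := ih.2.observe (S := S) (ℓ (t + 1))
    by_cases hd : S i ∣ t + 1
    · exact hnew _ h1 h2 hd
    · rw [bkt_succ_of_not_dvd ω ℓ hS hi hd, bkt_succ_of_not_dvd ω' ℓ hS hi hd]
      exact ⟨h1, h2⟩

/-- This makes liveness at a slot time independent of the sample in that slot and of later ones, as
the sequential trials require. -/
lemma Live.congr (hS : LegalBlocks S k) {e : Fin n} {a : ℝ} {i b : ℕ} (hi : i < k)
    (H₁ : ∀ t, ∀ j < i, ω.at t j = ω'.at t j)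
    (H₂ : ∀ t (ht : t < N + 1) (j : Fin m), slotTime m t j < a →
      ω ⟨t, ht⟩ ⟨i, hi⟩ j = ω' ⟨t, ht⟩ ⟨i, hi⟩ j)
    (h : Live S k ω ℓ e i b a) : Live S k ω' ℓ e i b a := by
  intro t hbt htN hd hep x hx hxa
  cases t with
  | zero => omega
  | succ t =>
    obtain ⟨y, hy, -, hy2, hy3⟩ :=
      (subBefore_bkt ℓ hS hi H₁ H₂ t).2.observe (S := S) (ℓ (t + 1)) x hx hxa
    rw [← hy3]
    exact h (t + 1) hbt htN hd hep y hy (hy2 ▸ hxa)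

end locality

/-! ### Sequential trials -/

section trials

/-- Resampling one coordinate does not change a sum over a product space. -/
lemma sum_resample {Ω α : Type} [Fintype Ω] [Fintype α] (get : Ω → α) (set : Ω → α → Ω)
    (h₁ : ∀ ω v, get (set ω v) = v) (h₂ : ∀ ω, set ω (get ω) = ω)
    (h₃ : ∀ ω v w, set (set ω v) w = set ω w) (F : Ω → ℝ) :
    ∑ ω, ∑ v, F (set ω v) = Fintype.card α * ∑ ω, F ω := by
  -- Exchanging the coordinate with the spare value permutes the product space.
  have hinv : Function.Involutive fun p : Ω × α => (set p.1 p.2, get p.1) := by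
    rintro ⟨ω, v⟩
    simp only [h₁, h₂, h₃]
  have h := Equiv.sum_comp hinv.toPerm fun p : Ω × α => F p.1
  rw [Fintype.sum_prod_type, Fintype.sum_prod_type] at h
  calc _ = ∑ ω : Ω, ∑ _v : α, F ω := h
    _ = _ := by simp [Finset.mul_sum]

/-- A product of conditionally submean factors over linearly ordered coordinates. -/
lemma sum_prod_le_card {Ω α ι : Type} [Fintype Ω] [Fintype α] [LinearOrder ι] [Nonempty α]
    (get : ι → Ω → α) (set : ι → Ω → α → Ω)
    (h₁ : ∀ p ω v, get p (set p ω v) = v) (h₂ : ∀ p ω, set p ω (get p ω) = ω)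
    (h₃ : ∀ p ω v w, set p (set p ω v) w = set p ω w) (g : ι → Ω → ℝ)
    (hg : ∀ p ω, 0 ≤ g p ω) (hloc : ∀ p p', p < p' → ∀ ω v, g p (set p' ω v) = g p ω)
    (hsum : ∀ p ω, ∑ v, g p (set p ω v) ≤ Fintype.card α) (s : Finset ι) :
    ∑ ω, ∏ p ∈ s, g p ω ≤ Fintype.card Ω := by
  induction s using Finset.induction_on_max with
  | empty => simp
  | insert p s hp ih =>
    have hcard : (0 : ℝ) < Fintype.card α := by exact_mod_cast Fintype.card_pos
    have hnot : p ∉ s := fun h => lt_irrefl _ (hp p h)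
    refine le_of_mul_le_mul_left ?_ hcard
    rw [← sum_resample (get p) (set p) (h₁ p) (h₂ p) (h₃ p)]
    calc ∑ ω, ∑ v, ∏ p' ∈ insert p s, g p' (set p ω v)
        = ∑ ω, (∏ p' ∈ s, g p' ω) * ∑ v, g p (set p ω v) := by
          refine Finset.sum_congr rfl fun ω _ => ?_
          rw [Finset.mul_sum]
          refine Finset.sum_congr rfl fun v _ => ?_
          rw [Finset.prod_insert hnot, mul_comm]
          congr 1
          exact Finset.prod_congr rfl fun p' hp' => hloc p' p (hp p' hp') ω v
      _ ≤ ∑ ω, (∏ p' ∈ s, g p' ω) * Fintype.card α :=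
          Finset.sum_le_sum fun ω _ =>
            mul_le_mul_of_nonneg_left (hsum p ω) (Finset.prod_nonneg fun p' _ => hg p' ω)
      _ = Fintype.card α * ∑ ω, ∏ p' ∈ s, g p' ω := by rw [← Finset.sum_mul, mul_comm]
      _ ≤ _ := mul_le_mul_of_nonneg_left ih hcard.le

/-- If each trial, when it is active, hits a given value with probability `1 / card α`, then many
active trials without a hit are unlikely. -/
lemma toOuterMeasure_trials_le {Ω α ι : Type} [Fintype Ω] [Nonempty Ω] [Fintype α] [DecidableEq α]
    [LinearOrder ι] [Nonempty α] (get : ι → Ω → α) (set : ι → Ω → α → Ω)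
    (h₁ : ∀ p ω v, get p (set p ω v) = v) (h₂ : ∀ p ω, set p ω (get p ω) = ω)
    (h₃ : ∀ p ω v w, set p (set p ω v) w = set p ω w)
    (h₄ : ∀ p p', p < p' → ∀ ω v, get p (set p' ω v) = get p ω)
    (active : ι → Ω → Prop) [∀ p ω, Decidable (active p ω)]
    (hloc : ∀ p p', p ≤ p' → ∀ ω v, active p (set p' ω v) ↔ active p ω)
    (e : α) (s : Finset ι) (r : ℝ) :
    (PMF.uniformOfFintype Ω).toOuterMeasure
      {ω | (∀ p ∈ s, active p ω → get p ω ≠ e) ∧ r ≤ (s.filter fun p => active p ω).card} ≤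
      ENNReal.ofReal (Real.exp (-(r / Fintype.card α))) := by
  classical
  set c : ℝ := ((Fintype.card α : ℕ) : ℝ) with hc
  have hcpos : 0 < c := by rw [hc]; exact_mod_cast Fintype.card_pos
  -- An active miss gains the factor e^{1/c}, a hit kills the product, an inactive trial does
  -- nothing; each factor has conditional mean at most 1.
  set g : ι → Ω → ℝ := fun p ω =>
    if active p ω then (if get p ω = e then 0 else Real.exp (1 / c)) else 1 with hg
  have hg0 : ∀ p ω, 0 ≤ g p ω := by
    intro p ω
    simp only [hg]
    split_ifs
    · exact le_rfl
    · exact Real.exp_nonneg _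
    · exact zero_le_one
  have hmain : ∑ ω, ∏ p ∈ s, g p ω ≤ Fintype.card Ω := by
    refine sum_prod_le_card get set h₁ h₂ h₃ g hg0 ?_ ?_ s
    · intro p p' hp ω v
      simp only [hg, hloc p p' hp.le ω v, h₄ p p' hp ω v]
    · intro p ω
      simp only [hg, hloc p p le_rfl, h₁]
      split_ifs with hact
      · have h5 : ∀ v : α, (if v = e then (0 : ℝ) else Real.exp (1 / c)) =
            Real.exp (1 / c) - if v = e then Real.exp (1 / c) else 0 := by
          intro v
          split_ifs <;> simp
        simp only [h5, Finset.sum_sub_distrib, Finset.sum_ite_eq', Finset.mem_univ, if_true,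
          Finset.sum_const, Finset.card_univ, nsmul_eq_mul]
        rw [← hc]
        -- The required inequality is (c - 1)e^{1/c} ≤ c.
        have h6 := Real.one_sub_le_exp_neg (1 / c)
        have h7 : Real.exp (-(1 / c)) * Real.exp (1 / c) = 1 := by rw [← Real.exp_add]; simp
        have h8 := mul_le_mul_of_nonneg_right h6 (Real.exp_nonneg (1 / c))
        rw [h7] at h8
        have h9 := mul_le_mul_of_nonneg_left h8 hcpos.le
        have h10 : c * ((1 - 1 / c) * Real.exp (1 / c)) =
            c * Real.exp (1 / c) - Real.exp (1 / c) := by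
          field_simp
        linarith
      · simp
  have hΩ : (0 : ℝ) < Fintype.card Ω := by exact_mod_cast Fintype.card_pos
  rw [toOuterMeasure_eq_pexp]
  have hpt : ∀ ω, ({ω | (∀ p ∈ s, active p ω → get p ω ≠ e) ∧
      r ≤ (s.filter fun p => active p ω).card} : Set Ω).indicator (1 : Ω → ℝ≥0∞) ω ≤
      ENNReal.ofReal (Real.exp (-(r / c))) * ENNReal.ofReal (∏ p ∈ s, g p ω) := by
    intro ω
    by_cases hω : (∀ p ∈ s, active p ω → get p ω ≠ e) ∧ r ≤ (s.filter fun p => active p ω).card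
    · rw [Set.indicator_of_mem (by exact hω), ← ENNReal.ofReal_mul (Real.exp_nonneg _),
        Pi.one_apply, ← ENNReal.ofReal_one]
      apply ENNReal.ofReal_le_ofReal
      have h5 : ∏ p ∈ s, g p ω = Real.exp ((s.filter fun p => active p ω).card / c) := by
        have h6 : ∀ p ∈ s, g p ω = if active p ω then Real.exp (1 / c) else 1 := by
          intro p hp
          simp only [hg]
          split_ifs with h7 h8
          · exact absurd h8 (hω.1 p hp h7)
          · rfl
          · rfl
        rw [Finset.prod_congr rfl h6, ← Finset.prod_filter, Finset.prod_const, ← Real.exp_nat_mul]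
        congr 1
        ring
      rw [h5, ← Real.exp_add, ← Real.exp_zero]
      apply Real.exp_le_exp.2
      have := div_le_div_of_nonneg_right hω.2 hcpos.le
      linarith
    · rw [Set.indicator_of_notMem (by exact hω)]
      exact zero_le
  refine (pexp_mono _ hpt).trans ?_
  rw [pexp_const_mul]
  refine mul_le_of_le_one_right' ?_
  rw [pexp, tsum_fintype]
  simp only [PMF.uniformOfFintype_apply]
  rw [← Finset.mul_sum, ← ENNReal.ofReal_sum_of_nonneg fun ω _ =>
    Finset.prod_nonneg fun p _ => hg0 p ω, ← ENNReal.ofReal_natCast, mul_comm, ← div_eq_mul_inv]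
  exact ENNReal.div_le_of_le_mul (by rw [one_mul]; exact ENNReal.ofReal_le_ofReal hmain)

end trials

/-! ### Blocks without a cover -/

section uncovered

variable {n m N : ℕ} {S : ℕ → ℕ} {k : ℕ}

/-- The sample of level `i` in the slot `p`. -/
def getSlot (i : Fin k) (p : Fin (N + 1) ×ₗ Fin m) (ω : Samples n m k N) : Fin n :=
  ω (ofLex p).1 i (ofLex p).2

/-- Replace the sample of level `i` in the slot `p`. -/
def setSlot (i : Fin k) (p : Fin (N + 1) ×ₗ Fin m) (ω : Samples n m k N) (v : Fin n) :
    Samples n m k N :=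
  Function.update ω (ofLex p).1 (Function.update (ω (ofLex p).1) i
    (Function.update (ω (ofLex p).1 i) (ofLex p).2 v))

lemma setSlot_apply (i : Fin k) (p : Fin (N + 1) ×ₗ Fin m) (ω : Samples n m k N) (v : Fin n)
    (t : Fin (N + 1)) (i' : Fin k) (j : Fin m) :
    setSlot i p ω v t i' j =
      if t = (ofLex p).1 ∧ i' = i ∧ j = (ofLex p).2 then v else ω t i' j := by
  unfold setSlot
  by_cases h1 : t = (ofLex p).1
  · subst h1
    by_cases h2 : i' = i
    · subst h2
      by_cases h3 : j = (ofLex p).2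
      · subst h3; simp
      · simp [h3]
    · simp [h2]
  · simp [h1]

lemma slotTime_le_of_le {p p' : Fin (N + 1) ×ₗ Fin m} (h : p ≤ p') :
    slotTime m (ofLex p).1 (ofLex p).2 ≤ slotTime m (ofLex p').1 (ofLex p').2 := by
  rcases Prod.Lex.le_iff.1 h with h | ⟨h1, h2⟩
  · have h3 := (slotTime_bounds (b := (ofLex p).1) (ofLex p).2.2).2
    have h4 := (slotTime_bounds (b := (ofLex p').1) (ofLex p').2.2).1
    have h5 : (((ofLex p).1 : ℕ) : ℝ) + 1 ≤ ((ofLex p').1 : ℕ) := by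
      exact_mod_cast (Fin.lt_def.1 h)
    linarith
  · unfold slotTime
    rw [h1]
    have : (((ofLex p).2 : ℕ) : ℝ) ≤ ((ofLex p').2 : ℕ) := by exact_mod_cast h2
    gcongr

variable (S) (ℓ : ℕ → Fin n → ℝ)

/-- The starts of the blocks of level `i` which are not covered. -/
def uncovered (ω : Samples n m k N) (e : Fin n) (i : ℕ) : Finset ℕ :=
  open Classical in
  (Finset.range N).filter fun b => S i ∣ b ∧ ¬ ∃ t c, Cover S k ω ℓ e i b t c

variable {S}

lemma toOuterMeasure_uncovered_le [NeZero n] (hS : LegalBlocks S k) (hN : S k = N)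
    (hℓ : ∀ t e, ℓ t e ∈ Set.Icc (0 : ℝ) 1) (e : Fin n) {i : ℕ} (hi : i < k) {r : ℝ}
    (hr : 0 ≤ r) : (PMF.uniformOfFintype (Samples n m k N)).toOuterMeasure
      {ω | r < (uncovered S ℓ ω e i).card} ≤ ENNReal.ofReal (N * Real.exp (-(r * m / n))) := by
  classical
  set P := (PMF.uniformOfFintype (Samples n m k N)).toOuterMeasure with hP
  -- Slots are ordered lexicographically, that is by arrival time. A slot is active if `e`, sampled
  -- there, would never be evicted before day `N`.
  set active : Fin (N + 1) ×ₗ Fin m → Samples n m k N → Prop := fun p ω =>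
    S i ∣ (ofLex p).1 ∧ Live S k ω ℓ e i (ofLex p).1 (slotTime m (ofLex p).1 (ofLex p).2)
    with hactive
  have hslot : ∀ (p' : Fin (N + 1) ×ₗ Fin m) (ω : Samples n m k N) (v : Fin n) (a : ℝ),
      a ≤ slotTime m (ofLex p').1 (ofLex p').2 → ∀ t (ht : t < N + 1) (j : Fin m),
      slotTime m t j < a → setSlot ⟨i, hi⟩ p' ω v ⟨t, ht⟩ ⟨i, hi⟩ j = ω ⟨t, ht⟩ ⟨i, hi⟩ j := by
    intro p' ω v a ha t ht j hj
    rw [setSlot_apply, if_neg]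
    rintro ⟨h1, -, h2⟩
    rw [← h1, ← h2] at ha
    exact absurd hj (not_lt.2 ha)
  have hat : ∀ (p' : Fin (N + 1) ×ₗ Fin m) (ω : Samples n m k N) (v : Fin n) t, ∀ j < i,
      (setSlot ⟨i, hi⟩ p' ω v).at t j = ω.at t j := by
    intro p' ω v t j hj
    unfold Samples.at
    split_ifs with h
    · congr 1
      funext j'
      rw [setSlot_apply, if_neg]
      rintro ⟨-, h1, -⟩
      have := Fin.mk.inj_iff.1 h1
      omega
    · rfl
  have hloc : ∀ p p', p ≤ p' → ∀ ω v,
      active p (setSlot ⟨i, hi⟩ p' ω v) ↔ active p ω := by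
    intro p p' hp ω v
    refine and_congr_right fun _ => ⟨fun h => ?_, fun h => ?_⟩
    · exact h.congr ℓ hS hi (hat p' ω v)
        (hslot p' ω v _ (slotTime_le_of_le hp))
    · exact h.congr ℓ hS hi (fun t j hj => (hat p' ω v t j hj).symm)
        fun t ht j hj => (hslot p' ω v _ (slotTime_le_of_le hp) t ht j hj).symm
  -- `B` will be the last uncovered start. It is random, hence the union over its `N` values.
  have htrial : ∀ B : ℕ, P {ω | (∀ p ∈ Finset.univ.filter
        (fun p : Fin (N + 1) ×ₗ Fin m => ((ofLex p).1 : ℕ) ≤ B),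
        active p ω → getSlot ⟨i, hi⟩ p ω ≠ e) ∧ r * m ≤ ((Finset.univ.filter
        (fun p : Fin (N + 1) ×ₗ Fin m => ((ofLex p).1 : ℕ) ≤ B)).filter
          fun p => active p ω).card} ≤ ENNReal.ofReal (Real.exp (-(r * m / n))) := by
    intro B
    have := toOuterMeasure_trials_le (getSlot (n := n) (m := m) (N := N) ⟨i, hi⟩)
      (setSlot ⟨i, hi⟩) (fun p ω v => by simp [getSlot, setSlot_apply])
      (fun p ω => by
        funext t i' j
        rw [setSlot_apply]
        split_ifs with h
        · rw [h.1, h.2.1, h.2.2]; rfl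
        · rfl)
      (fun p ω v w => by
        funext t i' j
        simp only [setSlot_apply]
        split_ifs <;> rfl)
      (fun p p' hp ω v => by
        rw [getSlot, setSlot_apply, if_neg]
        · rfl
        · rintro ⟨h1, -, h2⟩
          exact hp.ne (ofLex.injective (Prod.ext h1 h2)))
      active hloc e (Finset.univ.filter
        (fun p : Fin (N + 1) ×ₗ Fin m => ((ofLex p).1 : ℕ) ≤ B)) (r * m)
    rw [Fintype.card_fin] at this
    exact this
  have hsub : {ω : Samples n m k N | r < (uncovered S ℓ ω e i).card} ⊆
      ⋃ B ∈ Finset.range N, {ω | (∀ p ∈ Finset.univ.filter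
        (fun p : Fin (N + 1) ×ₗ Fin m => ((ofLex p).1 : ℕ) ≤ B),
        active p ω → getSlot ⟨i, hi⟩ p ω ≠ e) ∧ r * m ≤ ((Finset.univ.filter
        (fun p : Fin (N + 1) ×ₗ Fin m => ((ofLex p).1 : ℕ) ≤ B)).filter
          fun p => active p ω).card} := by
    intro ω hω
    set U := uncovered S ℓ ω e i with hU
    have hmemU : ∀ b ∈ U, b < N ∧ S i ∣ b ∧ ¬ ∃ t c, Cover S k ω ℓ e i b t c := by
      intro b hb
      simpa [hU, uncovered] using hb
    have hω' : r < U.card := hω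
    have hne : U.Nonempty := by
      rw [← Finset.card_pos]
      exact_mod_cast hr.trans_lt hω'
    obtain ⟨hB1, hB2, hB3⟩ := hmemU _ (U.max'_mem hne)
    simp only [Set.mem_iUnion, Finset.mem_range]
    refine ⟨U.max' hne, hB1, ?_, ?_⟩
    -- A hit in an active slot up to day `B` would cover `B` itself.
    · intro p hp hact hsample
      exact hB3 ⟨N, e, cover_of_live_sample ω ℓ hS hN hℓ hi (ofLex p).1.2 (ofLex p).2.2 hact.1
        hsample hact.2 (Finset.mem_filter.1 hp).2 hB1⟩
    · have hcard : (U ×ˢ (Finset.univ : Finset (Fin m))).card ≤ ((Finset.univ.filter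
          (fun p : Fin (N + 1) ×ₗ Fin m => ((ofLex p).1 : ℕ) ≤ U.max' hne)).filter
          fun p => active p ω).card := by
        refine Finset.card_le_card_of_injOn
          (fun q => toLex ((Fin.ofNat (N + 1) q.1, q.2) : Fin (N + 1) × Fin m)) ?_ ?_
        · rintro ⟨b, j⟩ hq
          have hb := (Finset.mem_product.1 hq).1
          obtain ⟨hb1, hb2, hb3⟩ := hmemU b hb
          have hval : ((Fin.ofNat (N + 1) b : Fin (N + 1)) : ℕ) = b :=
            Nat.mod_eq_of_lt (by omega)
          -- An uncovered start is live up to time `b + 1`, so all its `m` slots are active.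
          have hlive : Live S k ω ℓ e i b (b + 1) := by
            by_contra hcon
            exact hb3 (exists_cover_of_not_live ω ℓ hS hℓ hi hcon)
          simp only [Finset.coe_filter, Finset.mem_filter, Finset.mem_univ, true_and,
            Set.mem_ofPred_eq, ofLex_toLex, hactive, hval]
          exact ⟨U.le_max' b hb, hb2, hlive.mono ω ℓ (slotTime_bounds j.2).2.le⟩
        · rintro ⟨b, j⟩ hq ⟨b', j'⟩ hq' heq
          have hb := (hmemU b (Finset.mem_product.1 hq).1).1
          have hb' := (hmemU b' (Finset.mem_product.1 hq').1).1
          have h1 := toLex.injective heq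
          have h2 : (Fin.ofNat (N + 1) b : Fin (N + 1)) = Fin.ofNat (N + 1) b' :=
            congrArg Prod.fst h1
          have h3 : j = j' := congrArg Prod.snd h1
          have h4 : b % (N + 1) = b' % (N + 1) := congrArg Fin.val h2
          rw [Nat.mod_eq_of_lt (by omega), Nat.mod_eq_of_lt (by omega)] at h4
          rw [h3, h4]
      rw [Finset.card_product, Finset.card_univ, Fintype.card_fin] at hcard
      have h5 : r * m ≤ U.card * m := mul_le_mul_of_nonneg_right hω'.le (Nat.cast_nonneg m)
      exact h5.trans (by exact_mod_cast hcard)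
  refine (P.mono hsub).trans ?_
  refine (MeasureTheory.measure_biUnion_finset_le (μ := P) _ _).trans ?_
  refine (Finset.sum_le_sum fun B _ => htrial B).trans ?_
  rw [Finset.sum_const, Finset.card_range, nsmul_eq_mul, ENNReal.ofReal_mul (Nat.cast_nonneg N),
    ENNReal.ofReal_natCast]

end uncovered

/-! ### The walk along the covers -/

section walk

/-- The last stop at or before time `t` of the walk from `0` whose stop after `b` is `nxt b`. -/
def lastStop (nxt : ℕ → ℕ) : ℕ → ℕ
  | 0 => 0
  | t + 1 => if nxt (lastStop nxt t) = t + 1 then t + 1 else lastStop nxt t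

variable {nxt : ℕ → ℕ} {N d : ℕ}

lemma lastStop_le (t : ℕ) : lastStop nxt t ≤ t := by
  induction t with
  | zero => exact le_rfl
  | succ t ih =>
    simp only [lastStop]
    split_ifs <;> omega

lemma lastStop_idem (t : ℕ) : lastStop nxt (lastStop nxt t) = lastStop nxt t := by
  induction t with
  | zero => rfl
  | succ t ih =>
    by_cases h : nxt (lastStop nxt t) = t + 1
    · have : lastStop nxt (t + 1) = t + 1 := by simp only [lastStop, h, if_true]
      rw [this, this]
    · have : lastStop nxt (t + 1) = lastStop nxt t := by simp only [lastStop, h, if_false]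
      rw [this, ih]

lemma lastStop_mono : Monotone (lastStop nxt) := by
  refine monotone_nat_of_le_succ fun t => ?_
  have := lastStop_le (nxt := nxt) t
  simp only [lastStop]
  split_ifs <;> omega

lemma lastStop_eq_of_lt {b u : ℕ} (hb : lastStop nxt b = b) (hbu : b ≤ u) (hu : u < nxt b) :
    lastStop nxt u = b := by
  induction u, hbu using Nat.le_induction with
  | base => exact hb
  | succ u hbu ih =>
    have ih := ih (by omega)
    simp only [lastStop, ih]
    rw [if_neg (by omega)]

/-- The walk never oversteps: time `t` lies in the jump that starts at its last stop. -/
lemma lastStop_spec (hN : 0 < N)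
    (hnxt : ∀ b < N, d ∣ b → b < nxt b ∧ nxt b ≤ N ∧ d ∣ nxt b) {t : ℕ} (ht : t < N) :
    d ∣ lastStop nxt t ∧ t < nxt (lastStop nxt t) := by
  induction t with
  | zero => exact ⟨dvd_zero _, (hnxt 0 hN (dvd_zero _)).1⟩
  | succ t ih =>
    obtain ⟨h1, h2⟩ := ih (by omega)
    have h3 := lastStop_le (nxt := nxt) t
    obtain ⟨h4, h5, h6⟩ := hnxt _ (by omega) h1
    simp only [lastStop]
    split_ifs with h
    · exact ⟨h ▸ h6, (hnxt (t + 1) ht (h ▸ h6)).1⟩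
    · exact ⟨h1, by omega⟩

lemma lastStop_self (hN : 0 < N)
    (hnxt : ∀ b < N, d ∣ b → b < nxt b ∧ nxt b ≤ N ∧ d ∣ nxt b) : lastStop nxt N = N := by
  cases N with
  | zero => omega
  | succ N =>
    obtain ⟨h1, h2⟩ := lastStop_spec hN hnxt (Nat.lt_succ_self N)
    have h3 := lastStop_le (nxt := nxt) N
    have h4 := (hnxt _ (by omega) h1).2.1
    have : nxt (lastStop nxt N) = N + 1 := by omega
    simp only [lastStop, this, if_true]

/-- Comparing step by step along the walk. -/
lemma sum_walk_le (hN : 0 < N)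
    (hnxt : ∀ b < N, d ∣ b → b < nxt b ∧ nxt b ≤ N ∧ d ∣ nxt b) (f : ℕ → ℕ → ℝ) (g : ℕ → ℝ)
    (hfg : ∀ b < N, d ∣ b → ∑ u ∈ Finset.Ico b (nxt b), f b u ≤ ∑ u ∈ Finset.Ico b (nxt b), g u) :
    ∑ u ∈ Finset.range N, f (lastStop nxt u) u ≤ ∑ u ∈ Finset.range N, g u := by
  -- The induction compares sums only up to the last stop, as the hypothesis concerns whole jumps.
  have key : ∀ t ≤ N, ∑ u ∈ Finset.range (lastStop nxt t), f (lastStop nxt u) u ≤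
      ∑ u ∈ Finset.range (lastStop nxt t), g u := by
    intro t
    induction t with
    | zero => intro _; simp [lastStop]
    | succ t ih =>
      intro ht
      have ih := ih (by omega)
      by_cases h : nxt (lastStop nxt t) = t + 1
      · have h1 : lastStop nxt (t + 1) = t + 1 := by simp only [lastStop, h, if_true]
        have h2 := lastStop_le (nxt := nxt) t
        rw [h1, ← Finset.sum_range_add_sum_Ico _ (show lastStop nxt t ≤ t + 1 by omega),
          ← Finset.sum_range_add_sum_Ico _ (show lastStop nxt t ≤ t + 1 by omega)]
        refine add_le_add ih ?_
        have h3 := hfg (lastStop nxt t) (by omega) (lastStop_spec hN hnxt (by omega)).1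
        rw [h] at h3
        refine le_trans (le_of_eq (Finset.sum_congr rfl fun u hu => ?_)) h3
        have hu' := Finset.mem_Ico.1 hu
        rw [lastStop_eq_of_lt (lastStop_idem t) hu'.1 (by omega)]
      · have : lastStop nxt (t + 1) = lastStop nxt t := by simp only [lastStop, h, if_false]
        rw [this]
        exact ih
  have := key N le_rfl
  rwa [lastStop_self hN hnxt] at this

lemma sum_Ico_blocks (f : ℕ → ℝ) (s q r : ℕ) :
    ∑ u ∈ Finset.Ico s (s + q * r), f u =
      ∑ v ∈ Finset.range q, ∑ u ∈ Finset.Ico (s + v * r) (s + v * r + r), f u := by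
  induction q with
  | zero => simp
  | succ q ih =>
    rw [Finset.sum_range_succ, ← ih, ← Finset.sum_Ico_consecutive f
      (show s ≤ s + q * r by omega) (show s + q * r ≤ s + (q + 1) * r by
        rw [add_mul]; omega)]
    congr 3
    ring

end walk

/-! ### The total regret for given samples and predictions -/

section total

variable {n m N : ℕ} {S : ℕ → ℕ} {k : ℕ} (ω : Samples n m k N) (ℓ : ℕ → Fin n → ℝ)

variable (S k) in
/-- The block of level `i` which starts at `s` is a stop of the walk, and is not covered at the
levels from `i` upwards. -/
def SplitAt (e : Fin n) (nxt : ℕ → ℕ) (i s : ℕ) : Prop :=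
  lastStop nxt s = s ∧ ∀ j, i ≤ j → j ≤ topLevel S k s → ¬ ∃ t c, Cover S k ω ℓ e j s t c

variable (S k) in
/-- The walk which jumps along the covers of the highest possible level. -/
structure IsCoverWalk (e : Fin n) (nxt : ℕ → ℕ) (com : ℕ → Fin n) : Prop where
  step : ∀ b, (∃ j ≤ topLevel S k b, Cover S k ω ℓ e j b (nxt b) (com b) ∧
      ∀ j', j < j' → j' ≤ topLevel S k b → ¬ ∃ t c, Cover S k ω ℓ e j' b t c) ∨
    ((∀ j ≤ topLevel S k b, ¬ ∃ t c, Cover S k ω ℓ e j b t c) ∧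
      nxt b = b + S 0 ∧ com b = e)

variable (S k) in
lemma exists_coverWalk (e : Fin n) : ∃ nxt com, IsCoverWalk S k ω ℓ e nxt com := by
  classical
  have h : ∀ b, ∃ p : ℕ × Fin n,
      (∃ j ≤ topLevel S k b, Cover S k ω ℓ e j b p.1 p.2 ∧
        ∀ j', j < j' → j' ≤ topLevel S k b → ¬ ∃ t c, Cover S k ω ℓ e j' b t c) ∨
      ((∀ j ≤ topLevel S k b, ¬ ∃ t c, Cover S k ω ℓ e j b t c) ∧
        p.1 = b + S 0 ∧ p.2 = e) := by
    intro b
    by_cases hb : ∃ j ≤ topLevel S k b, ∃ t c, Cover S k ω ℓ e j b t c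
    · obtain ⟨j, hj, hc⟩ := hb
      have hs := Nat.findGreatest_spec (P := fun j => ∃ t c, Cover S k ω ℓ e j b t c) hj hc
      obtain ⟨t, c, hc'⟩ := hs
      refine ⟨(t, c), Or.inl ⟨_, Nat.findGreatest_le _, hc', fun j' hj' hj'' => ?_⟩⟩
      exact Nat.findGreatest_is_greatest hj' hj''
    · push Not at hb
      refine ⟨(b + S 0, e), Or.inr ⟨fun j hj => ?_, rfl, rfl⟩⟩
      push Not
      exact hb j hj
  choose p hp using h
  exact ⟨fun b => (p b).1, fun b => (p b).2, ⟨hp⟩⟩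

variable {ω ℓ}

lemma IsCoverWalk.next (hS : LegalBlocks S k) (hN : S k = N) {e : Fin n} {nxt : ℕ → ℕ}
    {com : ℕ → Fin n} (hw : IsCoverWalk S k ω ℓ e nxt com) :
    ∀ b < N, S 0 ∣ b → b < nxt b ∧ nxt b ≤ N ∧ S 0 ∣ nxt b := by
  intro b hb hd
  rcases hw.step b with ⟨j, hj, hc, -⟩ | ⟨-, h1, -⟩
  · have := topLevel_lt (S := S) hS.levels_pos b
    exact ⟨hc.lt, hc.le, (hS.dvd_of_le (Nat.zero_le _) (by omega)).trans hc.dvd⟩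
  · have h2 : S 0 ∣ N := hN ▸ hS.dvd_of_le (Nat.zero_le _) le_rfl
    have h3 := Nat.le_of_dvd (by omega) (Nat.dvd_sub h2 hd)
    have := hS.size_pos
    rw [h1]
    exact ⟨by omega, by omega, dvd_add hd dvd_rfl⟩

lemma IsCoverWalk.sum_le (hS : LegalBlocks S k) (hN : S k = N)
    (hℓ : ∀ t e, ℓ t e ∈ Set.Icc (0 : ℝ) 1) {e : Fin n} {nxt : ℕ → ℕ}
    {com : ℕ → Fin n} (hw : IsCoverWalk S k ω ℓ e nxt com) :
    ∑ u ∈ Finset.range N, ℓ (u + 1) (com (lastStop nxt u)) ≤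
      (1 + Real.log (S k) / m) * ∑ u ∈ Finset.range N, ℓ (u + 1) e := by
  have hNpos : 0 < N := hN ▸ hS.pos le_rfl
  rw [Finset.mul_sum]
  refine sum_walk_le hNpos (hw.next hS hN) (fun b u => ℓ (u + 1) (com b)) _ fun b hb hd => ?_
  rw [← Finset.mul_sum]
  rcases hw.step b with ⟨j, hj, hc, -⟩ | ⟨-, -, h1⟩
  · exact hc.loss
  · rw [h1]
    have h1 : 0 ≤ ∑ u ∈ Finset.Ico b (nxt b), ℓ (u + 1) e :=
      Finset.sum_nonneg fun u _ => (hℓ _ _).1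
    have h2 : 0 ≤ Real.log (S k) / m := div_nonneg (Real.log_natCast_nonneg _) (Nat.cast_nonneg m)
    nlinarith

/-- A block which is not split, but whose parent is, has a constant comparator which is present
in the bucket. -/
lemma IsCoverWalk.exists_comparator (hS : LegalBlocks S k) (hN : S k = N) {e : Fin n} {nxt : ℕ → ℕ}
    {com : ℕ → Fin n} (hw : IsCoverWalk S k ω ℓ e nxt com) {i s : ℕ} (hi : i < k) (hs : S i ∣ s)
    (hsN : s < N)
    (hpar : i + 1 < k → SplitAt S k ω ℓ e nxt (i + 1) (s / S (i + 1) * S (i + 1)))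
    (hsplit : ¬ SplitAt S k ω ℓ e nxt i s) :
    ∃ x ∈ bkt S k ω ℓ s i, ∀ u ∈ Finset.Ico s (s + S i), com (lastStop nxt u) = x.expert := by
  have hNpos : 0 < N := hN ▸ hS.pos le_rfl
  obtain ⟨hd, hlt⟩ := lastStop_spec hNpos (hw.next hS hN) hsN
  have h0s : S 0 ∣ s := (hS.dvd_of_le (Nat.zero_le _) hi.le).trans hs
  set b := lastStop nxt s with hb
  have hbs : b ≤ s := lastStop_le s
  have hbb : lastStop nxt b = b := lastStop_idem s
  have htop := topLevel_lt (S := S) hS.levels_pos b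
  -- A cover of level above `i` would make `b` a boundary of the parent level. The parent's start is
  -- itself a stop, so it would equal `b`; but the parent is split, which excludes such covers.
  have hlevel : ∀ j ≤ topLevel S k b, (∃ t c, Cover S k ω ℓ e j b t c) → j ≤ i := by
    intro j hj hc
    by_contra hji
    have hk : i + 1 < k := by omega
    obtain ⟨hp1, hp2⟩ := hpar hk
    have hdb : S (i + 1) ∣ b := (hS.le_topLevel_iff hk hd).1 (by omega)
    have h1 : s / S (i + 1) * S (i + 1) ≤ b := by
      have h2 := lastStop_mono (nxt := nxt) (Nat.div_mul_le_self s (S (i + 1)))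
      rwa [hp1] at h2
    have h3 : b ≤ s / S (i + 1) * S (i + 1) := by
      have h4 := Nat.mul_le_mul_right (S (i + 1)) (Nat.div_le_div_right (c := S (i + 1)) hbs)
      rwa [Nat.div_mul_cancel hdb] at h4
    have h5 : s / S (i + 1) * S (i + 1) = b := le_antisymm h1 h3
    rw [h5] at hp2
    exact hp2 j (by omega) hj hc
  have hconst : s + S i ≤ nxt b → ∀ u ∈ Finset.Ico s (s + S i), com (lastStop nxt u) = com b := by
    intro hle u hu
    have hu := Finset.mem_Ico.1 hu
    rw [lastStop_eq_of_lt hbb (by omega) (by omega)]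
  -- If the block starts at a stop, the cover chosen there has level exactly `i` and reaches at
  -- least the end of the block. Otherwise the block starts strictly inside a jump, and the `inner`
  -- field of the cover applies.
  rcases hbs.eq_or_lt with heq | hblt
  · have hex : ∃ j, i ≤ j ∧ j ≤ topLevel S k b ∧ ∃ t c, Cover S k ω ℓ e j b t c := by
      by_contra hcon
      refine hsplit ⟨by rw [← hb, heq], fun j hij hj hc => hcon ⟨j, hij, ?_, ?_⟩⟩
      · rw [heq]; exact hj
      · rw [heq]; exact hc
    obtain ⟨j, hij, hj, hc⟩ := hex
    rcases hw.step b with ⟨j₀, hj₀, hc₀, hmax⟩ | ⟨hnone, -⟩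
    · have h1 := hlevel j hj hc
      have h2 := hlevel j₀ hj₀ ⟨_, _, hc₀⟩
      have h3 : ¬ j₀ < j := fun hlt => hmax j hlt hj hc
      obtain rfl : j₀ = i := by omega
      obtain ⟨x, hx, hxe⟩ := hc₀.mem
      rw [heq] at hx
      refine ⟨x, hx, fun u hu => ?_⟩
      rw [hxe]
      refine hconst ?_ u hu
      have h4 := Nat.le_of_dvd (by omega) (Nat.dvd_sub hc₀.dvd hs)
      omega
    · exact absurd hc (hnone j hj)
  · rcases hw.step b with ⟨j₀, hj₀, hc₀, -⟩ | ⟨-, hn, -⟩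
    · obtain ⟨hle, x, hx, hxe⟩ := hc₀.inner i (hlevel j₀ hj₀ ⟨_, _, hc₀⟩) hi s hs hblt hlt
      refine ⟨x, hx, fun u hu => ?_⟩
      rw [hxe]
      exact hconst hle u hu
    -- A default jump has length `S 0`, so no multiple of `S 0` lies strictly inside it.
    · have h4 := Nat.le_of_dvd (by omega) (Nat.dvd_sub h0s hd)
      omega

variable (S k ω ℓ) in
/-- The cost charged to time `t` for the splittings below level `i`. -/
def splitCost (e : Fin n) (D : ℝ) (i t : ℕ) : ℝ :=
  (if t ∈ uncovered S ℓ ω e 0 then (S 0 : ℝ) else 0) +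
    ∑ j ∈ Finset.range i,
      if t ∈ uncovered S ℓ ω e (j + 1) then (S (j + 1) : ℝ) / √(S j) * D else 0

lemma splitCost_nonneg (e : Fin n) {D : ℝ} (hD : 0 ≤ D) (i t : ℕ) :
    0 ≤ splitCost S k ω ℓ e D i t := by
  unfold splitCost
  refine add_nonneg ?_ (Finset.sum_nonneg fun j _ => ?_)
  · split_ifs
    · positivity
    · exact le_rfl
  · split_ifs
    · positivity
    · exact le_rfl

lemma mem_uncovered_of_splitAt {e : Fin n} {nxt : ℕ → ℕ} {i s : ℕ} (hi : i < k) (hs : S i ∣ s)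
    (hsN : s < N) (h : SplitAt S k ω ℓ e nxt i s) : s ∈ uncovered S ℓ ω e i := by
  classical
  simp only [uncovered, Finset.mem_filter, Finset.mem_range]
  exact ⟨hsN, hs, h.2 i le_rfl (le_topLevel hi hs)⟩

/-- The loss of the combined prediction of the levels `0, …, i` in a block of level `i`. -/
lemma block_loss_le [NeZero n] (hS : LegalBlocks S k) (hN : S k = N)
    (hℓ : ∀ t e, ℓ t e ∈ Set.Icc (0 : ℝ) 1) {L b : ℝ} (hL : 0 ≤ L) (hb0 : 0 ≤ b)
    {h : ℕ → Predictions n} (hc : Concentrated S k ω ℓ L h)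
    (hb : ∀ s i, i < k → s ≤ N → √(Real.log (bkt S k ω ℓ s i).length) ≤ b)
    {e : Fin n} {nxt : ℕ → ℕ} {com : ℕ → Fin n} (hw : IsCoverWalk S k ω ℓ e nxt com)
    {i s : ℕ} (hi : i < k) (hs : S i ∣ s) (hsN : s < N)
    (hpar : i + 1 < k → SplitAt S k ω ℓ e nxt (i + 1) (s / S (i + 1) * S (i + 1))) :
    ∑ u ∈ Finset.Ico s (s + S i), ℓ (u + 1) ((h (u + 1)).pred i) ≤
      ∑ u ∈ Finset.Ico s (s + S i), ℓ (u + 1) (com (lastStop nxt u)) +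
        √(S i) * (4 * L + 2 * b + 3) +
        ∑ u ∈ Finset.Ico s (s + S i), splitCost S k ω ℓ e (4 * L + 2 * b + 3) i u := by
  set D := 4 * L + 2 * b + 3 with hD
  have hD0 : 0 ≤ D := by positivity
  have hblock : ∀ i s, i < k → S i ∣ s → s < N → s + S i ≤ N := by
    intro i s hi hs hsN
    have h1 : S i ∣ N := hN ▸ hS.dvd_of_le hi.le le_rfl
    have := Nat.le_of_dvd (by omega) (Nat.dvd_sub h1 hs)
    omega
  have hcost : ∀ i s, 0 ≤ ∑ u ∈ Finset.Ico s (s + S i), splitCost S k ω ℓ e D i u := fun i s =>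
    Finset.sum_nonneg fun u _ => splitCost_nonneg e hD0 i u
  induction i generalizing s with
  | zero =>
    by_cases hsp : SplitAt S k ω ℓ e nxt 0 s
    -- A split block of the bottom level is charged the trivial loss bound `S 0`.
    · have hmem := mem_uncovered_of_splitAt hi hs hsN hsp
      have hsS : s ∈ Finset.Ico s (s + S 0) := by
        have := hS.size_pos
        simp only [Finset.mem_Ico]
        omega
      have h1 : (S 0 : ℝ) ≤ ∑ u ∈ Finset.Ico s (s + S 0), splitCost S k ω ℓ e D 0 u := by
        refine le_trans ?_ (Finset.single_le_sum
          (f := fun u => splitCost S k ω ℓ e D 0 u)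
          (fun u _ => splitCost_nonneg e hD0 0 u) hsS)
        simp [splitCost, hmem]
      have h2 : ∑ u ∈ Finset.Ico s (s + S 0), ℓ (u + 1) ((h (u + 1)).pred 0) ≤ S 0 := by
        refine (Finset.sum_le_sum fun u _ => (hℓ _ _).2).trans (le_of_eq ?_)
        simp
      have h3 : 0 ≤ ∑ u ∈ Finset.Ico s (s + S 0), ℓ (u + 1) (com (lastStop nxt u)) :=
        Finset.sum_nonneg fun u _ => (hℓ _ _).1
      have h4 : 0 ≤ √(S 0 : ℝ) * D := by positivity
      linarith
    · obtain ⟨x, hx, hcx⟩ := hw.exists_comparator hS hN hi hs hsN hpar hsp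
      have h1 := hc.sum_pred_le_expert ω ℓ hS hℓ hL hb hi hs (hblock _ _ hi hs hsN) hx
      have h2 : ∑ u ∈ Finset.Ico s (s + S 0), ℓ (u + 1) (com (lastStop nxt u)) =
          ∑ u ∈ Finset.Ico s (s + S 0), ℓ (u + 1) x.expert :=
        Finset.sum_congr rfl fun u hu => by rw [hcx u hu]
      linarith [hcost 0 s]
  | succ i ih =>
    by_cases hsp : SplitAt S k ω ℓ e nxt (i + 1) s
    -- In a split block, follow the levels below: `q` sub-blocks at cost √S_i · D each give
    -- S_{i+1}/√S_i · D, charged to the uncovered start `s`. The cost of following the levels below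
    -- is the √S_{i+1} · D of the claim itself.
    · have hik : i < k := by omega
      have hSi : 0 < S i := hS.pos hik.le
      obtain ⟨q, hq⟩ := hS.dvd i hik
      have hq' : S (i + 1) = q * S i := by rw [hq, mul_comm]
      have hmem := mem_uncovered_of_splitAt hi hs hsN hsp
      have h1 := hc.sum_pred_le_pred ω ℓ hS hℓ hL hb0 hi hs (hblock _ _ hi hs hsN)
      have hsub : ∀ v ∈ Finset.range q,
          ∑ u ∈ Finset.Ico (s + v * S i) (s + v * S i + S i), ℓ (u + 1) ((h (u + 1)).pred i) ≤
          ∑ u ∈ Finset.Ico (s + v * S i) (s + v * S i + S i),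
            ℓ (u + 1) (com (lastStop nxt u)) + √(S i) * D +
          ∑ u ∈ Finset.Ico (s + v * S i) (s + v * S i + S i), splitCost S k ω ℓ e D i u := by
        intro v hv
        have hv := Finset.mem_range.1 hv
        have hlt : v * S i < S (i + 1) := by
          rw [hq']
          exact Nat.mul_lt_mul_of_pos_right hv hSi
        have hle := hblock _ _ hi hs hsN
        refine ih hik (dvd_add ((hS.dvd i hik).trans hs) (dvd_mul_left _ _)) (by omega) fun _ => ?_
        have : (s + v * S i) / S (i + 1) * S (i + 1) = s := by
          obtain ⟨c, rfl⟩ := hs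
          rw [Nat.mul_add_div (by omega), Nat.div_eq_of_lt hlt, add_zero, mul_comm]
        rw [this]
        exact hsp
      have h2 := Finset.sum_le_sum hsub
      rw [Finset.sum_add_distrib, Finset.sum_add_distrib, ← sum_Ico_blocks, ← sum_Ico_blocks,
        ← sum_Ico_blocks, Finset.sum_const, Finset.card_range, nsmul_eq_mul, ← hq'] at h2
      have hsS : s ∈ Finset.Ico s (s + S (i + 1)) := by
        have := hS.pos hi.le
        simp only [Finset.mem_Ico]
        omega
      have h3 : (q : ℝ) * (√(S i) * D) = (S (i + 1) : ℝ) / √(S i) * D := by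
        have h4 : (0 : ℝ) < S i := by exact_mod_cast hSi
        have h5 : (S (i + 1) : ℝ) = q * (√(S i) * √(S i)) := by
          rw [Real.mul_self_sqrt h4.le, hq']
          push_cast
          ring
        rw [h5]
        have := Real.sqrt_pos.2 h4
        field_simp
      have h6 : ∑ u ∈ Finset.Ico s (s + S (i + 1)), splitCost S k ω ℓ e D i u +
          (S (i + 1) : ℝ) / √(S i) * D ≤
          ∑ u ∈ Finset.Ico s (s + S (i + 1)), splitCost S k ω ℓ e D (i + 1) u := by
        have h7 : ∀ u, splitCost S k ω ℓ e D (i + 1) u = splitCost S k ω ℓ e D i u +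
            if u ∈ uncovered S ℓ ω e (i + 1) then (S (i + 1) : ℝ) / √(S i) * D else 0 := by
          intro u
          rw [splitCost, splitCost, Finset.sum_range_succ, add_assoc]
        simp only [h7, Finset.sum_add_distrib]
        gcongr
        refine le_trans ?_ (Finset.single_le_sum (f := fun u =>
          if u ∈ uncovered S ℓ ω e (i + 1) then (S (i + 1) : ℝ) / √(S i) * D else 0)
          (fun u _ => ?_) hsS)
        · simp [hmem]
        · split_ifs
          · positivity
          · exact le_rfl
      linarith
    · obtain ⟨x, hx, hcx⟩ := hw.exists_comparator hS hN hi hs hsN hpar hsp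
      have h1 := hc.sum_pred_le_expert ω ℓ hS hℓ hL hb hi hs (hblock _ _ hi hs hsN) hx
      have h2 : ∑ u ∈ Finset.Ico s (s + S (i + 1)), ℓ (u + 1) (com (lastStop nxt u)) =
          ∑ u ∈ Finset.Ico s (s + S (i + 1)), ℓ (u + 1) x.expert :=
        Finset.sum_congr rfl fun u hu => by rw [hcx u hu]
      linarith [hcost (i + 1) s]

/-- The loss of the algorithm, when the random choices are concentrated and few blocks are
uncovered. -/
theorem total_loss_le [NeZero n] (hS : LegalBlocks S k) (hN : S k = N)
    (hℓ : ∀ t e, ℓ t e ∈ Set.Icc (0 : ℝ) 1) {L b R : ℝ} (hL : 0 ≤ L) (hb0 : 0 ≤ b)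
    {h : ℕ → Predictions n} (hc : Concentrated S k ω ℓ L h)
    (hb : ∀ s i, i < k → s ≤ N → √(Real.log (bkt S k ω ℓ s i).length) ≤ b) {e : Fin n}
    (hR : ∀ i < k, ((uncovered S ℓ ω e i).card : ℝ) ≤ R) :
    ∑ u ∈ Finset.range N, ℓ (u + 1) ((h (u + 1)).pred (k - 1)) ≤
      (1 + Real.log (S k) / m) * ∑ u ∈ Finset.range N, ℓ (u + 1) e +
        N / √(S (k - 1)) * (4 * L + 2 * b + 3) +
        R * (S 0 + ∑ j ∈ Finset.range (k - 1),
          (S (j + 1) : ℝ) / √(S j) * (4 * L + 2 * b + 3)) := by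
  set D := 4 * L + 2 * b + 3 with hD
  have hD0 : 0 ≤ D := by positivity
  obtain ⟨nxt, com, hw⟩ := exists_coverWalk S k ω ℓ e
  have hk := hS.levels_pos
  have hdvd : S (k - 1) ∣ N := hN ▸ hS.dvd_of_le (Nat.sub_le _ _) le_rfl
  obtain ⟨q, hq⟩ := hdvd
  have hq' : N = q * S (k - 1) := by rw [hq, mul_comm]
  have hSk : 0 < S (k - 1) := hS.pos (Nat.sub_le _ _)
  have hsub : ∀ v ∈ Finset.range q,
      ∑ u ∈ Finset.Ico (0 + v * S (k - 1)) (0 + v * S (k - 1) + S (k - 1)),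
        ℓ (u + 1) ((h (u + 1)).pred (k - 1)) ≤
      ∑ u ∈ Finset.Ico (0 + v * S (k - 1)) (0 + v * S (k - 1) + S (k - 1)),
        ℓ (u + 1) (com (lastStop nxt u)) + √(S (k - 1)) * D +
      ∑ u ∈ Finset.Ico (0 + v * S (k - 1)) (0 + v * S (k - 1) + S (k - 1)),
        splitCost S k ω ℓ e D (k - 1) u := by
    intro v hv
    have hlt : v * S (k - 1) < N := by
      rw [hq']
      exact Nat.mul_lt_mul_of_pos_right (Finset.mem_range.1 hv) hSk
    -- Top blocks have no parent, so the condition on it is vacuous.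
    exact block_loss_le hS hN hℓ hL hb0 hc hb hw (by omega)
      (by rw [zero_add]; exact dvd_mul_left _ _) (by omega) fun hcon => absurd hcon (by omega)
  have h1 := Finset.sum_le_sum hsub
  rw [Finset.sum_add_distrib, Finset.sum_add_distrib, ← sum_Ico_blocks, ← sum_Ico_blocks,
    ← sum_Ico_blocks, Finset.sum_const, Finset.card_range, nsmul_eq_mul, ← hq', zero_add,
    ← Finset.range_eq_Ico] at h1
  have h2 : (q : ℝ) * (√(S (k - 1)) * D) = N / √(S (k - 1)) * D := by
    have h4 : (0 : ℝ) < S (k - 1) := by exact_mod_cast hSk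
    have h5 : (N : ℝ) = q * (√(S (k - 1)) * √(S (k - 1))) := by
      rw [Real.mul_self_sqrt h4.le, hq']
      push_cast
      ring
    rw [h5]
    have := Real.sqrt_pos.2 h4
    field_simp
  have h3 := hw.sum_le hS hN hℓ
  have hcount : ∀ i < k, ∀ c : ℝ, 0 ≤ c →
      ∑ u ∈ Finset.range N, (if u ∈ uncovered S ℓ ω e i then c else 0) ≤ R * c := by
    intro i hi c hc0
    rw [← Finset.sum_filter, Finset.sum_const, nsmul_eq_mul]
    refine mul_le_mul_of_nonneg_right (le_trans ?_ (hR i hi)) hc0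
    exact_mod_cast Finset.card_le_card fun u hu => (Finset.mem_filter.1 hu).2
  have h4 : ∑ u ∈ Finset.range N, splitCost S k ω ℓ e D (k - 1) u ≤
      R * (S 0 + ∑ j ∈ Finset.range (k - 1), (S (j + 1) : ℝ) / √(S j) * D) := by
    simp only [splitCost]
    rw [Finset.sum_add_distrib, Finset.sum_comm, mul_add, Finset.mul_sum]
    refine add_le_add (hcount 0 (by omega) _ (Nat.cast_nonneg _))
      (Finset.sum_le_sum fun j hj => ?_)
    have := Finset.mem_range.1 hj
    exact hcount (j + 1) (by omega) _ (by positivity)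
  linarith

end total

/-! ### The regret with high probability -/

section highProbability

variable {n m N : ℕ} {S : ℕ → ℕ} {k : ℕ}

lemma runDays_congr [NeZero n] (ω : Samples n m k N) {ℓ ℓ' : ℕ → Fin n → ℝ} {T : ℕ}
    (H : ∀ t ∈ Finset.Icc 1 T, ℓ t = ℓ' t) : runDays S k ω ℓ T = runDays S k ω ℓ' T := by
  induction T with
  | zero => rfl
  | succ T ih =>
    change (runDays S k ω ℓ T).bind _ = (runDays S k ω ℓ' T).bind _
    rw [ih fun t ht => H t (Finset.Icc_subset_Icc_right (Nat.le_succ T) ht)]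
    congr 1
    funext s
    simp only [day, H (T + 1) (Finset.mem_Icc.2 ⟨by omega, le_rfl⟩)]

lemma regret_congr (ℓ : ℕ → Fin n → ℝ) {T : ℕ} {a a' : ℕ → Fin n}
    (H : ∀ t ∈ Finset.Icc 1 T, a t = a' t) : regret ℓ T a = regret ℓ T a' := by
  unfold regret
  rw [Finset.sum_congr rfl fun t ht => by rw [H t ht]]

/-- The loss vectors of the days `1, …, T`, followed by zeros. -/
def truncate (T : ℕ) (ℓ : ℕ → Fin n → ℝ) (t : ℕ) (e : Fin n) : ℝ :=
  if t ∈ Finset.Icc 1 T then ℓ t e else 0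

lemma sum_truncate {T : ℕ} (hT : T ≤ N) (ℓ : ℕ → Fin n → ℝ) (a : ℕ → Fin n) :
    ∑ u ∈ Finset.range N, truncate T ℓ (u + 1) (a (u + 1)) =
      ∑ t ∈ Finset.Icc 1 T, ℓ t (a t) := by
  simp only [truncate]
  rw [Finset.range_eq_Ico, Finset.sum_Ico_add'
    (fun t => if t ∈ Finset.Icc 1 T then ℓ t (a t) else 0) 0 N 1, Finset.sum_ite_mem]
  congr 1
  ext t
  simp only [Finset.mem_inter, Finset.mem_Ico, Finset.mem_Icc]
  omega

lemma truncate_mem {T : ℕ} {ℓ : ℕ → Fin n → ℝ}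
    (hℓ : ∀ t ∈ Finset.Icc 1 T, ∀ e, ℓ t e ∈ Set.Icc (0 : ℝ) 1) (t : ℕ) (e : Fin n) :
    truncate T ℓ t e ∈ Set.Icc (0 : ℝ) 1 := by
  unfold truncate
  split_ifs with h
  · exact hℓ t h e
  · exact ⟨le_rfl, zero_le_one⟩

/-- Day `T` need not end a block. Appending days of zero loss up to `S k` completes all blocks and
leaves events about the first `T` plays unchanged. -/
lemma toOuterMeasure_hierarchicalBaseline [NeZero n] {T : ℕ} (ℓ : ℕ → Fin n → ℝ) (hT : T ≤ S k)
    (s : Set (ℕ → Fin n))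
    (hs : ∀ a a' : ℕ → Fin n, (∀ t ∈ Finset.Icc 1 T, a t = a' t) → a ∈ s → a' ∈ s) :
    (hierarchicalBaseline n m k S ℓ T).toOuterMeasure s =
      pexp (PMF.uniformOfFintype (Samples n m k (S k))) fun ω =>
        (histLaw S k ω (truncate T ℓ) (S k)).toOuterMeasure
          {h | (fun t => (h t).pred (k - 1)) ∈ s} := by
  classical
  have hs' : ∀ a a' : ℕ → Fin n, (∀ t ∈ Finset.Icc 1 T, a t = a' t) → (a ∈ s ↔ a' ∈ s) :=
    fun a a' H => ⟨hs a a' H, hs a' a fun t ht => (H t ht).symm⟩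
  rw [toOuterMeasure_eq_pexp]
  change pexp ((PMF.uniformOfFintype (Samples n m k (S k))).bind fun ω =>
    (runDays S k ω ℓ T).bind fun s => PMF.pure s.play) _ = _
  rw [pexp_bind]
  congr 1
  funext ω
  have htr : ∀ t ∈ Finset.Icc 1 T, ℓ t = truncate T ℓ t := by
    intro t ht
    funext e
    simp only [truncate, ht, if_true]
  rw [runDays_congr ω htr, runDays_eq_map, PMF.bind_map, pexp_bind, toOuterMeasure_eq_pexp,
    pexp_histLaw_of_le S k ω _ hT]
  · congr 1
    funext h
    simp only [Function.comp_apply, pexp_pure]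
    have := hs' (stateOf S k ω (truncate T ℓ) h T).play (fun t => (h t).pred (k - 1))
      fun t ht => stateOf_play S k ω _ h (Finset.mem_Icc.1 ht).1 (Finset.mem_Icc.1 ht).2
    simp only [Set.indicator_apply, this, Set.mem_ofPred_eq, Pi.one_apply]
  · intro h h' H
    have := hs' (fun t => (h t).pred (k - 1)) (fun t => (h' t).pred (k - 1))
      fun t ht => by simp only [H t (Finset.mem_Icc.1 ht).2]
    simp only [Set.indicator_apply, this, Set.mem_ofPred_eq, Pi.one_apply]

/-- The regret of the hierarchical baseline with legal block sizes. -/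
theorem regret_highProb [NeZero n] (hS : LegalBlocks S k) (hm : 1 ≤ m) {T : ℕ} (hT : T ≤ S k)
    {ℓ : ℕ → Fin n → ℝ} (hℓ : ∀ t ∈ Finset.Icc 1 T, ∀ e, ℓ t e ∈ Set.Icc (0 : ℝ) 1)
    {L b r Q : ℝ} (hL : 1 ≤ L) (hb0 : 0 ≤ b) (hr : 0 ≤ r)
    (hb : √(Real.log (m * (2 * (S k + 1)) ^ k)) ≤ b)
    (hQ : Real.log (S k) / m * T + S k / √(S (k - 1)) * (4 * L + 2 * b + 3) +
        r * (S 0 + ∑ j ∈ Finset.range (k - 1),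
          (S (j + 1) : ℝ) / √(S j) * (4 * L + 2 * b + 3)) ≤ Q) :
    ENNReal.ofReal (1 - (k * S k * Real.exp (-(r * m / n)) + 2 * k * S k * Real.exp (-L))) ≤
      (hierarchicalBaseline n m k S ℓ T).toOuterMeasure {a | regret ℓ T a ≤ Q} := by
  classical
  have hℓ' := truncate_mem hℓ
  -- The best expert is determined by the losses alone, so no union bound over experts is needed.
  obtain ⟨e, he⟩ := exists_eq_ciInf_of_finite (f := fun e : Fin n => ∑ t ∈ Finset.Icc 1 T, ℓ t e)
  have hbkt : ∀ (ω : Samples n m k (S k)) s i, i < k → s ≤ S k →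
      √(Real.log (bkt S k ω (truncate T ℓ) s i).length) ≤ b := by
    intro ω s i hi hs
    refine le_trans (Real.sqrt_le_sqrt ?_) hb
    have h1 := length_bkt_le ω (truncate T ℓ) hS hi hs
    have h2 : m * (2 * (s + 1)) ^ (i + 1) ≤ m * (2 * (S k + 1)) ^ k :=
      Nat.mul_le_mul_left _ ((Nat.pow_le_pow_left (by omega) _).trans
        (Nat.pow_le_pow_right (by omega) (by omega)))
    have h3 : 0 < (bkt S k ω (truncate T ℓ) s i).length :=
      List.length_pos_iff.2 (bkt_ne_nil ω _ hS hm hi hs)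
    apply Real.log_le_log (by exact_mod_cast h3)
    exact_mod_cast h1.trans h2
  set bad : Set (Samples n m k (S k)) :=
    ⋃ i ∈ Finset.range k, {ω | r < (uncovered S (truncate T ℓ) ω e i).card} with hbad
  set P := (PMF.uniformOfFintype (Samples n m k (S k))).toOuterMeasure with hP
  have hPbad : P bad ≤ ENNReal.ofReal (k * S k * Real.exp (-(r * m / n))) := by
    refine (MeasureTheory.measure_biUnion_finset_le (μ := P) _ _).trans ?_
    refine (Finset.sum_le_sum fun i hi => toOuterMeasure_uncovered_le (truncate T ℓ) hS rfl hℓ' e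
      (Finset.mem_range.1 hi) hr).trans ?_
    rw [Finset.sum_const, Finset.card_range, nsmul_eq_mul, mul_assoc,
      ENNReal.ofReal_mul (Nat.cast_nonneg k), ENNReal.ofReal_natCast]
  have hgood : ∀ ω ∉ bad, ∀ h, Concentrated S k ω (truncate T ℓ) L h →
      regret ℓ T (fun t => (h t).pred (k - 1)) ≤ Q := by
    intro ω hω h hc
    have hR : ∀ i < k, ((uncovered S (truncate T ℓ) ω e i).card : ℝ) ≤ r := by
      intro i hi
      by_contra hcon
      exact hω (Set.mem_biUnion (Finset.mem_coe.2 (Finset.mem_range.2 hi)) (not_le.1 hcon))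
    have htot := total_loss_le hS rfl hℓ' (zero_le_one.trans hL) hb0 hc (hbkt ω) hR
    rw [sum_truncate hT ℓ fun t => (h t).pred (k - 1), sum_truncate hT ℓ fun _ => e] at htot
    have hle : ∑ t ∈ Finset.Icc 1 T, ℓ t e ≤ T := by
      refine (Finset.sum_le_sum fun t ht => (hℓ t ht e).2).trans (le_of_eq ?_)
      simp
    have hε : 0 ≤ Real.log (S k) / m := div_nonneg (Real.log_natCast_nonneg _) (Nat.cast_nonneg m)
    have := mul_le_mul_of_nonneg_left hle hε
    unfold regret
    rw [← he]
    simp only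
    linarith
  have hcompl : (hierarchicalBaseline n m k S ℓ T).toOuterMeasure {a | regret ℓ T a ≤ Q}ᶜ ≤
      ENNReal.ofReal (k * S k * Real.exp (-(r * m / n)) + 2 * k * S k * Real.exp (-L)) := by
    rw [toOuterMeasure_hierarchicalBaseline ℓ hT _ fun a a' H ha => by
      simp only [Set.mem_compl_iff, Set.mem_ofPred_eq] at ha ⊢
      rwa [← regret_congr ℓ H]]
    rw [ENNReal.ofReal_add (by positivity) (by positivity)]
    -- Bad samples are given conditional failure probability 1; for the others only the predictions
    -- can fail.
    have hpt : ∀ ω : Samples n m k (S k), (histLaw S k ω (truncate T ℓ) (S k)).toOuterMeasure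
        {h | (fun t => (h t).pred (k - 1)) ∈ ({a | regret ℓ T a ≤ Q}ᶜ : Set (ℕ → Fin n))} ≤
        bad.indicator 1 ω + ENNReal.ofReal (2 * k * S k * Real.exp (-L)) := by
      intro ω
      by_cases hω : ω ∈ bad
      · rw [Set.indicator_of_mem hω]
        refine le_trans ?_ le_self_add
        rw [Pi.one_apply, ← toOuterMeasure_add_compl _ _]
        exact le_self_add
      · refine le_trans ?_ le_add_self
        refine le_trans (MeasureTheory.OuterMeasure.mono _ ?_)
          (concentrated_compl_le ω (truncate T ℓ) hS hm hℓ' hL)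
        intro h hh hc
        exact hh (hgood ω hω h hc)
    refine (pexp_mono _ hpt).trans ?_
    rw [pexp_add, pexp_const, ← toOuterMeasure_eq_pexp]
    gcongr
  have hadd := toOuterMeasure_add_compl (hierarchicalBaseline n m k S ℓ T) {a | regret ℓ T a ≤ Q}
  rw [ENNReal.ofReal_sub _ (by positivity), ENNReal.ofReal_one, ← hadd]
  exact tsub_le_iff_right.2 (by gcongr)

end highProbability

/-! ### The prescribed block sizes -/

section parameters

lemma idealBlock_zero_pos {x : ℝ} (hx : 0 < x) (k : ℕ) : 0 < idealBlock x k 0 := by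
  rw [idealBlock]
  exact Real.rpow_pos_of_pos hx _

/-- In exponents to base T_0 the recursion is a_i = (3/2)a_{i-1} - (1/2)a_{i-2} with a_{-1} = 0 and
a_0 = 1. -/
lemma idealBlock_eq {x : ℝ} (hx : 0 < x) (k i : ℕ) :
    idealBlock x k i = idealBlock x k 0 ^ ((2 : ℝ) - (1 / 2) ^ i) := by
  have h0 := idealBlock_zero_pos hx k
  suffices h : idealBlock x k i = idealBlock x k 0 ^ ((2 : ℝ) - (1 / 2) ^ i) ∧
      idealBlock x k (i + 1) = idealBlock x k 0 ^ ((2 : ℝ) - (1 / 2) ^ (i + 1)) from h.1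
  induction i with
  | zero =>
    refine ⟨by norm_num, ?_⟩
    change idealBlock x k 0 ^ (3 / 2 : ℝ) / √1 = _
    rw [Real.sqrt_one, div_one]
    norm_num
  | succ i ih =>
    refine ⟨ih.2, ?_⟩
    change idealBlock x k (i + 1) ^ (3 / 2 : ℝ) / √(idealBlock x k i) = _
    rw [ih.1, ih.2, ← Real.rpow_mul h0.le, Real.sqrt_eq_rpow, ← Real.rpow_mul h0.le,
      ← Real.rpow_sub h0]
    congr 1
    rw [pow_succ, pow_succ]
    ring

lemma idealBlock_pos {x : ℝ} (hx : 0 < x) (k i : ℕ) : 0 < idealBlock x k i := by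
  rw [idealBlock_eq hx]
  exact Real.rpow_pos_of_pos (idealBlock_zero_pos hx k) _

/-- The purpose of the recursion: splitting a block costs the same at every level. -/
lemma idealBlock_succ_div_sqrt {x : ℝ} (hx : 0 < x) (k i : ℕ) :
    idealBlock x k (i + 1) / √(idealBlock x k i) = idealBlock x k 0 := by
  have h0 := idealBlock_zero_pos hx k
  rw [idealBlock_eq hx k (i + 1), idealBlock_eq hx k i, Real.sqrt_eq_rpow, ← Real.rpow_mul h0.le,
    ← Real.rpow_sub h0]
  nth_rewrite 2 [← Real.rpow_one (idealBlock x k 0)]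
  congr 1
  rw [pow_succ]
  ring

lemma two_pow_sub_pos (k : ℕ) : (0 : ℝ) < 2 ^ (k + 1) - 1 := by
  have : (1 : ℝ) ≤ 2 ^ k := one_le_pow₀ one_le_two
  rw [pow_succ]
  linarith

/-- The top block size is `x`, up to the factor `x ^ (1 / (2 ^ (k + 1) - 1))`. -/
lemma idealBlock_top {x : ℝ} (hx : 0 < x) {k : ℕ} (hk : 1 ≤ k) :
    idealBlock x k (k - 1) * x ^ (1 / ((2 : ℝ) ^ (k + 1) - 1)) = x := by
  obtain ⟨k, rfl⟩ : ∃ j, k = j + 1 := ⟨k - 1, by omega⟩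
  rw [Nat.add_sub_cancel, idealBlock_eq hx, idealBlock, ← Real.rpow_mul hx.le, ← Real.rpow_add hx]
  nth_rewrite 2 [← Real.rpow_one x]
  congr 1
  have h1 := two_pow_sub_pos (k + 1)
  have h2 : (0 : ℝ) < 2 ^ k := by positivity
  have e₁ : (2 : ℝ) ^ (k + 1 + 1) = 2 ^ k * 2 * 2 := by ring
  have e₂ : (2 : ℝ) ^ (k + 1) = 2 ^ k * 2 := by ring
  rw [e₁] at h1
  rw [one_div_pow, e₁, e₂]
  generalize (2 : ℝ) ^ k = K at *
  generalize hd : K * 2 * 2 - 1 = d at *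
  field_simp
  linarith

lemma idealBlock_zero_eq {x : ℝ} (hx : 0 < x) (k : ℕ) :
    idealBlock x k 0 = √x * √(x ^ (1 / ((2 : ℝ) ^ (k + 1) - 1))) := by
  rw [idealBlock, Real.sqrt_eq_rpow, Real.sqrt_eq_rpow, ← Real.rpow_mul hx.le, ← Real.rpow_add hx]
  congr 1
  have h1 := two_pow_sub_pos k
  rw [pow_succ] at *
  field_simp
  ring

lemma le_two_rpow {y : ℝ} (hy : 0 < y) {a : ℝ} (h : Real.logb 2 y ≤ a) : y ≤ 2 ^ a := by
  rwa [← Real.logb_le_iff_le_rpow one_lt_two hy]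

/-- With at least `log₂ log₂ x - 1` levels, the correction factor is bounded. -/
lemma rpow_correction_le {x : ℝ} (hx : 2 ≤ x) {k : ℕ}
    (hk : Real.logb 2 (Real.logb 2 x) ≤ k + 1) :
    x ^ (1 / ((2 : ℝ) ^ (k + 1) - 1)) ≤ 4 := by
  have hx0 : 0 < x := by linarith
  have hlog : 1 ≤ Real.logb 2 x := by
    rw [Real.le_logb_iff_rpow_le one_lt_two hx0, Real.rpow_one]
    exact hx
  have h1 := le_two_rpow (by linarith) hk
  have h2 : (2 : ℝ) ^ ((k : ℝ) + 1) = 2 * 2 ^ k := by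
    rw [Real.rpow_add two_pos, Real.rpow_natCast, Real.rpow_one, mul_comm]
  rw [h2] at h1
  have h3 : (1 : ℝ) ≤ 2 ^ k := one_le_pow₀ one_le_two
  have h4 := two_pow_sub_pos k
  have h5 : x ^ (1 / ((2 : ℝ) ^ (k + 1) - 1)) ≤ 2 ^ (2 : ℝ) := by
    -- Here log₂ x ≤ 2^{k+1} ≤ 2(2^{k+1} - 1).
    apply le_two_rpow (Real.rpow_pos_of_pos hx0 _)
    rw [Real.logb_rpow_eq_mul_logb_of_pos hx0, one_div, inv_mul_le_iff₀ h4, pow_succ]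
    linarith
  refine h5.trans (le_of_eq ?_)
  norm_num

lemma le_rpow_correction {x : ℝ} (hx : 1 ≤ x) (k : ℕ) :
    1 ≤ x ^ (1 / ((2 : ℝ) ^ (k + 1) - 1)) :=
  Real.one_le_rpow hx (one_div_nonneg.2 (two_pow_sub_pos k).le)

/-- Powers of two near the ideal block sizes. -/
lemma exists_prescribedBlocks {n m T : ℕ} (hm : 1 ≤ m) (hmn : m ≤ n)
    (hT : 16 * ((n : ℝ) / m) ≤ T) : ∃ (k : ℕ) (S : ℕ → ℕ), PrescribedBlocks 1 n m T k S := by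
  have hm0 : (0 : ℝ) < m := by exact_mod_cast hm
  have hmn' : (m : ℝ) ≤ n := by exact_mod_cast hmn
  have hn0 : (0 : ℝ) < n := hm0.trans_le hmn'
  set x : ℝ := (T : ℝ) * m / n with hx
  have hx16 : 16 ≤ x := by
    rw [hx, le_div_iff₀ hn0]
    have := mul_le_mul_of_nonneg_right hT hm0.le
    rwa [mul_assoc, div_mul_cancel₀ _ hm0.ne'] at this
  have hxT : x ≤ T := by
    rw [hx, div_le_iff₀ hn0]
    exact mul_le_mul_of_nonneg_left hmn' (Nat.cast_nonneg T)
  have hx0 : 0 < x := by linarith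
  have hlog : 4 ≤ Real.logb 2 x := by
    rw [Real.le_logb_iff_rpow_le one_lt_two hx0]
    norm_num
    exact hx16
  have hloglog : 2 ≤ Real.logb 2 (Real.logb 2 x) := by
    rw [Real.le_logb_iff_rpow_le one_lt_two (by linarith)]
    norm_num
    exact hlog
  set k := ⌊Real.logb 2 (Real.logb 2 x)⌋₊ with hk
  have hk1 : (k : ℝ) ≤ Real.logb 2 (Real.logb 2 x) := Nat.floor_le (by linarith)
  have hk2 : Real.logb 2 (Real.logb 2 x) < k + 1 := Nat.lt_floor_add_one _
  have hk3 : 2 ≤ k := Nat.le_floor (by exact_mod_cast hloglog)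
  have hK : (2 : ℝ) ^ k ≤ Real.logb 2 x := by
    rw [← Real.rpow_natCast, ← Real.le_logb_iff_rpow_le one_lt_two (by linarith)]
    exact hk1
  have hpos := fun i => idealBlock_pos hx0 k i
  have hL0 : (2 : ℝ) ^ k / 2 ≤ Real.logb 2 (idealBlock x k 0) := by
    rw [idealBlock, Real.logb_rpow_eq_mul_logb_of_pos hx0]
    have h1 := two_pow_sub_pos k
    have h2 : (1 : ℝ) / 2 ≤ 2 ^ k / (2 ^ (k + 1) - 1) := by
      rw [div_le_div_iff₀ two_pos h1, pow_succ]
      linarith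
    have h3 : (0 : ℝ) ≤ 2 ^ k := by positivity
    calc (2 : ℝ) ^ k / 2 = 1 / 2 * 2 ^ k := by ring
      _ ≤ _ := mul_le_mul h2 hK h3 (by positivity)
  have hL : ∀ i, Real.logb 2 (idealBlock x k i) =
      (2 - (1 / 2) ^ i) * Real.logb 2 (idealBlock x k 0) := by
    intro i
    rw [idealBlock_eq hx0, Real.logb_rpow_eq_mul_logb_of_pos (hpos 0)]
  have hKpos : (0 : ℝ) < 2 ^ k := by positivity
  -- The ideal sizes at least double from level to level, so rounding down to powers of two keeps
  -- them distinct. The gap of exponents is 2^{-(i+1)} log₂ T_0, and log₂ T_0 ≥ 2^{k-1}.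
  have hgap : ∀ i, i + 1 < k →
      Real.logb 2 (idealBlock x k i) + 1 ≤ Real.logb 2 (idealBlock x k (i + 1)) := by
    intro i hi
    rw [hL, hL (i + 1)]
    have h1 : (1 : ℝ) ≤ (1 / 2) ^ (i + 1) * Real.logb 2 (idealBlock x k 0) := by
      have h2 : (1 / 2 : ℝ) ^ (k - 1) ≤ (1 / 2) ^ (i + 1) :=
        pow_le_pow_of_le_one (by norm_num) (by norm_num) (by omega)
      have h3 : (1 / 2 : ℝ) ^ (k - 1) * (2 ^ k / 2) = 1 := by
        obtain ⟨j, hj⟩ : ∃ j, k = j + 1 := ⟨k - 1, by omega⟩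
        rw [hj, Nat.add_sub_cancel, pow_succ, one_div_pow]
        field_simp
      exact h3.symm.le.trans (mul_le_mul h2 hL0 (by positivity) (by positivity))
    rw [pow_succ] at *
    linarith
  have hLpos : ∀ i, 0 ≤ Real.logb 2 (idealBlock x k i) := by
    intro i
    rw [hL]
    refine mul_nonneg ?_ (le_trans (by positivity) hL0)
    have : (1 / 2 : ℝ) ^ i ≤ 1 := pow_le_one₀ (by norm_num) (by norm_num)
    linarith
  set q : ℕ → ℕ := fun i => 2 ^ ⌊Real.logb 2 (idealBlock x k i)⌋₊ with hq
  have hq1 : ∀ i, (q i : ℝ) ≤ idealBlock x k i := by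
    intro i
    simp only [hq]
    push_cast
    rw [← Real.rpow_natCast, ← Real.le_logb_iff_rpow_le one_lt_two (hpos i)]
    exact Nat.floor_le (hLpos i)
  have hq2 : ∀ i, idealBlock x k i ≤ 2 * q i := by
    intro i
    refine (le_two_rpow (hpos i) (Nat.lt_floor_add_one _).le).trans (le_of_eq ?_)
    simp only [hq]
    push_cast
    rw [Real.rpow_add two_pos, Real.rpow_natCast, Real.rpow_one, mul_comm]
  have hqpos : ∀ i, 0 < q i := fun i => by simp only [hq]; positivity
  have hqT : q (k - 1) < T := by
    have h1 := idealBlock_top hx0 (k := k) (by omega)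
    have h2 : 1 < x ^ (1 / ((2 : ℝ) ^ (k + 1) - 1)) :=
      Real.one_lt_rpow (by linarith) (one_div_pos.2 (two_pow_sub_pos k))
    have h3 : (q (k - 1) : ℝ) < T := by
      have := hq1 (k - 1)
      have := hpos (k - 1)
      nlinarith
    exact_mod_cast h3
  -- The quotient of `T` by the top block size, rounded up.
  set c := (T + q (k - 1) - 1) / q (k - 1) with hc
  have hc1 : T ≤ c * q (k - 1) := by
    have h1 := Nat.div_add_mod (T + q (k - 1) - 1) (q (k - 1))
    have h2 := Nat.mod_lt (T + q (k - 1) - 1) (hqpos (k - 1))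
    rw [← hc, mul_comm] at h1
    omega
  have hc2 : c * q (k - 1) < T + q (k - 1) := by
    have h1 := Nat.div_mul_le_self (T + q (k - 1) - 1) (q (k - 1))
    rw [← hc] at h1
    omega
  set S : ℕ → ℕ := fun i => if i < k then q i else c * q (k - 1) with hS
  have hSlt : ∀ i, i < k → S i = q i := fun i hi => by simp only [hS, hi, if_true]
  have hSk : S k = c * q (k - 1) := by simp only [hS, lt_irrefl, if_false]
  have hexp : ∀ i, i + 1 < k → ⌊Real.logb 2 (idealBlock x k i)⌋₊ + 1 ≤
      ⌊Real.logb 2 (idealBlock x k (i + 1))⌋₊ := by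
    intro i hi
    rw [← Nat.floor_add_one (hLpos i)]
    exact Nat.floor_le_floor (hgap i hi)
  refine ⟨k, S, by omega, ?_, ?_, ?_, ?_, ?_, ?_, ?_, ?_⟩
  · rw [abs_le]
    constructor <;> linarith
  · rw [hSlt 0 (by omega)]
    exact hqpos 0
  · intro i hi
    rw [hSlt i hi]
    by_cases h : i + 1 < k
    · rw [hSlt _ h]
      exact Nat.pow_lt_pow_right (by norm_num) (hexp i h)
    · obtain rfl : i = k - 1 := by omega
      rw [show k - 1 + 1 = k by omega, hSk]
      exact hqT.trans_le hc1
  · intro i hi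
    rw [hSlt i hi]
    by_cases h : i + 1 < k
    · rw [hSlt _ h]
      exact pow_dvd_pow 2 ((Nat.le_succ _).trans (hexp i h))
    · obtain rfl : i = k - 1 := by omega
      rw [show k - 1 + 1 = k by omega, hSk]
      exact dvd_mul_left _ _
  · intro i hi
    rw [hSlt i hi]
    exact hq2 i
  · intro i hi
    rw [hSlt i hi]
    linarith [hq1 i, hpos i]
  · rw [hSk]
    exact hc1
  · rw [hSk, hSlt (k - 1) (by omega)]
    exact hc2

lemma PrescribedBlocks.legal {b : ℝ} {n m T k : ℕ} {S : ℕ → ℕ}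
    (h : PrescribedBlocks b n m T k S) : LegalBlocks S k :=
  ⟨h.levels_pos, h.size_pos, h.strict, h.dvd⟩

/-- The orders of magnitude of prescribed block sizes. -/
lemma PrescribedBlocks.bounds {n m T k : ℕ} {S : ℕ → ℕ} (h : PrescribedBlocks 1 n m T k S) {x : ℝ}
    (hx : x = (T : ℝ) * m / n) (hx16 : 16 ≤ x) :
    (S 0 : ℝ) ≤ 4 * √x ∧ x ≤ 8 * S (k - 1) ∧ (S (k - 1) : ℝ) ≤ 2 * x ∧
      ∀ j, j + 1 < k → (S (j + 1) : ℝ) / √(S j) ≤ 8 * √x := by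
  obtain ⟨hk, hlev, -, -, -, hlow, hupp, -, -⟩ := h
  rw [← hx] at hlev hlow hupp
  have hx0 : 0 < x := by linarith
  have hcorr := rpow_correction_le (x := x) (by linarith) (k := k) (by linarith [(abs_le.1 hlev).1])
  have hcorr1 := le_rpow_correction (x := x) (by linarith) k
  have htop := idealBlock_top hx0 hk
  have hT0 : idealBlock x k 0 ≤ 2 * √x := by
    rw [idealBlock_zero_eq hx0, mul_comm]
    refine mul_le_mul_of_nonneg_right ?_ (Real.sqrt_nonneg _)
    rw [Real.sqrt_le_left two_pos.le]
    linarith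
  have hpos := fun i => idealBlock_pos hx0 k i
  have hlast := hlow (k - 1) (by omega)
  have hlast' := hupp (k - 1) (by omega)
  have h1 := hpos (k - 1)
  -- Each constant combines the rounding factor 2 with the correction factor, which is at most 4 (at
  -- most 2 under a square root).
  refine ⟨?_, ?_, ?_, ?_⟩
  · linarith [hupp 0 (by omega)]
  · nlinarith
  · nlinarith
  · intro j hj
    have h2 := hupp (j + 1) hj
    have h3 := hlow j (by omega)
    have h4 : √(idealBlock x k j) ≤ 2 * √(S j) := by
      rw [Real.sqrt_le_left (by positivity), mul_pow, Real.sq_sqrt (Nat.cast_nonneg _)]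
      have : (0 : ℝ) ≤ S j := Nat.cast_nonneg _
      linarith
    have h5 := Real.sqrt_pos.2 (hpos j)
    have h6 : 0 < √(S j : ℝ) := by linarith
    have h7 := idealBlock_succ_div_sqrt hx0 k j
    rw [div_eq_iff h5.ne'] at h7
    rw [div_le_iff₀ h6]
    have h8 : idealBlock x k 0 * √(idealBlock x k j) ≤ 2 * √x * (2 * √(S j)) :=
      mul_le_mul hT0 h4 h5.le (by positivity)
    linarith

end parameters

/-! ### The regret with prescribed block sizes -/

section final

variable {n m T k : ℕ} {S : ℕ → ℕ}

lemma PrescribedBlocks.size_le (h : PrescribedBlocks 1 n m T k S) (hm : 1 ≤ m) (hmn : m ≤ n)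
    (hx : 16 ≤ (T : ℝ) * m / n) : (S k : ℝ) ≤ 3 * T ∧ (T : ℝ) * m / n ≤ T := by
  have hn0 : (0 : ℝ) < n := by exact_mod_cast hm.trans hmn
  have hxT : (T : ℝ) * m / n ≤ T := by
    rw [div_le_iff₀ hn0]
    exact mul_le_mul_of_nonneg_left (by exact_mod_cast hmn) (Nat.cast_nonneg T)
  have h1 : (S k : ℝ) < T + S (k - 1) := by exact_mod_cast h.horizon_lt
  have h2 := (h.bounds rfl hx).2.2.1
  exact ⟨by linarith, hxT⟩

/-- The number of levels is at most logarithmic. -/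
lemma PrescribedBlocks.levels_le (h : PrescribedBlocks 1 n m T k S) {x : ℝ}
    (hx : x = (T : ℝ) * m / n) (hx16 : 16 ≤ x) : (k : ℝ) ≤ 1 + 4 * Real.log x := by
  have h1 := (abs_le.1 h.levels).2
  rw [← hx] at h1
  have hlog2 := Real.log_two_gt_d9
  have hlogb : ∀ y : ℝ, 1 ≤ y → Real.logb 2 y ≤ 2 * Real.log y := by
    intro y hy
    rw [Real.logb, div_le_iff₀ (by linarith)]
    have := Real.log_nonneg hy
    nlinarith
  have h2 : 1 ≤ Real.logb 2 x := by
    rw [Real.le_logb_iff_rpow_le one_lt_two (by linarith), Real.rpow_one]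
    linarith
  have h3 := hlogb _ h2
  have h4 := Real.log_le_self (zero_le_one.trans h2)
  have h5 := hlogb x (by linarith)
  linarith

/-- The sum of the three regret terms. -/
lemma regret_terms_le {n m T x Y γ L : ℝ} (hγ : 0 < γ) (hm0 : 0 < m) (hn0 : 0 < n)
    (hx : x = T * m / n) (hx16 : 16 ≤ x) (hY2 : 2 ≤ Y) (hL0 : 0 ≤ L) (hLY : L ≤ (5 + γ) * Y)
    (hkY : (k : ℝ) ≤ 5 * Y) (hN3 : S k ≤ 3 * T) (hlogN : Real.log (S k) ≤ 2 + Y)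
    (hS0 : S 0 ≤ 4 * √x) (hSlow : x ≤ 8 * S (k - 1))
    (hratio : ∀ j, j + 1 < k → (S (j + 1) : ℝ) / √(S j) ≤ 8 * √x) :
    Real.log (S k) / m * T + S k / √(S (k - 1)) * (4 * L + 2 * (4 * Y) + 3) +
        n / m * L * (S 0 + ∑ j ∈ Finset.range (k - 1),
          (S (j + 1) : ℝ) / √(S j) * (4 * L + 2 * (4 * Y) + 3)) ≤
      (2 + 9 * (30 + 4 * γ) + (5 + γ) * (4 + 40 * (30 + 4 * γ))) * Y ^ (3 : ℝ) *
        (T / m + √(T * n / m)) := by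
  have hT0 : 0 ≤ T := by linarith [Nat.cast_nonneg (α := ℝ) (S k)]
  set Z := √(T * n / m) with hZ
  have hsx : 0 < √x := Real.sqrt_pos.2 (by linarith)
  have hZx : Z = n / m * √x := by
    rw [hZ, show T * n / m = (n / m) ^ 2 * x by rw [hx]; field_simp,
      Real.sqrt_mul (sq_nonneg _), Real.sqrt_sq (by positivity)]
  have hTx : T = √x * Z := by
    rw [hZx, mul_left_comm, Real.mul_self_sqrt (by linarith), hx]
    field_simp
  have hZ0 : 0 ≤ Z := Real.sqrt_nonneg _
  set D := 4 * L + 2 * (4 * Y) + 3 with hD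
  have hD0 : 0 ≤ D := by linarith
  -- Here 4(5 + γ) + 8 = 28 + 4γ, and the constant 3 is absorbed in 2Y because Y ≥ 2.
  have hDY : D ≤ (30 + 4 * γ) * Y := by linarith
  have hY3 : Y ^ (3 : ℝ) = Y ^ 3 := by exact_mod_cast Real.rpow_natCast Y 3
  have hterm₁ : Real.log (S k) / m * T ≤ 2 * Y * (T / m) := by
    rw [div_mul_eq_mul_div, ← mul_div_assoc]
    gcongr
    linarith
  have hterm₂ : S k / √(S (k - 1)) * D ≤ 9 * Z * ((30 + 4 * γ) * Y) := by
    refine mul_le_mul ?_ hDY hD0 (by positivity)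
    have h1 : √x ≤ 3 * √(S (k - 1)) := by
      rw [Real.sqrt_le_left (by positivity), mul_pow, Real.sq_sqrt (Nat.cast_nonneg _)]
      linarith
    have h2 : 0 < √(S (k - 1) : ℝ) := by linarith
    rw [div_le_iff₀ h2]
    have h3 := mul_le_mul_of_nonneg_right h1 hZ0
    linarith
  -- The cube arises here: `L`, `k` and `D` each contribute one factor `Y`.
  have hterm₃ : n / m * L * (S 0 + ∑ j ∈ Finset.range (k - 1),
      (S (j + 1) : ℝ) / √(S j) * D) ≤
      (5 + γ) * (4 + 40 * (30 + 4 * γ)) * Y ^ 3 * Z := by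
    have h1 : ∑ j ∈ Finset.range (k - 1), (S (j + 1) : ℝ) / √(S j) * D ≤ k * (8 * √x * D) := by
      calc _ ≤ ∑ j ∈ Finset.range (k - 1), 8 * √x * D :=
            Finset.sum_le_sum fun j hj => mul_le_mul_of_nonneg_right
              (hratio j (by have := Finset.mem_range.1 hj; omega)) hD0
        _ = (k - 1 : ℕ) * (8 * √x * D) := by simp
        _ ≤ _ := by
          refine mul_le_mul_of_nonneg_right ?_ (by positivity)
          exact_mod_cast Nat.sub_le _ _
    have h2 : (k : ℝ) * D ≤ 5 * Y * ((30 + 4 * γ) * Y) := mul_le_mul hkY hDY hD0 (by linarith)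
    have h3 : 4 + 8 * (k * D) ≤ (4 + 40 * (30 + 4 * γ)) * Y ^ 2 := by
      have : 1 ≤ Y ^ 2 := one_le_pow₀ (by linarith)
      linarith
    have h4 : L * (4 + 8 * (k * D)) ≤ (5 + γ) * Y * ((4 + 40 * (30 + 4 * γ)) * Y ^ 2) :=
      mul_le_mul hLY h3 (by positivity) (by positivity)
    calc n / m * L * (S 0 + ∑ j ∈ Finset.range (k - 1), (S (j + 1) : ℝ) / √(S j) * D)
        ≤ n / m * L * (4 * √x + k * (8 * √x * D)) := by gcongr
      _ = L * (4 + 8 * (k * D)) * Z := by rw [hZx]; ring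
      _ ≤ (5 + γ) * Y * ((4 + 40 * (30 + 4 * γ)) * Y ^ 2) * Z :=
          mul_le_mul_of_nonneg_right h4 hZ0
      _ = _ := by ring
  rw [hY3]
  have hYY : Y ≤ Y ^ 3 := le_self_pow₀ (by linarith) (by norm_num)
  have hTm : 0 ≤ T / m := by positivity
  have e₁ : 2 * Y * (T / m) ≤ 2 * Y ^ 3 * (T / m) := by gcongr
  have e₂ : 9 * Z * ((30 + 4 * γ) * Y) ≤ 9 * Z * ((30 + 4 * γ) * Y ^ 3) := by gcongr
  have e₃ : 0 ≤ 2 * Y ^ 3 * Z := by positivity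
  have e₄ : 0 ≤ (9 * (30 + 4 * γ) + (5 + γ) * (4 + 40 * (30 + 4 * γ))) * Y ^ 3 * (T / m) := by
    positivity
  linarith

theorem PrescribedBlocks.regret_le [NeZero n] (h : PrescribedBlocks 1 n m T k S) (hm : 1 ≤ m)
    (hmn : m ≤ n) (hT : 16 * ((n : ℝ) / m) ≤ T) {γ : ℝ} (hγ : 0 < γ) {ℓ : ℕ → Fin n → ℝ}
    (hℓ : ∀ t ∈ Finset.Icc 1 T, ∀ e, ℓ t e ∈ Set.Icc (0 : ℝ) 1) :
    ENNReal.ofReal (1 - (T : ℝ) ^ (-γ)) ≤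
      (hierarchicalBaseline n m k S ℓ T).toOuterMeasure
        {a | regret ℓ T a ≤
          (2 + 9 * (30 + 4 * γ) + (5 + γ) * (4 + 40 * (30 + 4 * γ))) *
            Real.log ((n : ℝ) * T) ^ (3 : ℝ) * ((T : ℝ) / m + √((T : ℝ) * n / m))} := by
  have hm1 : (1 : ℝ) ≤ m := by exact_mod_cast hm
  have hm0 : (0 : ℝ) < m := by linarith
  have hmn' : (m : ℝ) ≤ n := by exact_mod_cast hmn
  have hn0 : (0 : ℝ) < n := hm0.trans_le hmn'
  set x : ℝ := (T : ℝ) * m / n with hx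
  have hx16 : 16 ≤ x := by
    rw [hx, le_div_iff₀ hn0]
    have := mul_le_mul_of_nonneg_right hT hm0.le
    rwa [mul_assoc, div_mul_cancel₀ _ hm0.ne'] at this
  obtain ⟨hN3, hxT⟩ := h.size_le hm hmn hx16
  rw [← hx] at hxT
  have hT16 : (16 : ℝ) ≤ T := hx16.trans hxT
  have hS := h.legal
  have hkN : (k : ℝ) ≤ S k := by exact_mod_cast (hS.lt_size le_rfl).le
  have hk1 : (1 : ℝ) ≤ k := by exact_mod_cast hS.levels_pos
  set Y := Real.log ((n : ℝ) * T) with hY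
  have hlogT : Real.log T ≤ Y :=
    Real.log_le_log (by linarith) (le_mul_of_one_le_left (by linarith) (by linarith))
  have hlogm : Real.log m ≤ Y := Real.log_le_log hm0 (by nlinarith)
  have hlogx : Real.log x ≤ Y := (Real.log_le_log (by linarith) hxT).trans hlogT
  have hlog2 := Real.log_two_gt_d9
  have hlog2' := Real.log_two_lt_d9
  have hlogT2 : 2 ≤ Real.log T := by
    have h1 : Real.log ((2 : ℝ) ^ 4) ≤ Real.log T :=
      Real.log_le_log (by norm_num) (by norm_num; exact_mod_cast hT16)
    rw [Real.log_pow] at h1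
    push_cast at h1
    linarith
  have hY2 : 2 ≤ Y := hlogT2.trans hlogT
  have hlog4 : Real.log 4 = 2 * Real.log 2 := by
    rw [show (4 : ℝ) = 2 ^ 2 by norm_num, Real.log_pow]
    push_cast
    ring
  have hlog8 : Real.log 8 = 3 * Real.log 2 := by
    rw [show (8 : ℝ) = 2 ^ 3 by norm_num, Real.log_pow]
    push_cast
    ring
  have hlogN : Real.log (S k) ≤ 2 + Y := by
    have h1 : Real.log (S k) ≤ Real.log (4 * T) :=
      Real.log_le_log (by linarith) (by linarith)
    rw [Real.log_mul (by norm_num) (by linarith), hlog4] at h1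
    linarith
  have hTγ : 1 ≤ (T : ℝ) ^ γ := Real.one_le_rpow (by linarith) hγ.le
  -- Chosen so that the failure probability 3k·S_k·e^{-L}, with L = log w, is three quarters of
  -- T^{-γ}.
  set w : ℝ := 4 * k * S k * (T : ℝ) ^ γ with hw
  have hN1 : (1 : ℝ) ≤ S k := hk1.trans hkN
  have hkN1 : 1 ≤ (k : ℝ) * S k := one_le_mul_of_one_le_of_one_le hk1 hN1
  have hw4 : 4 ≤ w := by
    have := one_le_mul_of_one_le_of_one_le hkN1 hTγ
    rw [hw]
    linarith
  set L := Real.log w with hL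
  have hL1 : 1 ≤ L := by
    have := Real.log_le_log (by norm_num) hw4
    rw [hlog4] at this
    linarith
  have hLY : L ≤ (5 + γ) * Y := by
    have h1 : L = Real.log 4 + Real.log k + Real.log (S k) + γ * Real.log T := by
      rw [hL, hw, Real.log_mul (by positivity) (by positivity),
        Real.log_mul (by positivity) (by positivity), Real.log_mul (by norm_num) (by positivity),
        Real.log_rpow (by linarith)]
    have h2 : Real.log k ≤ Real.log (S k) := Real.log_le_log (by linarith) hkN
    have h3 := mul_le_mul_of_nonneg_left hlogT hγ.le
    rw [h1, hlog4]
    linarith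
  have hexpL : Real.exp (-L) = w⁻¹ := by
    rw [Real.exp_neg, hL, Real.exp_log (by linarith)]
  have hkY : (k : ℝ) ≤ 5 * Y := by
    have := h.levels_le hx hx16
    linarith
  -- The logarithm is at most Y + 5Y(3 + Y), which is below (4Y)² for Y ≥ 2.
  have hb : √(Real.log (m * (2 * (S k + 1)) ^ k)) ≤ 4 * Y := by
    rw [Real.sqrt_le_left (by linarith), Real.log_mul hm0.ne' (by positivity), Real.log_pow]
    have h1 : Real.log (2 * (S k + 1)) ≤ 3 + Y := by
      have h2 : Real.log (2 * (S k + 1)) ≤ Real.log (8 * T) :=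
        Real.log_le_log (by positivity) (by linarith)
      rw [Real.log_mul (x := 8) (by norm_num) (by linarith), hlog8] at h2
      linarith
    have h2 : 0 ≤ Real.log (2 * ((S k : ℝ) + 1)) := Real.log_nonneg (by linarith)
    have h3 : (k : ℝ) * Real.log (2 * (S k + 1)) ≤ 5 * Y * (3 + Y) :=
      mul_le_mul hkY h1 h2 (by linarith)
    nlinarith
  obtain ⟨hS0, hSlow, -, hratio⟩ := h.bounds hx hx16
  -- With r = (n/m)L the exponent r·m/n of the sampling bound equals L.
  have hfinal := regret_highProb hS hm h.le_horizon hℓ (L := L) (b := 4 * Y) (r := n / m * L)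
    (Q := (2 + 9 * (30 + 4 * γ) + (5 + γ) * (4 + 40 * (30 + 4 * γ))) * Y ^ (3 : ℝ) *
      ((T : ℝ) / m + √((T : ℝ) * n / m))) hL1 (by linarith) (by positivity) hb ?_
  · refine le_trans (ENNReal.ofReal_le_ofReal ?_) hfinal
    have h1 : (n : ℝ) / m * L * m / n = L := by field_simp
    rw [h1, hexpL, Real.rpow_neg (by linarith)]
    have h2 : (k : ℝ) * S k * w⁻¹ = ((T : ℝ) ^ γ)⁻¹ / 4 := by
      rw [hw]
      field_simp
    have h3 : 0 < ((T : ℝ) ^ γ)⁻¹ := by positivity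
    have h4 : 2 * (k : ℝ) * S k * w⁻¹ = 2 * (((T : ℝ) ^ γ)⁻¹ / 4) := by
      rw [← h2]
      ring
    rw [h2, h4]
    linarith
  · exact regret_terms_le hγ hm0 hn0 hx hx16 hY2 (by linarith) hLY hkY hN3 hlogN hS0 hSlow hratio

end final

end

end HierBaseline

theorem mainTheorem3 :
    ∃ C b p : ℝ, 0 < C ∧
      (∀ n m T : ℕ, 1 ≤ m → m ≤ n → C * ((n : ℝ) / m) ≤ T →
        ∃ (k : ℕ) (S : ℕ → ℕ), HierBaseline.PrescribedBlocks b n m T k S) ∧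
      (∀ γ : ℝ, 0 < γ → ∃ A : ℝ, ∀ (n m T : ℕ) [NeZero n],
        1 ≤ m → m ≤ n → C * ((n : ℝ) / m) ≤ T →
        ∀ (k : ℕ) (S : ℕ → ℕ), HierBaseline.PrescribedBlocks b n m T k S →
        ∀ ℓ : ℕ → Fin n → ℝ, (∀ t ∈ Finset.Icc 1 T, ∀ e, ℓ t e ∈ Set.Icc (0 : ℝ) 1) →
          ENNReal.ofReal (1 - (T : ℝ) ^ (-γ)) ≤
            (HierBaseline.hierarchicalBaseline n m k S ℓ T).toOuterMeasure
              {a | HierBaseline.regret ℓ T a ≤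
                A * Real.log ((n : ℝ) * T) ^ p *
                  ((T : ℝ) / m + √((T : ℝ) * n / m))}) := by
  -- The value 16 gives log₂ log₂ x ≥ 2, hence at least two levels in the construction; b = 1 allows
  -- for rounding log₂ log₂ x down to an integer.
  refine ⟨16, 1, 3, by norm_num, fun n m T hm hmn hT => ?_, fun γ hγ => ?_⟩
  · exact HierBaseline.exists_prescribedBlocks hm hmn hT
  · exact ⟨_, fun n m T _ hm hmn hT k S h ℓ hℓ => h.regret_le hm hmn hT hγ hℓ⟩
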